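/- Let $k$ be a field of characteristic zero, $V=k((z))$, $V_+=k[[z]]$, and let $g\ge 0$ be an integer. A rational point of $\mathrm{Gr}^{n}(V)$ is a subspace $U\subset V$ such that $U\cap V_+$ and $V/(U+V_+)$ are finite-dimensional and $\dim (U\cap V_+)-\dim V/(U+V_+)=n$. Its orthogonal $U^\perp$ is taken for the pairing $(f,h)=\operatorname{Res}_{z=0}fh\,dz$. Write $t=(t_1,t_2,\dots)$, $[z]=(z,\tfrac{z^2}{2},\tfrac{z^3}{3},\dots)$, $v(t,z)=\exp\big(\sum_{i>0}t_iz^{-i}\big)$, and let $k\{\{t\}\}=\varprojlim_n k[[t_1,\dots,t_n]]$. The $\tau$-function $\tau_U(t)\in k\{\{t\}\}$ of a rational point $U\in\mathrm{Gr}^n(V)$, defined up to a factor in $k^*$, is the determinant of the map $z^{-n}U\to V/V_+$, $f\mapsto v(t,z)f$, with respect to the basis $z^{-1},z^{-2},\dots$ of $V/V_+$ and a basis $w_1,w_2,\dots$ of $z^{-n}U$ for which there is an $N$ with $w_i-z^{-i}\in z^{-N}k[[z]]$ for all $i\ge N$; that is, $\tau_U$ is the coefficientwise limit, as $m\to\infty$,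 of the $m\times m$ determinants formed by the coefficients of $z^{-l}$ in $v(t,z)w_i$, $1\le l,i\le m$. The Baker-Akhiezer function and its adjoint are $$\psi_U(z,t)=v(t,z)^{-1}\,\frac{\tau_U(t+[z])}{\tau_U(t)},\qquad \psi^*_U(z,t)=\psi_{U^\perp}(z,-t).$$ Put $\tilde\partial_t=\big(\tfrac{\partial}{\partial t_1},\tfrac12\tfrac{\partial}{\partial t_2},\tfrac13\tfrac{\partial}{\partial t_3},\dots\big)$, and define the polynomials $p_j$ by $\exp\big(\sum_{i>0}x_iz^i\big)=\sum_{j\ge0}p_j(x)z^j$, with $p_j=0$ for $j<0$. For a Young diagram $\mu$ with rows $\mu_1\ge\mu_2\ge\dots\ge\mu_n>0$ let $\chi_\mu=\det\big(p_{\mu_i-i+j}\big)_{1\le i,j\le n}$ be its Schur polynomial (where $i\,x_i$ stands for the $i$-th power sum). For an integer $\alpha$ let $D_{\lambda,\alpha}=\sum_\mu\chi_\mu$, the sum over the Young diagrams $\mu\subseteq\lambda$ such that $\lambda-\mu$ is a horizontal $\alpha$-strip ($\alpha$ cells, no two in the same column). **Theorem.** Let $U$ be a rational point of $\mathrm{Gr}^{1-g}(V)$.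 The condition $$\operatorname{Res}_{z=0}\psi_U(z,t)\,\psi_U(z,t')\,\psi^*_U(z,t'')\,\frac{dz}{z^{2+g}}=0$$ is equivalent to the infinite set of equations $$P(\lambda_1,\lambda_2,\lambda_3)\big(\tau_U(t)\,\tau_U(t')\,\tau_U(t'')\big)\Big|_{t=t'=t''=0}=0,$$ one for every three Young diagrams $\lambda_1,\lambda_2,\lambda_3$, where $P(\lambda_1,\lambda_2,\lambda_3)$ is the differential operator $$\sum p_{\beta_1}(\tilde\partial_t)D_{\lambda_1,\alpha_1}(-\tilde\partial_t)\cdot p_{\beta_2}(\tilde\partial_{t'})D_{\lambda_2,\alpha_2}(-\tilde\partial_{t'})\cdot p_{\beta_3}(-\tilde\partial_{t''})D_{\lambda_3,\alpha_3}(\tilde\partial_{t''}),$$ the sum being over the 6-tuples $\{\alpha_1,\beta_1,\alpha_2,\beta_2,\alpha_3,\beta_3\}$ of integers with $-\alpha_1+\beta_1-\alpha_2+\beta_2-\alpha_3+\beta_3=1+g$. -/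

import Mathlib

open scoped TensorProduct

noncomputable section

namespace SatoGr

/-! ### The infinite Grassmannian of `V = k((z))` -/

/-- The element `z ^ n` of `k((z))`. -/
def zpow (k : Type*) [Field k] (n : ℤ) : LaurentSeries k := HahnSeries.single n 1

/-- The subspace `z ^ n k[[z]]` of `k((z))`. -/
def zPlus (k : Type*) [Field k] (n : ℤ) : Submodule k (LaurentSeries k) where
  carrier := {f | ∀ j < n, f.coeff j = 0}
  add_mem' hf hg j hj := by simp [hf j hj, hg j hj]
  zero_mem' j _ := by simp
  smul_mem' c f hf j hj := by simp [hf j hj]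

/-- `V_+ = k[[z]]` as a subspace of `V = k((z))`. -/
abbrev VPlus (k : Type*) [Field k] : Submodule k (LaurentSeries k) := zPlus k 0

/-- The index `dim (U ∩ V_+) - dim V / (U + V_+)` of a (discrete) subspace of `V`. -/
def index {k : Type*} [Field k] (U : Submodule k (LaurentSeries k)) : ℤ :=
  (Module.finrank k ↥(U ⊓ VPlus k) : ℤ) - Module.finrank k (LaurentSeries k ⧸ (U ⊔ VPlus k))

/-- `U` is a rational point of `Gr^n(V)`: a subspace of `V` such that `U ∩ V_+` and
`V / (U + V_+)` are finite-dimensional, of index `n`. -/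
structure IsRationalPoint {k : Type*} [Field k] (n : ℤ)
    (U : Submodule k (LaurentSeries k)) : Prop where
  finite_inf : FiniteDimensional k ↥(U ⊓ VPlus k)
  finite_quot : FiniteDimensional k (LaurentSeries k ⧸ (U ⊔ VPlus k))
  index_eq : index U = n

/-- Multiplication by `z ^ n` on `k((z))`. -/
def mulZ (k : Type*) [Field k] (n : ℤ) : LaurentSeries k →ₗ[k] LaurentSeries k where
  toFun f := zpow k n * f
  map_add' f g := mul_add _ f g
  map_smul' c f := by
    change zpow k n * (c • f) = c • (zpow k n * f)
    rw [← HahnSeries.C_mul_eq_smul, ← HahnSeries.C_mul_eq_smul, mul_left_comm]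

/-- The homothety `U ↦ z ^ n U`. -/
def homothety {k : Type*} [Field k] (n : ℤ) (U : Submodule k (LaurentSeries k)) :
    Submodule k (LaurentSeries k) :=
  U.map (mulZ k n)

/-- The orthogonal `U^⊥` for the residue pairing `(f, g) = Res_{z=0} f g dz`. -/
def orth {k : Type*} [Field k] (U : Submodule k (LaurentSeries k)) :
    Submodule k (LaurentSeries k) where
  carrier := {f | ∀ u ∈ U, (f * u).coeff (-1) = 0}
  add_mem' hf hg u hu := by simp [add_mul, hf u hu, hg u hu]
  zero_mem' u _ := by simp
  smul_mem' c f hf u hu := by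
    rw [← HahnSeries.C_mul_eq_smul, mul_assoc, HahnSeries.C_mul_eq_smul, HahnSeries.coeff_smul,
      hf u hu, smul_zero]

/-! ### Formal series

`MvPowerSeries σ k` consists of all formal series in the variables `σ`, and so it is the ring
`k{{t}} = lim k[[t_1, ..., t_n]]` for `σ = ℕ+`. Likewise `MvPowerSeries σ (LaurentSeries k)` is
the completed tensor product of `k((z))` and `k{{t}}`: its elements are formal series in `t`
whose coefficients are Laurent series in `z`. -/

theorem algebraMap_laurent {k : Type*} [Field k] (c : k) :
    algebraMap k (LaurentSeries k) c = HahnSeries.C c := by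
  rw [HahnSeries.algebraMap_apply']
  simp

/-- The coefficient of `z ^ n`, taken in every coefficient of a series in `t`; it is
`k{{t}}`-linear. -/
def zCoeff {k : Type*} [Field k] {σ : Type*} (n : ℤ) :
    MvPowerSeries σ (LaurentSeries k) →ₗ[MvPowerSeries σ k] MvPowerSeries σ k where
  toFun F := fun d => (MvPowerSeries.coeff d F).coeff n
  map_add' F G := by
    funext d
    change (MvPowerSeries.coeff d (F + G)).coeff n = _
    rw [map_add, HahnSeries.coeff_add]
    rfl
  map_smul' r F := by
    classical
    let G : MvPowerSeries σ k := fun d => (MvPowerSeries.coeff d F).coeff n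
    have key : ∀ d, (MvPowerSeries.coeff d (r • F)).coeff n = MvPowerSeries.coeff d (r * G) := by
      intro d
      rw [Algebra.smul_def, MvPowerSeries.coeff_mul, MvPowerSeries.coeff_mul,
        HahnSeries.coeff_sum]
      refine Finset.sum_congr rfl fun x _ => ?_
      rw [MvPowerSeries.algebraMap_apply'', MvPowerSeries.coeff_map, algebraMap_laurent,
        HahnSeries.C_mul_eq_smul, HahnSeries.coeff_smul]
      rfl
    funext d
    exact key d

/-- The series `∑_{i > 0} t_i z^{-i}`. -/
def timeSeries (k : Type*) [Field k] : MvPowerSeries ℕ+ (LaurentSeries k) :=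
  fun d => ∑ i ∈ d.support, if d = Finsupp.single i 1 then zpow k (-(i : ℤ)) else 0

/-- The universal element `v(t, z) = exp (∑_{i > 0} t_i z^{-i})` of `Γ_-`. -/
def vSeries (k : Type*) [Field k] [CharZero k] : MvPowerSeries ℕ+ (LaurentSeries k) :=
  (PowerSeries.exp k).subst (timeSeries k)

/-- The inverse `v(t, z)^{-1} = exp (- ∑_{i > 0} t_i z^{-i})`. -/
def vInv (k : Type*) [Field k] [CharZero k] : MvPowerSeries ℕ+ (LaurentSeries k) :=
  (PowerSeries.exp k).subst (-timeSeries k)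

/-- The exponential may be substituted: the constant coefficient of `∑ t_i z^{-i}` is `0`. -/
theorem hasSubst_timeSeries (k : Type*) [Field k] : PowerSeries.HasSubst (timeSeries k) := by
  refine PowerSeries.HasSubst.of_constantCoeff_zero ?_
  rw [← MvPowerSeries.coeff_zero_eq_constantCoeff_apply, MvPowerSeries.coeff_apply, timeSeries]
  simp

/-! ### `τ`-functions -/

/-- `w 0, w 1, w 2, ...` is an admissible basis of `W`: it is a basis of `W`, and modulo some
`z^{-N} k[[z]]` all but finitely many `w i` are equal to `z^{-(i+1)}`. Such bases exist when `W`
has index `0`, and they represent the nonzero elements of the fibre at `W` of the determinant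
bundle. -/
structure IsAdmissibleBasis {k : Type*} [Field k] (W : Submodule k (LaurentSeries k))
    (w : ℕ → LaurentSeries k) : Prop where
  linearIndependent : LinearIndependent k w
  span_eq : Submodule.span k (Set.range w) = W
  eventually_eq : ∃ N : ℕ, ∀ i ≥ N, w i - zpow k (-(i + 1 : ℤ)) ∈ zPlus k (-(N : ℤ))

/-- The `m × m` corner of the matrix of `W → V / V_+`, `f ↦ v(t, z) f`, with respect to the basis
`w` of `W` and the basis `z^{-1}, z^{-2}, ...` of `V / V_+`: its `(l, i)` entry is the coefficient
of `z^{-(l+1)}` in `v(t, z) w_i`. -/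
def tauMatrix {k : Type*} [Field k] [CharZero k] (w : ℕ → LaurentSeries k) (m : ℕ) :
    Matrix (Fin m) (Fin m) (MvPowerSeries ℕ+ k) :=
  Matrix.of fun l i => zCoeff (-((l : ℕ) + 1 : ℤ)) (vSeries k * MvPowerSeries.C (w i))

/-- `τ` is a `τ`-function `τ_U` of `U` (such a function is unique up to a nonzero constant).
With `n` the index of `U`, `τ_U` is the determinant of the map
`z^{-n} U → V / V_+`, `f ↦ v(t, z) f`, relative to an admissible basis of `z^{-n} U`: the limit,
coefficient by coefficient, of the determinants of the finite corners of its matrix. -/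
def IsTauFunction {k : Type*} [Field k] [CharZero k] (U : Submodule k (LaurentSeries k))
    (τ : MvPowerSeries ℕ+ k) : Prop :=
  ∃ w : ℕ → LaurentSeries k, IsAdmissibleBasis (homothety (-index U) U) w ∧
    ∀ d : ℕ+ →₀ ℕ, ∀ᶠ m in Filter.atTop,
      MvPowerSeries.coeff d (tauMatrix w m).det = MvPowerSeries.coeff d τ

/-! ### Baker-Akhiezer functions -/

/-- The substitution `t_i ↦ t_i + z^i / i`, where `Sum.inr ()` is the variable `z`. -/
def shiftVars (k : Type*) [Field k] (i : ℕ+) : MvPowerSeries (ℕ+ ⊕ Unit) k :=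
  MvPowerSeries.X (Sum.inl i) +
    MvPowerSeries.C (((i : ℕ) : k)⁻¹) * MvPowerSeries.X (Sum.inr ()) ^ (i : ℕ)

/-- The substitution `t_i ↦ t_i + z^i / i` makes sense for all formal series. -/
theorem hasSubst_shiftVars (k : Type*) [Field k] : MvPowerSeries.HasSubst (shiftVars k) where
  const_coeff i := by
    have : MvPowerSeries.constantCoeff (shiftVars k i) = 0 := by
      simp [shiftVars]
    simp [this]
  coeff_zero d := by
    classical
    refine ((d.support.preimage Sum.inl Sum.inl_injective.injOn).finite_toSet.union
      ((Set.finite_Iic (d (Sum.inr ()))).preimage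
        (f := fun i : ℕ+ => (i : ℕ)) PNat.coe_injective.injOn)).subset ?_
    intro i hi
    by_contra hcon
    simp only [Set.mem_union, Finset.mem_coe, Finset.mem_preimage, Finsupp.mem_support_iff,
      Set.mem_preimage, Set.mem_Iic, not_or, not_not, not_le] at hcon
    apply hi
    rw [shiftVars, map_add, MvPowerSeries.coeff_C_mul, MvPowerSeries.coeff_X,
      MvPowerSeries.coeff_X_pow, if_neg, if_neg]
    · simp
    · intro h
      have := DFunLike.congr_fun h (Sum.inr ())
      simp at this
      omega
    · intro h
      have := DFunLike.congr_fun h (Sum.inl i)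
      simp [hcon.1] at this

/-- `τ(t + [z])`, where `[z] = (z, z^2 / 2, z^3 / 3, ...)`, as a series in `t` with coefficients
in `k((z))`. -/
def tauShift {k : Type*} [Field k] (τ : MvPowerSeries ℕ+ k) :
    MvPowerSeries ℕ+ (LaurentSeries k) :=
  fun d => HahnSeries.ofPowerSeries ℤ k (PowerSeries.mk fun n =>
    MvPowerSeries.coeff (d.sumElim (Finsupp.single () n)) (MvPowerSeries.subst (shiftVars k) τ))

/-- The numerator `v(t, z)^{-1} τ(t + [z])` of the Baker-Akhiezer function. -/
def bakerNum {k : Type*} [Field k] [CharZero k] (τ : MvPowerSeries ℕ+ k) :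
    MvPowerSeries ℕ+ (LaurentSeries k) :=
  vInv k * tauShift τ

/-- The substitution `t ↦ -t`, that is, `g ↦ g⁻¹` on `Γ_-`. -/
def negTime {R : Type*} [CommRing R] (F : MvPowerSeries ℕ+ R) : MvPowerSeries ℕ+ R :=
  MvPowerSeries.rescale (fun _ => -1) F

/-- The series `F(t)`, `F(t')`, `F(t'')` for `a = 0, 1, 2`; the three sets of variables `t`, `t'`,
`t''` are indexed by `Fin 3 × ℕ+`. -/
def inVars {R : Type*} [CommRing R] (a : Fin 3) (F : MvPowerSeries ℕ+ R) :
    MvPowerSeries (Fin 3 × ℕ+) R :=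
  MvPowerSeries.rename (Function.Embedding.sectR a ℕ+) F

/-- The field of fractions of `k{{t, t', t''}}`. -/
abbrev TimeField (k : Type*) [Field k] : Type _ := FractionRing (MvPowerSeries (Fin 3 × ℕ+) k)

/-- The ring in which Baker-Akhiezer functions in `z` and `t, t', t''` live: formal series in
`t, t', t''` with coefficients in `k((z))`, with denominators in `k{{t, t', t''}}`. -/
abbrev BakerRing (k : Type*) [Field k] : Type _ :=
  TimeField k ⊗[MvPowerSeries (Fin 3 × ℕ+) k] MvPowerSeries (Fin 3 × ℕ+) (LaurentSeries k)

/-- `num / den` as an element of `BakerRing k`. -/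
def frac {k : Type*} [Field k] (num : MvPowerSeries (Fin 3 × ℕ+) (LaurentSeries k))
    (den : MvPowerSeries (Fin 3 × ℕ+) k) : BakerRing k :=
  (algebraMap (MvPowerSeries (Fin 3 × ℕ+) k) (TimeField k) den)⁻¹ ⊗ₜ num

/-- The Baker-Akhiezer function `ψ_U(z, t) = v(t, z)^{-1} τ_U(t + [z]) / τ_U(t)` in the `a`-th set
of variables, in terms of a `τ`-function of `U`. -/
def baker {k : Type*} [Field k] [CharZero k] (a : Fin 3) (τ : MvPowerSeries ℕ+ k) : BakerRing k :=
  frac (inVars a (bakerNum τ)) (inVars a τ)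

/-- The adjoint Baker-Akhiezer function `ψ*_U(z, t) = ψ_{U^⊥}(z, -t)` in the `a`-th set of
variables, in terms of a `τ`-function `τ'` of `U^⊥`. -/
def bakerAdj {k : Type*} [Field k] [CharZero k] (a : Fin 3) (τ' : MvPowerSeries ℕ+ k) :
    BakerRing k :=
  frac (inVars a (negTime (bakerNum τ'))) (inVars a (negTime τ'))

/-- The function `z ^ n` in `BakerRing k`. -/
def zpowBaker (k : Type*) [Field k] (n : ℤ) : BakerRing k :=
  1 ⊗ₜ MvPowerSeries.C (zpow k n)

/-- `F ↦ Res_{z=0} F dz`. -/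
def residue (k : Type*) [Field k] :
    BakerRing k →ₗ[MvPowerSeries (Fin 3 × ℕ+) k] TimeField k :=
  (TensorProduct.rid (MvPowerSeries (Fin 3 × ℕ+) k) (TimeField k)).toLinearMap ∘ₗ
    LinearMap.lTensor (TimeField k) (zCoeff (-1))

/-! ### Schur polynomials and differential operators -/

/-- The series `∑_{i > 0} x_i z^i`. -/
def xSeries (k : Type*) [Field k] : PowerSeries (MvPolynomial ℕ+ k) :=
  PowerSeries.mk fun i => if h : 0 < i then MvPolynomial.X ⟨i, h⟩ else 0

theorem hasSubst_xSeries (k : Type*) [Field k] : PowerSeries.HasSubst (xSeries k) :=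
  PowerSeries.HasSubst.of_constantCoeff_zero' (by
    rw [← PowerSeries.coeff_zero_eq_constantCoeff_apply]
    simp [xSeries])

/-- The polynomials `p_j`, defined by `exp (∑_{i > 0} x_i z^i) = ∑_{j ≥ 0} p_j(x) z^j`. -/
def pPoly (k : Type*) [Field k] [CharZero k] (j : ℕ) : MvPolynomial ℕ+ k :=
  PowerSeries.coeff j ((PowerSeries.exp k).subst (xSeries k))

/-- The polynomials `p_j` for all integers `j`, with `p_j = 0` for `j < 0`. -/
def pPolyInt (k : Type*) [Field k] [CharZero k] (j : ℤ) : MvPolynomial ℕ+ k :=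
  if 0 ≤ j then pPoly k j.toNat else 0

/-- The Schur polynomial `χ_μ = det (p_{μ_i - i + j})` as a polynomial in the variables `x_i`,
where `i x_i` stands for the `i`-th power sum. -/
def schur (k : Type*) [Field k] [CharZero k] (μ : YoungDiagram) : MvPolynomial ℕ+ k :=
  (Matrix.of fun i j : Fin (μ.colLen 0) =>
    pPolyInt k ((μ.rowLen i : ℤ) - (i : ℕ) + (j : ℕ))).det

/-- `ν - μ` is a horizontal `α`-strip: `μ` is contained in `ν`, the difference has `α` cells, and
no two of them are in the same column. -/
structure IsHorizontalStrip (ν μ : YoungDiagram) (α : ℕ) : Prop where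
  le : μ ≤ ν
  card_eq : ν.card = μ.card + α
  column : ∀ c ∈ ν.cells \ μ.cells, ∀ c' ∈ ν.cells \ μ.cells, c.2 = c'.2 → c = c'

theorem finite_horizontalStrip (ν : YoungDiagram) (α : ℕ) :
    {μ | IsHorizontalStrip ν μ α}.Finite := by
  refine Set.Finite.of_finite_image (f := YoungDiagram.cells)
    (ν.cells.powerset.finite_toSet.subset ?_) ?_
  · rintro _ ⟨μ, hμ, rfl⟩
    simpa using YoungDiagram.cells_subset_iff.2 hμ.le
  · intro μ _ μ' _ h
    exact YoungDiagram.ext h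

/-- `D_{ν,α} = ∑_μ χ_μ`, the sum over all `μ` such that `ν - μ` is a horizontal `α`-strip. -/
def stripSum (k : Type*) [Field k] [CharZero k] (ν : YoungDiagram) (α : ℕ) : MvPolynomial ℕ+ k :=
  ∑ μ ∈ (finite_horizontalStrip ν α).toFinset, schur k μ

/-- `Q(x) ↦ Q(-x)`. -/
def negX {k : Type*} [Field k] (Q : MvPolynomial ℕ+ k) : MvPolynomial ℕ+ k :=
  MvPolynomial.aeval (fun i => -MvPolynomial.X i) Q

/-- The polynomial `Q` in the `a`-th set of variables. -/
def inX {k : Type*} [Field k] (a : Fin 3) (Q : MvPolynomial ℕ+ k) :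
    MvPolynomial (Fin 3 × ℕ+) k :=
  MvPolynomial.rename (Prod.mk a) Q

/-- The operator `(1 / i) ∂ / ∂ t_i`, with `t_i` taken in the `a`-th set of variables, for
`s = (a, i)`. -/
def dTilde (k : Type*) [Field k] (s : Fin 3 × ℕ+) :
    Module.End k (MvPowerSeries (Fin 3 × ℕ+) k) :=
  ((s.2 : ℕ) : k)⁻¹ • (MvPowerSeries.pderiv k s : Module.End k (MvPowerSeries (Fin 3 × ℕ+) k))

theorem dTilde_commute (k : Type*) [Field k] (s s' : Fin 3 × ℕ+) :
    Commute (dTilde k s) (dTilde k s') := by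
  have h : Commute (MvPowerSeries.pderiv k s : Module.End k (MvPowerSeries (Fin 3 × ℕ+) k))
      (MvPowerSeries.pderiv k s' : Module.End k (MvPowerSeries (Fin 3 × ℕ+) k)) := by
    by_cases hs : s = s'
    · rw [hs]
    refine LinearMap.ext fun F => MvPowerSeries.ext fun d => ?_
    change MvPowerSeries.coeff d (MvPowerSeries.pderiv k s (MvPowerSeries.pderiv k s' F)) =
      MvPowerSeries.coeff d (MvPowerSeries.pderiv k s' (MvPowerSeries.pderiv k s F))
    simp only [MvPowerSeries.coeff_pderiv, Finsupp.add_apply, Finsupp.single_apply, if_neg hs,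
      if_neg (Ne.symm hs), add_zero]
    rw [add_right_comm]
    ring
  exact (h.smul_left _).smul_right _

/-- The differential operator `Q(∂̃)` with constant coefficients: the operators `dTilde k s` are
put in for the variables of the polynomial `Q`. -/
def diffOp {k : Type*} [Field k] (Q : MvPolynomial (Fin 3 × ℕ+) k) :
    Module.End k (MvPowerSeries (Fin 3 × ℕ+) k) :=
  ∑ e ∈ Q.support, Q.coeff e •
    e.support.noncommProd (fun s => dTilde k s ^ e s)
      fun s _ s' _ _ => (dTilde_commute k s s').pow_pow (e s) (e s')

/-- The symbol of the operator `P(λ₁, λ₂, λ₃)`, the sum of the products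
`p_{β₁}(∂̃_t) D_{λ₁,α₁}(-∂̃_t) p_{β₂}(∂̃_{t'}) D_{λ₂,α₂}(-∂̃_{t'}) p_{β₃}(-∂̃_{t''}) D_{λ₃,α₃}(∂̃_{t''})`
over all `α`, `β` with `-α₁ + β₁ - α₂ + β₂ - α₃ + β₃ = 1 + g`. Here `D_{λ,α} = 0` when `α < 0` or
`α` exceeds the number of cells of `λ`, and `p_β = 0` when `β < 0`; so the sum is over
`0 ≤ αᵢ ≤ |λᵢ|` and the triples `β` of natural numbers with sum `1 + g + α₁ + α₂ + α₃`. -/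
def symbolP (k : Type*) [Field k] [CharZero k] (g : ℕ) (l : Fin 3 → YoungDiagram) :
    MvPolynomial (Fin 3 × ℕ+) k :=
  ∑ α ∈ Fintype.piFinset fun a => Finset.range ((l a).card + 1),
    ∑ β ∈ Finset.piAntidiag (Finset.univ : Finset (Fin 3)) (1 + g + ∑ a, α a),
      (inX 0 (pPoly k (β 0)) * inX 0 (negX (stripSum k (l 0) (α 0)))) *
      (inX 1 (pPoly k (β 1)) * inX 1 (negX (stripSum k (l 1) (α 1)))) *
      (inX 2 (negX (pPoly k (β 2))) * inX 2 (stripSum k (l 2) (α 2)))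

end SatoGr

end

open SatoGr

noncomputable section

namespace SatoGr

open Finset

/-! ### Exponentials of formal series -/

section Exponential

variable {k S σ : Type*} [Field k] [CommRing S] [Algebra k S]

/-! The residue condition says that one coefficient of a trilinear expression vanishes; the
operators $P(\lambda_1,\lambda_2,\lambda_3)$ appear when this expression is tested on Schur
polynomials.

Suppose $\tau_U\ne0$. The denominators of the Baker-Akhiezer functions are then nonzero and free of
$z$, so only the coefficient of $z^{1+g}$ in the product of the numerators matters. The three sets
of times are disjoint, so the coefficients of this product are products of three Laurent series
(`residue_bakerProduct_eq_zero_iff`). In characteristic zero, knowing the coefficients of $F$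
amounts to knowing the values $Q(\tilde\partial)F|_{t=0}$ (`pair`), and $Q$ may run over any
spanning family of polynomials. Both $\chi_\mu(x)$ and $\chi_\mu(-x)$ are such families
(`span_schur`, `span_negX_schur`), whence `forall_coeff_mul_eq_zero_iff`.

On the numerator $v^{-1}\tau(t+[z])$ these values are explicit. Moving $Q(\tilde\partial)$ past
$v^{-1}$ replaces $x$ by $x-[z^{-1}]$ (`pair_vInv_mul`). For $Q=\chi_\nu(-x)$ this adds the variable
$z^{-1}$ to the alphabet, and the branching rule `aeval_schur_add_variable` gives $\sum_\alpha
z^{-\alpha}D_{\nu,\alpha}(-x)$. Taylor's formula `pair_tauShift` expands $\tau(t+[z])$ as $\sum_n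
z^n p_n(\tilde\partial)\tau$. Collecting $z^{1+g}$ in the product of three such sums gives exactly
$P(\lambda_1,\lambda_2,\lambda_3)$.

The third factor involves the $\tau$-function of $U^\perp$, and $\tau_{U^\perp}(-t)=c\,\tau_U(t)$
with $c\ne0$ (`exists_negTime_tau_orth_eq`). To see this, cut down to the exponents $-M,\dots,M-1$.
There $z^{-n}U$ and $z^{n}U^\perp$ give orthogonal $M$-dimensional spaces, multiplication by $v$ is
unipotent, and the two corner determinants are complementary minors
(`exists_ne_zero_det_upperRows`). The proportionality then passes to the limit coefficient by
coefficient. -/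

theorem coeff_pow_eq_zero_of_degree_lt {a : MvPowerSeries σ S}
    (ha : MvPowerSeries.constantCoeff a = 0) {e : σ →₀ ℕ} {n : ℕ} (h : e.degree < n) :
    MvPowerSeries.coeff e (a ^ n) = 0 := by
  refine MvPowerSeries.coeff_of_lt_order ?_
  refine lt_of_lt_of_le ?_ (MvPowerSeries.le_order_pow_of_constantCoeff_eq_zero n ha)
  exact_mod_cast h

theorem coeff_subst_eq_sum_range {a : MvPowerSeries σ S}
    (ha : MvPowerSeries.constantCoeff a = 0) (f : PowerSeries k) {e : σ →₀ ℕ} {N : ℕ}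
    (h : e.degree < N) :
    MvPowerSeries.coeff e (f.subst a) =
      ∑ n ∈ range N, PowerSeries.coeff n f • MvPowerSeries.coeff e (a ^ n) := by
  rw [PowerSeries.coeff_subst (PowerSeries.HasSubst.of_constantCoeff_zero ha)]
  refine finsum_eq_sum_of_support_subset _ fun n hn => ?_
  by_contra hcon
  simp only [coe_range, Set.mem_Iio, not_lt] at hcon
  exact hn (by simp [coeff_pow_eq_zero_of_degree_lt ha (h.trans_le hcon)])

theorem constantCoeff_exp_subst [CharZero k] {a : MvPowerSeries σ S}
    (ha : MvPowerSeries.constantCoeff a = 0) :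
    MvPowerSeries.constantCoeff ((PowerSeries.exp k).subst a) = 1 := by
  rw [← MvPowerSeries.coeff_zero_eq_constantCoeff_apply,
    coeff_subst_eq_sum_range ha (N := 1) _ (by simp)]
  simp

/-- The chain rule, coefficient by coefficient. As `a` has no constant term, only finitely many
powers of it reach a given monomial; the factor $n+1$ from differentiating $a^{n+1}$ turns
$1/(n+1)!$ into $1/n!$. -/
theorem pderiv_exp_subst [CharZero k] {a : MvPowerSeries σ S}
    (ha : MvPowerSeries.constantCoeff a = 0) (i : σ) :
    MvPowerSeries.pderiv S i ((PowerSeries.exp k).subst a) =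
      (PowerSeries.exp k).subst a * MvPowerSeries.pderiv S i a := by
  classical
  ext e
  have hr : MvPowerSeries.coeff e ((PowerSeries.exp k).subst a * MvPowerSeries.pderiv S i a) =
      ∑ n ∈ range (e.degree + 1), PowerSeries.coeff n (PowerSeries.exp k) •
        MvPowerSeries.coeff e (a ^ n * MvPowerSeries.pderiv S i a) := by
    simp only [MvPowerSeries.coeff_mul, smul_sum]
    rw [sum_comm]
    refine sum_congr rfl fun x hx => ?_
    rw [coeff_subst_eq_sum_range ha (N := e.degree + 1), sum_mul]
    · simp
    · have := congrArg Finsupp.degree (mem_antidiagonal.1 hx)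
      simp only [map_add] at this
      omega
  rw [hr, MvPowerSeries.coeff_pderiv, coeff_subst_eq_sum_range ha (N := e.degree + 1 + 1) _
    (by simp), sum_mul, sum_range_succ']
  simp only [pow_zero]
  rw [MvPowerSeries.coeff_one, if_neg (by simp), smul_zero, zero_mul, add_zero]
  refine sum_congr rfl fun n _ => ?_
  rw [smul_mul_assoc, ← MvPowerSeries.coeff_pderiv, MvPowerSeries.pderiv_pow]
  simp only [Nat.add_sub_cancel, mul_assoc]
  rw [← nsmul_eq_mul, map_nsmul, ← Nat.cast_smul_eq_nsmul k, smul_smul]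
  congr 1
  have h0 : (n : k) + 1 ≠ 0 := by exact_mod_cast n.succ_ne_zero
  have h1 : (n.factorial : k) ≠ 0 := by exact_mod_cast n.factorial_ne_zero
  simp only [PowerSeries.coeff_exp, Nat.factorial_succ]
  simp
  field_simp

/-- The coefficient `∏ 1 / dᵢ!` of the exponential series. -/
def expCoeff (k : Type*) [Field k] (d : σ →₀ ℕ) : k :=
  d.prod fun _ n => (n.factorial : k)⁻¹

theorem expCoeff_zero : expCoeff k (0 : σ →₀ ℕ) = 1 := by
  simp [expCoeff]

theorem prod_add_single {M : Type*} [CommMonoid M] (f : σ → ℕ → M) (hf : ∀ i, f i 0 = 1)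
    (d : σ →₀ ℕ) (i : σ) (y : M) (hy : f i (d i + 1) = f i (d i) * y) :
    (d + Finsupp.single i 1).prod f = d.prod f * y := by
  classical
  have h1 : (d + Finsupp.single i 1).prod f =
      ∏ j ∈ insert i d.support, f j ((d + Finsupp.single i 1 : σ →₀ ℕ) j) :=
    by
    refine Finsupp.prod_of_support_subset _ (fun j hj => ?_) _ (by simp [hf])
    by_contra hcon
    simp only [mem_insert, not_or, Finsupp.mem_support_iff, not_not] at hcon
    simp [hcon.2, Ne.symm hcon.1] at hj
  have h2 : d.prod f = ∏ j ∈ insert i d.support, f j (d j) :=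
    Finsupp.prod_of_support_subset _ (subset_insert _ _) _ (by simp [hf])
  rw [h1, h2, ← mul_prod_erase _ _ (mem_insert_self i _),
    ← mul_prod_erase _ (fun j => f j (d j)) (mem_insert_self i _)]
  have h3 : ∏ j ∈ (insert i d.support).erase i, f j ((d + Finsupp.single i 1 : σ →₀ ℕ) j) =
      ∏ j ∈ (insert i d.support).erase i, f j (d j) :=
    prod_congr rfl fun j hj => by simp [(ne_of_mem_erase hj).symm]
  rw [h3]
  simp only [Finsupp.add_apply, Finsupp.single_eq_same, hy]
  rw [mul_right_comm]

theorem expCoeff_add_single [CharZero k] (d : σ →₀ ℕ) (i : σ) :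
    expCoeff k (d + Finsupp.single i 1) * (d i + 1) = expCoeff k d := by
  have h0 : (d i : k) + 1 ≠ 0 := by exact_mod_cast (d i).succ_ne_zero
  rw [expCoeff, prod_add_single _ (by simp) d i ((d i : k) + 1)⁻¹, expCoeff]
  · field_simp
  · rw [Nat.factorial_succ]
    push_cast
    rw [mul_inv, mul_comm]

theorem finsupp_induction_add_single {p : (σ →₀ ℕ) → Prop} (h0 : p 0)
    (h : ∀ d i, p d → p (d + Finsupp.single i 1)) (d : σ →₀ ℕ) : p d := by
  classical
  induction hn : d.degree generalizing d with
  | zero => rwa [(Finsupp.degree_eq_zero_iff d).1 hn]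
  | succ n ih =>
    have hd : d ≠ 0 := by rintro rfl; simp at hn
    obtain ⟨i, hi⟩ := Finsupp.ne_iff.1 hd
    have hle : Finsupp.single i 1 ≤ d := by
      rw [Finsupp.single_le_iff]
      exact Nat.one_le_iff_ne_zero.2 hi
    have := tsub_add_cancel_of_le hle
    rw [← this]
    refine h _ _ (ih _ ?_)
    have h2 := congrArg Finsupp.degree this
    simp only [map_add, Finsupp.degree_single] at h2
    omega

/-- The system $\partial_iF=c_iF$, $F(0)=1$ determines each coefficient from one of lower degree,
because $d_i+1$ is invertible in a $k$-algebra. This gives the coefficients of $v$ and $v^{-1}$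
without expanding powers of $\sum t_iz^{-i}$. -/
theorem coeff_of_pderiv_eq_mul_C [CharZero k] {F : MvPowerSeries σ S} {c : σ → S}
    (h0 : MvPowerSeries.constantCoeff F = 1)
    (h : ∀ i, MvPowerSeries.pderiv S i F = F * MvPowerSeries.C (c i)) (d : σ →₀ ℕ) :
    MvPowerSeries.coeff d F = algebraMap k S (expCoeff k d) * d.prod fun i n => c i ^ n := by
  induction d using finsupp_induction_add_single with
  | h0 => simp [h0, expCoeff_zero]
  | h d i ih =>
    have h1 := congrArg (MvPowerSeries.coeff d) (h i)
    rw [MvPowerSeries.coeff_pderiv, MvPowerSeries.coeff_mul_C, ih] at h1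
    have hne : (d i : k) + 1 ≠ 0 := by exact_mod_cast (d i).succ_ne_zero
    have hu : IsUnit ((d i : S) + 1) := by
      have := (IsUnit.mk0 _ hne).map (algebraMap k S)
      simpa using this
    refine hu.mul_right_cancel ?_
    rw [h1, prod_add_single _ (by simp) d i (c i) (pow_succ _ _), ← expCoeff_add_single (k := k) d i]
    simp only [map_mul, map_add, map_natCast, map_one]
    ring

end Exponential

/-! ### Powers of `z` and residues -/

section Laurent

variable {k : Type*} [Field k]

theorem zpow_zero : zpow k 0 = 1 := rfl

theorem zpow_mul_zpow (m n : ℤ) : zpow k m * zpow k n = zpow k (m + n) := by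
  simp [zpow, HahnSeries.single_mul_single]

theorem zpow_pow (m : ℤ) (n : ℕ) : zpow k m ^ n = zpow k (n * m) := by
  simp [zpow, HahnSeries.single_pow]

theorem coeff_zpow_mul (m n : ℤ) (f : LaurentSeries k) :
    (zpow k m * f).coeff n = f.coeff (n - m) := by
  have := HahnSeries.coeff_single_mul_add (r := (1 : k)) (x := f) (a := n - m) (b := m)
  simpa [zpow] using this

theorem coeff_zpow (m n : ℤ) : (zpow k m).coeff n = if n = m then 1 else 0 := by
  classical
  rw [zpow, HahnSeries.coeff_single]
  congr

theorem coeff_C_mul (c : k) (f : LaurentSeries k) (n : ℤ) :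
    (HahnSeries.C c * f).coeff n = c * f.coeff n := by
  rw [HahnSeries.C_mul_eq_smul, HahnSeries.coeff_smul, smul_eq_mul]

theorem zPlus_mono {m n : ℤ} (h : m ≤ n) : zPlus k n ≤ zPlus k m :=
  fun _ hf j hj => hf j (hj.trans_le h)

theorem zpow_mem_zPlus {m n : ℤ} (h : m ≤ n) : zpow k n ∈ zPlus k m := by
  intro j hj
  rw [coeff_zpow, if_neg (by omega)]

theorem exists_mem_zPlus_neg (f : LaurentSeries k) : ∃ n : ℕ, f ∈ zPlus k (-(n : ℤ)) := by
  refine ⟨f.order.natAbs, fun j hj => HahnSeries.coeff_eq_zero_of_lt_order ?_⟩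
  omega

/-- The coefficient of `z ^ n` in a product is a finite sum over a window of exponents. -/
theorem coeff_mul_eq_sum_Ico {a b : ℤ} {f h : LaurentSeries k} (hf : f ∈ zPlus k a)
    (hh : h ∈ zPlus k b) (n : ℤ) :
    (f * h).coeff n = ∑ i ∈ Ico a (n - b + 1), f.coeff i * h.coeff (n - i) := by
  classical
  rw [HahnSeries.coeff_mul]
  refine sum_of_injOn Prod.fst ?_ ?_ ?_ ?_
  · rintro ⟨i, j⟩ hi ⟨i', j'⟩ hi' h
    simp only [mem_coe, Finset.mem_antidiagonal] at hi hi'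
    simp only at h
    ext <;> simp <;> omega
  · rintro ⟨i, j⟩ hi
    simp only [mem_coe, Finset.mem_antidiagonal, HahnSeries.mem_support] at hi
    have h1 : a ≤ i := by by_contra hc; exact hi.1 (hf i (by omega))
    have h2 : b ≤ j := by by_contra hc; exact hi.2.1 (hh j (by omega))
    simp only [coe_Ico, Set.mem_Ico]
    omega
  · intro i hi hni
    by_contra hne
    refine hni ⟨(i, n - i), ?_, rfl⟩
    simp only [mem_coe, Finset.mem_antidiagonal, HahnSeries.mem_support]
    exact ⟨left_ne_zero_of_mul hne, right_ne_zero_of_mul hne, by omega⟩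
  · rintro ⟨i, j⟩ hi
    simp only [Finset.mem_antidiagonal] at hi
    have : j = n - i := by omega
    rw [this]

end Laurent

/-! ### The universal element of `Γ_-` -/

section Universal

variable (k : Type*) [Field k]

/-- The weight `∑ i dᵢ` of a monomial in the times. -/
def timeWeight : (ℕ+ →₀ ℕ) →+ ℕ := Finsupp.weight fun i : ℕ+ => (i : ℕ)

theorem timeWeight_single (i : ℕ+) : timeWeight (Finsupp.single i 1) = i := by
  simp [timeWeight, Finsupp.weight_single]

theorem constantCoeff_timeSeries : MvPowerSeries.constantCoeff (timeSeries k) = 0 := by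
  rw [← MvPowerSeries.coeff_zero_eq_constantCoeff_apply, MvPowerSeries.coeff_apply, timeSeries]
  simp

theorem pderiv_timeSeries (i : ℕ+) :
    MvPowerSeries.pderiv (LaurentSeries k) i (timeSeries k) =
      MvPowerSeries.C (zpow k (-(i : ℤ))) := by
  classical
  ext1 d
  rw [MvPowerSeries.coeff_pderiv, MvPowerSeries.coeff_C, MvPowerSeries.coeff_apply, timeSeries]
  split_ifs with h
  · subst h
    simp
  · rw [sum_eq_zero, zero_mul]
    intro j _
    refine if_neg fun hj => h ?_
    have := congrArg Finsupp.degree hj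
    simp only [map_add, Finsupp.degree_single] at this
    exact (Finsupp.degree_eq_zero_iff d).1 (by omega)

theorem prod_zpow_neg (d : ℕ+ →₀ ℕ) :
    (d.prod fun i n => zpow k (-(i : ℤ)) ^ n) = zpow k (-(timeWeight d : ℤ)) := by
  induction d using finsupp_induction_add_single with
  | h0 => simp [zpow_zero]
  | h d i ih =>
    rw [prod_add_single (fun (i : ℕ+) n => zpow k (-(i : ℤ)) ^ n) (by simp) d i _ (pow_succ _ _),
      ih, zpow_mul_zpow, map_add,
      timeWeight_single]
    congr 1
    push_cast
    ring

variable [CharZero k]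

theorem constantCoeff_vSeries : MvPowerSeries.constantCoeff (vSeries k) = 1 :=
  constantCoeff_exp_subst (constantCoeff_timeSeries k)

theorem constantCoeff_vInv : MvPowerSeries.constantCoeff (vInv k) = 1 :=
  constantCoeff_exp_subst (by rw [map_neg, constantCoeff_timeSeries, neg_zero])

theorem pderiv_vSeries (i : ℕ+) : MvPowerSeries.pderiv (LaurentSeries k) i (vSeries k) =
    vSeries k * MvPowerSeries.C (zpow k (-(i : ℤ))) := by
  rw [vSeries, pderiv_exp_subst (constantCoeff_timeSeries k), pderiv_timeSeries]

theorem pderiv_vInv (i : ℕ+) : MvPowerSeries.pderiv (LaurentSeries k) i (vInv k) =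
    vInv k * MvPowerSeries.C (-zpow k (-(i : ℤ))) := by
  rw [vInv, pderiv_exp_subst (by rw [map_neg, constantCoeff_timeSeries, neg_zero]), map_neg,
    pderiv_timeSeries, map_neg]

theorem coeff_vSeries (d : ℕ+ →₀ ℕ) : MvPowerSeries.coeff d (vSeries k) =
    HahnSeries.C (expCoeff k d) * zpow k (-(timeWeight d : ℤ)) := by
  rw [coeff_of_pderiv_eq_mul_C (k := k) (constantCoeff_vSeries k) (pderiv_vSeries k),
    algebraMap_laurent, prod_zpow_neg]

theorem coeff_negTime {R : Type*} [CommRing R] (F : MvPowerSeries ℕ+ R) (d : ℕ+ →₀ ℕ) :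
    MvPowerSeries.coeff d (negTime F) = (-1) ^ d.degree * MvPowerSeries.coeff d F := by
  rw [negTime, MvPowerSeries.coeff_rescale]
  congr 1
  rw [Finsupp.prod, prod_pow_eq_pow_sum, Finsupp.degree_apply]

theorem vInv_eq_negTime : vInv k = negTime (vSeries k) := by
  ext1 d
  rw [coeff_negTime, coeff_of_pderiv_eq_mul_C (k := k) (constantCoeff_vInv k) (pderiv_vInv k),
    coeff_vSeries, algebraMap_laurent, ← prod_zpow_neg, mul_left_comm]
  congr 1
  rw [Finsupp.prod, Finsupp.prod, Finsupp.degree_apply, ← prod_pow_eq_pow_sum,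
    ← prod_mul_distrib]
  exact prod_congr rfl fun i _ => by rw [← neg_one_mul, mul_pow]

/-- The product has constant term $1$ and vanishing partial derivatives, which forces it to be $1$
in characteristic zero. -/
theorem vSeries_mul_vInv : vSeries k * vInv k = 1 := by
  have : CharZero (LaurentSeries k) := algebraRat.charZero _
  refine MvPowerSeries.pderiv.ext (fun i => ?_) (by
    rw [map_mul, constantCoeff_vSeries, constantCoeff_vInv, map_one, one_mul])
  rw [Derivation.leibniz, pderiv_vInv, pderiv_vSeries, Derivation.map_one_eq_zero]
  simp only [smul_eq_mul, map_neg]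
  ring

end Universal

/-! ### The polynomials `p_j` -/

section Complete

/-- $F'=FD$ is the recursion $(n+1)F_{n+1}=\sum_{i+j=n}F_iD_j$, so $F$ is determined by its constant
term. It serves to prove identities between generating series from their logarithmic derivatives. -/
theorem powerSeries_eq_of_derivative_eq_mul {k R : Type*} [Field k] [CharZero k] [CommRing R]
    [Algebra k R] {F G D : PowerSeries R}
    (h0 : PowerSeries.constantCoeff F = PowerSeries.constantCoeff G)
    (hF : PowerSeries.derivative R F = F * D) (hG : PowerSeries.derivative R G = G * D) :
    F = G := by
  ext n
  induction n using Nat.strong_induction_on with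
  | _ n ih =>
    cases n with
    | zero => simpa using h0
    | succ n =>
      have hne : (n : k) + 1 ≠ 0 := by exact_mod_cast n.succ_ne_zero
      have hu : IsUnit ((n : R) + 1) := by
        have := (IsUnit.mk0 _ hne).map (algebraMap k R)
        simpa using this
      refine hu.mul_right_cancel ?_
      rw [← PowerSeries.coeff_derivative, ← PowerSeries.coeff_derivative, hF, hG,
        PowerSeries.coeff_mul, PowerSeries.coeff_mul]
      refine sum_congr rfl fun x hx => ?_
      rw [ih]
      have := mem_antidiagonal.1 hx
      omega

variable (k : Type*) [Field k]

/-- The derivative `∑ i x_i z^{i-1}` of `∑ x_i z^i`. -/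
def dxSeries {R : Type*} [CommRing R] (x : ℕ+ → R) : PowerSeries R :=
  PowerSeries.mk fun j => (j + 1) * x j.succPNat

theorem derivative_xSeries :
    PowerSeries.derivative _ (xSeries k) = dxSeries (MvPolynomial.X : ℕ+ → MvPolynomial ℕ+ k) := by
  ext1 j
  rw [PowerSeries.coeff_derivative, xSeries, dxSeries, PowerSeries.coeff_mk, PowerSeries.coeff_mk,
    dif_pos j.succ_pos, mul_comm]
  rfl

theorem constantCoeff_xSeries : MvPowerSeries.constantCoeff (xSeries k) = 0 := by
  change PowerSeries.constantCoeff (xSeries k) = 0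
  rw [← PowerSeries.coeff_zero_eq_constantCoeff_apply]
  simp [xSeries]

variable [CharZero k]

/-- The generating series `∑ p_j z^j`. -/
def pSeries : PowerSeries (MvPolynomial ℕ+ k) := PowerSeries.mk (pPoly k)

theorem pSeries_eq : pSeries k = (PowerSeries.exp k).subst (xSeries k) := by
  ext1 n
  rw [pSeries, PowerSeries.coeff_mk, pPoly]

theorem pPoly_zero : pPoly k 0 = 1 := by
  rw [pPoly, PowerSeries.coeff_zero_eq_constantCoeff_apply]
  exact constantCoeff_exp_subst (constantCoeff_xSeries k)

theorem derivative_pSeries : PowerSeries.derivative _ (pSeries k) =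
    pSeries k * dxSeries (MvPolynomial.X : ℕ+ → MvPolynomial ℕ+ k) := by
  rw [← derivative_xSeries, pSeries_eq]
  exact pderiv_exp_subst (constantCoeff_xSeries k) ()

theorem pPoly_succ_mul (n : ℕ) : pPoly k (n + 1) * ((n : MvPolynomial ℕ+ k) + 1) =
    ∑ x ∈ antidiagonal n, pPoly k x.1 *
      (((x.2 : MvPolynomial ℕ+ k) + 1) * MvPolynomial.X x.2.succPNat) := by
  have := congrArg (PowerSeries.coeff n) (derivative_pSeries k)
  rw [PowerSeries.coeff_derivative, PowerSeries.coeff_mul] at this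
  simpa [pSeries, dxSeries] using this

/-- Differentiating $\exp(\sum x_iz^i)$ in $x_m$ multiplies it by $z^m$. In the proof,
$\sum\partial_mp_n\,z^n$ and $z^m\sum p_nz^n$ solve the same inhomogeneous linear equation in $z$;
their difference solves the homogeneous one with constant term $0$, so it vanishes. -/
theorem pderiv_pPoly (m : ℕ+) (n : ℕ) :
    MvPolynomial.pderiv m (pPoly k n) = if (m : ℕ) ≤ n then pPoly k (n - m) else 0 := by
  classical
  let G : PowerSeries (MvPolynomial ℕ+ k) :=
    PowerSeries.mk fun n => MvPolynomial.pderiv m (pPoly k n)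
  obtain ⟨m', hm'⟩ : ∃ m' : ℕ, (m : ℕ) = m' + 1 := ⟨m - 1, by have := m.pos; omega⟩
  have hG : PowerSeries.derivative _ G = G * dxSeries MvPolynomial.X +
      PowerSeries.X ^ m' * pSeries k * ((m : ℕ) : PowerSeries (MvPolynomial ℕ+ k)) := by
    ext1 j
    have h1 : MvPolynomial.pderiv m (pPoly k (j + 1) * ((j : MvPolynomial ℕ+ k) + 1)) =
        MvPolynomial.pderiv m (pPoly k (j + 1)) * ((j : MvPolynomial ℕ+ k) + 1) := by
      have : (j : MvPolynomial ℕ+ k) + 1 = ((j + 1 : ℕ) : MvPolynomial ℕ+ k) := by simp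
      rw [Derivation.leibniz, this, Derivation.map_natCast, smul_zero, zero_add, smul_eq_mul,
        mul_comm]
    rw [PowerSeries.coeff_derivative, PowerSeries.coeff_mk, ← h1, pPoly_succ_mul, map_sum,
      map_add, PowerSeries.coeff_mul, mul_comm (PowerSeries.X ^ m'), mul_assoc,
      PowerSeries.coeff_mul, ← sum_add_distrib]
    refine sum_congr rfl fun x _ => ?_
    have h2 : MvPolynomial.pderiv m (((x.2 : MvPolynomial ℕ+ k) + 1) *
        MvPolynomial.X x.2.succPNat) = PowerSeries.coeff x.2
          (PowerSeries.X ^ m' * ((m : ℕ) : PowerSeries (MvPolynomial ℕ+ k))) := by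
      have h3 : (x.2 : MvPolynomial ℕ+ k) + 1 = ((x.2 + 1 : ℕ) : MvPolynomial ℕ+ k) := by simp
      have h4 : ((m : ℕ) : PowerSeries (MvPolynomial ℕ+ k)) =
        PowerSeries.C ((m : ℕ) : MvPolynomial ℕ+ k) := by simp
      rw [h3, Derivation.leibniz, Derivation.map_natCast, smul_zero, add_zero, smul_eq_mul, h4,
        PowerSeries.coeff_mul_C, PowerSeries.coeff_X_pow, MvPolynomial.pderiv_X, Pi.single_apply]
      by_cases h : x.2 = m'
      · have : x.2.succPNat = m := PNat.eq (by simp [h, hm'])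
        rw [if_pos this, if_pos h, h, hm', mul_comm]
      · have : x.2.succPNat ≠ m := by
          intro hc
          have := congrArg PNat.val hc
          simp at this
          omega
        rw [if_neg this, if_neg h, mul_zero, zero_mul]
    rw [Derivation.leibniz, h2, smul_eq_mul, smul_eq_mul, dxSeries, PowerSeries.coeff_mk,
      PowerSeries.coeff_mk, pSeries, PowerSeries.coeff_mk]
    ring
  have hX : PowerSeries.derivative _ (PowerSeries.X ^ (m : ℕ) * pSeries k) =
      PowerSeries.X ^ (m : ℕ) * pSeries k * dxSeries MvPolynomial.X +
      PowerSeries.X ^ m' * pSeries k * ((m : ℕ) : PowerSeries (MvPolynomial ℕ+ k)) := by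
    rw [Derivation.leibniz, derivative_pSeries, PowerSeries.derivative_pow,
      PowerSeries.derivative_X, hm']
    simp only [smul_eq_mul, Nat.add_sub_cancel]
    ring
  have key : G - PowerSeries.X ^ (m : ℕ) * pSeries k = 0 := by
    refine powerSeries_eq_of_derivative_eq_mul (k := k) (D := dxSeries MvPolynomial.X) ?_ ?_ ?_
    · rw [← PowerSeries.coeff_zero_eq_constantCoeff_apply,
        ← PowerSeries.coeff_zero_eq_constantCoeff_apply, map_sub]
      simp [G, pPoly_zero, PowerSeries.coeff_X_pow_mul']
    · rw [map_sub, hG, hX]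
      ring
    · simp
  have := congrArg (PowerSeries.coeff n) (sub_eq_zero.1 key)
  rw [PowerSeries.coeff_mk, PowerSeries.coeff_X_pow_mul'] at this
  simpa [pSeries] using this

/-! ### Values of $p_j$ when a variable is added to the alphabet -/

variable {k} {R : Type*} [CommRing R] [Algebra k R]

/-- The value of `p_j`, `j ∈ ℤ`, at `x`. -/
def pVal (x : ℕ+ → R) (j : ℤ) : R := MvPolynomial.aeval x (pPolyInt k j)

theorem pPolyInt_of_neg {j : ℤ} (h : j < 0) : pPolyInt k j = 0 := if_neg (not_le.2 h)

theorem pPolyInt_natCast (j : ℕ) : pPolyInt k j = pPoly k j := by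
  rw [pPolyInt, if_pos (by positivity), Int.toNat_natCast]

theorem pPolyInt_zero : pPolyInt k 0 = 1 := by
  have := pPolyInt_natCast (k := k) 0
  rwa [pPoly_zero] at this

/-- Adding one variable `y` to the alphabet: `p_j(x + [y]) = p_j(x) + y p_{j-1}(x + [y])`. -/
theorem pVal_add_variable (x : ℕ+ → R) (y : R) (j : ℤ) :
    pVal (k := k) (fun i => x i + algebraMap k R ((i : ℕ) : k)⁻¹ * y ^ (i : ℕ)) j =
      pVal (k := k) x j +
        y * pVal (k := k) (fun i => x i + algebraMap k R ((i : ℕ) : k)⁻¹ * y ^ (i : ℕ)) (j - 1) := by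
  set x' : ℕ+ → R := fun i => x i + algebraMap k R ((i : ℕ) : k)⁻¹ * y ^ (i : ℕ) with hx'
  let Hs : (ℕ+ → R) → PowerSeries R := fun x =>
    PowerSeries.map (MvPolynomial.aeval (R := k) x : MvPolynomial ℕ+ k →+* R) (pSeries k)
  have hcoeff : ∀ (x : ℕ+ → R) (n : ℕ), PowerSeries.coeff n (Hs x) = pVal (k := k) x n := by
    intro x n
    simp only [Hs, PowerSeries.coeff_map, pSeries, PowerSeries.coeff_mk, pVal, pPolyInt_natCast]
    rfl
  have hder : ∀ x : ℕ+ → R, PowerSeries.derivative R (Hs x) = Hs x * dxSeries x := by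
    intro x
    have h1 : dxSeries x = PowerSeries.map
        (MvPolynomial.aeval (R := k) x : MvPolynomial ℕ+ k →+* R) (dxSeries MvPolynomial.X) := by
      ext1 n
      simp [dxSeries]
    rw [h1, ← map_mul, ← derivative_pSeries]
    ext1 n
    simp [Hs, PowerSeries.coeff_derivative]
  have hone : ∀ x : ℕ+ → R, PowerSeries.constantCoeff (Hs x) = 1 := by
    intro x
    rw [← PowerSeries.coeff_zero_eq_constantCoeff_apply, hcoeff, pVal, Nat.cast_zero,
      pPolyInt_zero, map_one]
  -- Adding $y^i/i$ to every $x_i$ adds $\sum_n y^{n+1}z^n=y/(1-yz)$ to the logarithmic derivative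
  -- of $\sum p_jz^j$. The factor $1-yz$ compensates for this, so $(1-yz)H_{x'}$ and $H_x$ satisfy
  -- the same equation.
  have hgeo : (1 - PowerSeries.C y * PowerSeries.X) * dxSeries x' =
      (1 - PowerSeries.C y * PowerSeries.X) * dxSeries x + PowerSeries.C y := by
    have h2 : dxSeries x' = dxSeries x + PowerSeries.mk fun n => y ^ (n + 1) := by
      ext1 n
      have hne : (n : k) + 1 ≠ 0 := by exact_mod_cast n.succ_ne_zero
      have h3 : ((n : R) + 1) * algebraMap k R ((n : k) + 1)⁻¹ = 1 := by
        have : (n : R) + 1 = algebraMap k R ((n : k) + 1) := by simp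
        rw [this, ← map_mul, mul_inv_cancel₀ hne, map_one]
      simp only [dxSeries, hx', PowerSeries.coeff_mk, map_add, Nat.succPNat_coe, Nat.cast_succ]
      rw [mul_add, ← mul_assoc, h3, one_mul]
    have h4 : (1 - PowerSeries.C y * PowerSeries.X) * (PowerSeries.mk fun n => y ^ (n + 1)) =
        PowerSeries.C y := by
      ext1 n
      rw [sub_mul, one_mul, map_sub, mul_assoc, PowerSeries.coeff_C_mul, PowerSeries.coeff_mk,
        PowerSeries.coeff_C]
      cases n with
      | zero => simp
      | succ n => simp [PowerSeries.coeff_succ_X_mul, pow_succ' y (n + 1)]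
    rw [h2, mul_add, h4]
  have key : (1 - PowerSeries.C y * PowerSeries.X) * Hs x' = Hs x := by
    refine powerSeries_eq_of_derivative_eq_mul (k := k) (D := dxSeries x) ?_ ?_ (hder x)
    · simp [hone]
    · rw [Derivation.leibniz, hder, map_sub, Derivation.map_one_eq_zero, Derivation.leibniz,
        PowerSeries.derivative_C, PowerSeries.derivative_X]
      simp only [smul_eq_mul]
      linear_combination Hs x' * hgeo
  rcases lt_trichotomy j 0 with h | h | h
  · simp [pVal, pPolyInt_of_neg h, pPolyInt_of_neg (show j - 1 < 0 by omega)]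
  · subst h
    simp [pVal, pPolyInt_zero, pPolyInt_of_neg]
  · obtain ⟨n, rfl⟩ : ∃ n : ℕ, j = ((n + 1 : ℕ) : ℤ) := ⟨(j - 1).toNat, by omega⟩
    have := congrArg (PowerSeries.coeff (n + 1)) key
    rw [sub_mul, one_mul, map_sub, mul_assoc, PowerSeries.coeff_C_mul,
      PowerSeries.coeff_succ_X_mul, hcoeff, hcoeff, hcoeff] at this
    rw [← this]
    push_cast
    simp

end Complete

/-! ### Young diagrams -/

section Young

theorem rowLen_eq_zero_of_colLen_le (μ : YoungDiagram) {i : ℕ} (h : μ.colLen 0 ≤ i) :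
    μ.rowLen i = 0 := by
  by_contra hne
  have : (i, 0) ∈ μ := YoungDiagram.mem_iff_lt_rowLen.2 (Nat.pos_of_ne_zero hne)
  exact absurd (YoungDiagram.mem_iff_lt_colLen.1 this) (not_lt.2 h)

theorem card_eq_sum_rowLen (μ : YoungDiagram) {n : ℕ} (h : μ.colLen 0 ≤ n) :
    μ.card = ∑ i : Fin n, μ.rowLen i := by
  rw [Fin.sum_univ_eq_sum_range (fun i => μ.rowLen i) n, YoungDiagram.card,
    card_eq_sum_card_fiberwise (f := Prod.fst) (t := range n)]
  · exact sum_congr rfl fun i _ => (μ.rowLen_eq_card).symm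
  · rintro ⟨i, j⟩ hc
    rw [mem_coe, YoungDiagram.mem_cells] at hc
    have h1 : (i, 0) ∈ μ := μ.up_left_mem le_rfl (Nat.zero_le j) hc
    exact mem_coe.2 (mem_range.2 ((YoungDiagram.mem_iff_lt_colLen.1 h1).trans_le h))

theorem youngDiagram_ext_rowLen {μ ν : YoungDiagram} (h : ∀ i, μ.rowLen i = ν.rowLen i) :
    μ = ν := by
  ext ⟨i, j⟩
  rw [YoungDiagram.mem_cells, YoungDiagram.mem_cells, YoungDiagram.mem_iff_lt_rowLen,
    YoungDiagram.mem_iff_lt_rowLen, h]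

/-- The Young diagram with the given row lengths. -/
theorem exists_youngDiagram_rowLen {f : ℕ → ℕ} (hf : Antitone f) {n : ℕ} (hn : ∀ i ≥ n, f i = 0) :
    ∃ μ : YoungDiagram, (∀ i, μ.rowLen i = f i) ∧ μ.colLen 0 ≤ n := by
  let μ : YoungDiagram :=
    { cells := (range n ×ˢ range (f 0)).filter fun c => c.2 < f c.1
      isLowerSet := by
        rintro ⟨i, j⟩ ⟨i', j'⟩ hle hc
        have h1 : i' ≤ i := hle.1
        have h2 : j' ≤ j := hle.2
        simp only [coe_filter, mem_product, mem_range, Set.mem_ofPred_eq] at hc ⊢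
        have := hf h1
        omega }
  have hmem : ∀ i j, (i, j) ∈ μ ↔ j < f i := by
    intro i j
    rw [← YoungDiagram.mem_cells]
    simp only [μ, mem_filter, mem_product, mem_range]
    refine ⟨fun h => h.2, fun h => ⟨⟨?_, h.trans_le (hf (Nat.zero_le i))⟩, h⟩⟩
    by_contra hc
    rw [hn i (not_lt.1 hc)] at h
    omega
  refine ⟨μ, fun i => ?_, ?_⟩
  · refine eq_of_forall_lt_iff fun j => ?_
    rw [← YoungDiagram.mem_iff_lt_rowLen, hmem]
  · by_contra hc
    have := (hmem n 0).1 (YoungDiagram.mem_iff_lt_colLen.2 (not_le.1 hc))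
    rw [hn n le_rfl] at this
    omega

theorem IsHorizontalStrip.rowLen_le {ν μ : YoungDiagram} {α : ℕ} (h : IsHorizontalStrip ν μ α)
    (i : ℕ) : μ.rowLen i ≤ ν.rowLen i := by
  by_contra hc
  have h1 : (i, ν.rowLen i) ∈ μ := YoungDiagram.mem_iff_lt_rowLen.2 (not_le.1 hc)
  have h2 : (i, ν.rowLen i) ∈ ν := h.le h1
  exact lt_irrefl _ (YoungDiagram.mem_iff_lt_rowLen.1 h2)

/-- If $\mu_i<\nu_{i+1}$, the cells of column $\mu_i$ in rows $i$ and $i+1$ would both be removed.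
Together with $\mu_i\le\nu_i$ this is the interlacing $\nu_{i+1}\le\mu_i\le\nu_i$, which
characterises horizontal strips and is the form the determinants need. -/
theorem IsHorizontalStrip.rowLen_succ_le {ν μ : YoungDiagram} {α : ℕ}
    (h : IsHorizontalStrip ν μ α) (i : ℕ) : ν.rowLen (i + 1) ≤ μ.rowLen i := by
  by_contra hc
  have h0 := ν.rowLen_anti i (i + 1) (Nat.le_succ i)
  have h0' := μ.rowLen_anti i (i + 1) (Nat.le_succ i)
  have key := h.column (i, μ.rowLen i) ?_ (i + 1, μ.rowLen i) ?_ rfl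
  · simp at key
  all_goals
    rw [mem_sdiff, YoungDiagram.mem_cells, YoungDiagram.mem_cells,
      YoungDiagram.mem_iff_lt_rowLen, YoungDiagram.mem_iff_lt_rowLen]
    omega

theorem isHorizontalStrip_of_rowLen {ν μ : YoungDiagram} (h1 : ∀ i, μ.rowLen i ≤ ν.rowLen i)
    (h2 : ∀ i, ν.rowLen (i + 1) ≤ μ.rowLen i) : IsHorizontalStrip ν μ (ν.card - μ.card) := by
  have hle : μ ≤ ν := by
    rintro ⟨i, j⟩ hc
    exact YoungDiagram.mem_iff_lt_rowLen.2
      ((YoungDiagram.mem_iff_lt_rowLen.1 hc).trans_le (h1 i))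
  refine ⟨hle, ?_, ?_⟩
  · have : μ.card ≤ ν.card := card_le_card (YoungDiagram.cells_subset_iff.2 hle)
    omega
  · have aux : ∀ i i' j, i < i' → (i, j) ∉ μ → (i', j) ∈ ν → False := by
      intro i i' j hlt hμ hν
      rw [YoungDiagram.mem_iff_lt_rowLen] at hμ hν
      have := ν.rowLen_anti (i + 1) i' hlt
      have := h2 i
      omega
    rintro ⟨i, j⟩ hc ⟨i', j'⟩ hc' hj
    simp only at hj
    subst hj
    rw [mem_sdiff, YoungDiagram.mem_cells, YoungDiagram.mem_cells] at hc hc'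
    rcases lt_trichotomy i i' with h | h | h
    · exact (aux i i' j h hc.2 hc'.1).elim
    · rw [h]
    · exact (aux i' i j h hc'.2 hc.1).elim

end Young

/-! ### Schur polynomials -/

section Schur

variable {k : Type*} [Field k] [CharZero k] {R : Type*} [CommRing R] [Algebra k R]

/-- The matrix `(p_{a_i - i + j})` of a Schur function. -/
def jacobiTrudi (k : Type*) [Field k] [CharZero k] {R : Type*} [CommRing R] [Algebra k R]
    (x : ℕ+ → R) {n : ℕ} (a : Fin n → ℤ) : Matrix (Fin n) (Fin n) R :=
  Matrix.of fun i j => pVal (k := k) x (a i - (i : ℕ) + (j : ℕ))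

theorem pVal_of_neg (x : ℕ+ → R) {j : ℤ} (h : j < 0) : pVal (k := k) x j = 0 := by
  rw [pVal, pPolyInt_of_neg h, map_zero]

theorem pVal_zero (x : ℕ+ → R) : pVal (k := k) x 0 = 1 := by
  rw [pVal, pPolyInt_zero, map_one]

/-- The last row is $(p_{-n},\dots,p_{-1},p_0)=(0,\dots,0,1)$. Hence empty rows may be appended, and
determinants for $\mu\subseteq\nu$ can be compared at the size given by $\nu$. -/
theorem det_jacobiTrudi_succ (x : ℕ+ → R) (n : ℕ) (a : ℕ → ℤ) (h : a n = 0) :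
    (jacobiTrudi k x fun i : Fin (n + 1) => a i).det =
      (jacobiTrudi k x fun i : Fin n => a i).det := by
  rw [Matrix.det_succ_row _ (Fin.last n), sum_eq_single (Fin.last n)]
  · have h1 : jacobiTrudi k x (fun i : Fin (n + 1) => a i) (Fin.last n) (Fin.last n) = 1 := by
      simp [jacobiTrudi, h, pVal_zero]
    rw [h1, ← two_mul, pow_mul, neg_one_sq, one_pow, one_mul, one_mul]
    congr 1
    ext i j
    simp [jacobiTrudi]
  · intro j _ hj
    have hlt : (j : ℕ) < n := by
      have := Fin.val_ne_of_ne hj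
      have := j.2
      simp at *
      omega
    have h1 : jacobiTrudi k x (fun i : Fin (n + 1) => a i) (Fin.last n) j = 0 := by
      simp only [jacobiTrudi, Matrix.of_apply, Fin.val_last, h]
      exact pVal_of_neg _ (by omega)
    rw [h1, mul_zero, zero_mul]
  · simp

theorem aeval_schur (x : ℕ+ → R) (μ : YoungDiagram) {n : ℕ} (hn : μ.colLen 0 ≤ n) :
    MvPolynomial.aeval x (schur k μ) =
      (jacobiTrudi k x fun i : Fin n => (μ.rowLen i : ℤ)).det := by
  induction n, hn using Nat.le_induction with
  | base =>
    rw [schur, ← AlgHom.coe_toRingHom, RingHom.map_det]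
    rfl
  | succ n hn ih =>
    rw [ih, det_jacobiTrudi_succ x n fun i => (μ.rowLen i : ℤ)]
    rw [rowLen_eq_zero_of_colLen_le μ hn, Nat.cast_zero]

theorem pVal_add_variable_telescope (x : ℕ+ → R) (y : R) (m : ℤ) (c : ℕ) :
    pVal (k := k) (fun i => x i + algebraMap k R ((i : ℕ) : k)⁻¹ * y ^ (i : ℕ)) m =
      ∑ s ∈ range c, y ^ s * pVal (k := k) x (m - s) + y ^ c *
        pVal (k := k) (fun i => x i + algebraMap k R ((i : ℕ) : k)⁻¹ * y ^ (i : ℕ)) (m - c) := by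
  induction c with
  | zero => simp
  | succ c ih =>
    rw [ih, sum_range_succ, pVal_add_variable (k := k) x y (m - c), Nat.cast_succ, ← sub_sub]
    ring

/-- The branching rule for Schur functions, in terms of rows. -/
theorem aeval_schur_add_variable_eq_sum_rows (x : ℕ+ → R) (y : R) (ν : YoungDiagram) :
    MvPolynomial.aeval (fun i : ℕ+ => x i + algebraMap k R ((i : ℕ) : k)⁻¹ * y ^ (i : ℕ))
        (schur k ν) =
      ∑ s ∈ Fintype.piFinset fun i : Fin (ν.colLen 0) =>
          range (ν.rowLen i - ν.rowLen (i + 1) + 1),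
        y ^ (∑ i, s i) *
          (jacobiTrudi k x fun i : Fin (ν.colLen 0) => (ν.rowLen i : ℤ) - s i).det := by
  set x' : ℕ+ → R := fun i => x i + algebraMap k R ((i : ℕ) : k)⁻¹ * y ^ (i : ℕ) with hx'
  set n := ν.colLen 0 with hn
  rw [aeval_schur x' ν hn.ge]
  let A : ℕ → Fin n → R := fun i j => pVal (k := k) x' ((ν.rowLen i : ℤ) - i + (j : ℕ))
  -- The choice $c_i=\nu_i-\nu_{i+1}+1$ makes $p_{\nu_i-i+j-c_i}=p_{\nu_{i+1}-(i+1)+j}$: after $c_i$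
  -- steps of telescoping, the remainder of row $i$ is $y^{c_i}$ times row $i+1$. The unipotent
  -- matrix `T` removes it, and row $n$ is zero, so the last row needs no exception.
  let c : ℕ → ℕ := fun i => ν.rowLen i - ν.rowLen (i + 1) + 1
  let T : Matrix (Fin n) (Fin n) R := Matrix.of fun i i' =>
    if i' = i then 1 else if (i' : ℕ) = i + 1 then -y ^ c i else 0
  let B : Matrix (Fin n) (Fin n) R := Matrix.of fun i j =>
    ∑ s ∈ range (c i), y ^ s * pVal (k := k) x ((ν.rowLen i : ℤ) - s - (i : ℕ) + (j : ℕ))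
  have hA : A n = 0 := by
    funext j
    simp only [A, rowLen_eq_zero_of_colLen_le ν hn.ge, Pi.zero_apply]
    exact pVal_of_neg _ (by have := j.2; omega)
  have hrow : ∀ (i : Fin n) (j : Fin n), A i j = B i j + y ^ c i * A (i + 1) j := by
    intro i j
    have h1 := ν.rowLen_anti i (i + 1) (Nat.le_succ _)
    simp only [A, B, Matrix.of_apply]
    rw [hx', pVal_add_variable_telescope x y _ (c i)]
    congr 1
    · exact sum_congr rfl fun s _ => by congr 2; ring
    · congr 2
      simp only [c]
      push_cast
      omega
  have hTA : T * Matrix.of (fun i j : Fin n => A i j) = B := by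
    ext i j
    rw [Matrix.mul_apply]
    have h1 : ∀ i' : Fin n, T i i' * Matrix.of (fun i j : Fin n => A i j) i' j =
        (if i' = i then A i j else 0) +
          (if (i' : ℕ) = i + 1 then -y ^ c i * A (i + 1) j else 0) := by
      intro i'
      simp only [T, Matrix.of_apply]
      by_cases h : i' = i
      · subst h; simp
      · rw [if_neg h, if_neg h]
        split_ifs with h2
        · rw [h2, zero_add]
        · simp
    rw [sum_congr rfl fun i' _ => h1 i', sum_add_distrib, sum_ite_eq' univ i, if_pos (mem_univ i)]
    have h2 : (∑ i' : Fin n, if (i' : ℕ) = i + 1 then -y ^ c i * A (i + 1) j else 0) =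
        -y ^ c i * A (i + 1) j := by
      by_cases h : (i : ℕ) + 1 < n
      · rw [sum_eq_single (⟨i + 1, h⟩ : Fin n)]
        · simp
        · intro b _ hb
          exact if_neg fun hc => hb (Fin.ext hc)
        · simp
      · have : (i : ℕ) + 1 = n := by have := i.2; omega
        rw [this, hA]
        simp
    rw [h2, hrow i j]
    ring
  have hT : T.det = 1 := by
    rw [Matrix.det_of_isUpperTriangular]
    · simp [T]
    · intro i j hij
      simp only [id] at hij
      simp only [T, Matrix.of_apply]
      rw [if_neg hij.ne, if_neg]
      have : (j : ℕ) < i := hij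
      omega
  have hdet : (jacobiTrudi k x' fun i : Fin n => (ν.rowLen i : ℤ)).det = B.det := by
    rw [← hTA, Matrix.det_mul, hT, one_mul]
    rfl
  rw [hdet]
  have hB : B = fun i : Fin n => ∑ s ∈ range (c i),
      (fun j : Fin n => y ^ s * pVal (k := k) x ((ν.rowLen i : ℤ) - s - (i : ℕ) + (j : ℕ))) := by
    funext i j
    rw [Finset.sum_apply]
    rfl
  -- Multilinearity in the rows: choosing the summand $s_i\le\nu_i-\nu_{i+1}$ in row $i$ amounts to
  -- shortening that row of the diagram by $s_i$.
  have hexp := (Matrix.detRowAlternating (n := Fin n) (R := R)).toMultilinearMap.map_sum_finset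
    (fun (i : Fin n) (s : ℕ) => (fun j : Fin n =>
      y ^ s * pVal (k := k) x ((ν.rowLen i : ℤ) - s - (i : ℕ) + (j : ℕ))))
    (fun i => range (c i))
  rw [hB]
  refine hexp.trans (sum_congr rfl fun s _ => ?_)
  rw [← prod_pow_eq_pow_sum]
  exact Matrix.det_mul_column (fun i => y ^ s i) _

/-- The branching rule for Schur functions. -/
theorem aeval_schur_add_variable (x : ℕ+ → R) (y : R) (ν : YoungDiagram) :
    MvPolynomial.aeval (fun i : ℕ+ => x i + algebraMap k R ((i : ℕ) : k)⁻¹ * y ^ (i : ℕ))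
        (schur k ν) =
      ∑ α ∈ range (ν.card + 1), y ^ α * MvPolynomial.aeval x (stripSum k ν α) := by
  rw [aeval_schur_add_variable_eq_sum_rows]
  simp only [stripSum, map_sum, mul_sum]
  rw [sum_sigma' (range (ν.card + 1)) fun α => (finite_horizontalStrip ν α).toFinset]
  symm
  have hcol : ∀ μ : YoungDiagram, μ ≤ ν → μ.colLen 0 ≤ ν.colLen 0 := by
    intro μ h
    by_contra hc
    have h1 : (ν.colLen 0, 0) ∈ μ := YoungDiagram.mem_iff_lt_colLen.2 (not_le.1 hc)
    have h2 : (ν.colLen 0, 0) ∈ ν := h h1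
    exact lt_irrefl _ (YoungDiagram.mem_iff_lt_colLen.1 h2)
  -- The bijection is $s_i=\nu_i-\mu_i$; the bounds $0\le s_i\le\nu_i-\nu_{i+1}$ are the interlacing
  -- conditions, and $\alpha=\sum s_i$.
  refine sum_bij (fun p _ => fun i : Fin (ν.colLen 0) => ν.rowLen i - p.2.rowLen i) ?_ ?_ ?_ ?_
  · rintro ⟨α, μ⟩ hp
    simp only [mem_sigma, Set.Finite.mem_toFinset, Set.mem_ofPred_eq] at hp
    rw [Fintype.mem_piFinset]
    intro i
    have h1 := hp.2.rowLen_le i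
    have h2 := hp.2.rowLen_succ_le i
    simp only [mem_range]
    omega
  · rintro ⟨α, μ⟩ hp ⟨α', μ'⟩ hp' h
    simp only [mem_sigma, Set.Finite.mem_toFinset, Set.mem_ofPred_eq] at hp hp'
    have hμ : μ = μ' := by
      refine youngDiagram_ext_rowLen fun i => ?_
      have h1 := hp.2.rowLen_le i
      have h1' := hp'.2.rowLen_le i
      by_cases hi : i < ν.colLen 0
      · have := congrFun h ⟨i, hi⟩
        simp only at this
        omega
      · rw [rowLen_eq_zero_of_colLen_le ν (not_lt.1 hi)] at h1 h1'
        omega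
    subst hμ
    have h1 := hp.2.card_eq
    have h2 := hp'.2.card_eq
    have : α = α' := by omega
    rw [this]
  · intro s hs
    rw [Fintype.mem_piFinset] at hs
    let f : ℕ → ℕ := fun i => if h : i < ν.colLen 0 then ν.rowLen i - s ⟨i, h⟩ else 0
    have hf1 : ∀ i, f i ≤ ν.rowLen i := by
      intro i
      simp only [f]
      split_ifs <;> omega
    have hf2 : ∀ i, ν.rowLen (i + 1) ≤ f i := by
      intro i
      simp only [f]
      split_ifs with h
      · have h1 := mem_range.1 (hs ⟨i, h⟩)
        have h2 := ν.rowLen_anti i (i + 1) (Nat.le_succ _)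
        simp only at h1
        omega
      · rw [rowLen_eq_zero_of_colLen_le ν (by omega)]
    obtain ⟨μ, hμ, -⟩ := exists_youngDiagram_rowLen (f := f) (n := ν.colLen 0)
      (antitone_nat_of_succ_le fun i => (hf1 (i + 1)).trans (hf2 i))
      (fun i hi => dif_neg (not_lt.2 hi))
    refine ⟨⟨ν.card - μ.card, μ⟩, ?_, ?_⟩
    · simp only [mem_sigma, Set.Finite.mem_toFinset, Set.mem_ofPred_eq, mem_range]
      exact ⟨by omega, isHorizontalStrip_of_rowLen (fun i => (hμ i).trans_le (hf1 i))
        fun i => (hf2 i).trans_eq (hμ i).symm⟩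
    · funext i
      have h1 := mem_range.1 (hs i)
      have h2 := ν.rowLen_anti i (i + 1) (Nat.le_succ _)
      simp only [hμ, f, i.2, dif_pos, Fin.eta]
      omega
  · rintro ⟨α, μ⟩ hp
    simp only [mem_sigma, Set.Finite.mem_toFinset, Set.mem_ofPred_eq] at hp
    have hle := hp.2.rowLen_le
    simp only
    congr 2
    · have h1 := hp.2.card_eq
      rw [card_eq_sum_rowLen ν le_rfl, card_eq_sum_rowLen μ (hcol μ hp.2.le)] at h1
      have h2 : ∑ i : Fin (ν.colLen 0), ν.rowLen i = ∑ i : Fin (ν.colLen 0), μ.rowLen i +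
          ∑ i : Fin (ν.colLen 0), (ν.rowLen i - μ.rowLen i) := by
        rw [← sum_add_distrib]
        exact sum_congr rfl fun i _ => by have := hle i; omega
      omega
    · rw [aeval_schur x μ (hcol μ hp.2.le)]
      congr 2
      funext i
      have := hle i
      omega

end Schur

/-! ### Schur polynomials span -/

section Span

variable {k : Type*} [Field k]

theorem negX_negX (Q : MvPolynomial ℕ+ k) : negX (negX Q) = Q := by
  simp only [negX]
  rw [← AlgHom.comp_apply, MvPolynomial.comp_aeval]
  simp

/-- `Q(x) ↦ Q(-x)` as an algebra homomorphism. -/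
def negXHom (k : Type*) [Field k] : MvPolynomial ℕ+ k →ₐ[k] MvPolynomial ℕ+ k :=
  MvPolynomial.aeval fun i => -MvPolynomial.X i

theorem negXHom_apply (Q : MvPolynomial ℕ+ k) : negXHom k Q = negX Q := rfl

variable [CharZero k]

theorem pVal_X (j : ℤ) : pVal (k := k) (MvPolynomial.X : ℕ+ → MvPolynomial ℕ+ k) j =
    pPolyInt k j := by
  rw [pVal, MvPolynomial.aeval_X_left_apply]

/-- Expanding the squares leaves $2\big(\sum a_i\sigma^{-1}(i)-\sum
a_i\,i\big)+\sum(\sigma^{-1}(i)-i)^2$. The first term is nonnegative by the rearrangement inequality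
and the second is positive. This makes the Jacobi-Trudi expansion triangular. -/
theorem sq_sum_lt_of_perm_ne_one {n : ℕ} {a : Fin n → ℤ} (ha : Antitone a)
    {σ : Equiv.Perm (Fin n)} (hσ : σ ≠ 1) :
    ∑ i, a i ^ 2 < ∑ i, (a (σ i) - ((σ i : ℕ) : ℤ) + ((i : ℕ) : ℤ)) ^ 2 := by
  have h1 : ∑ i, (a (σ i) - ((σ i : ℕ) : ℤ) + ((i : ℕ) : ℤ)) ^ 2 =
      ∑ i, (a i - ((i : ℕ) : ℤ) + ((σ⁻¹ i : Fin n) : ℕ)) ^ 2 := by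
    rw [← Equiv.sum_comp σ fun i => (a i - ((i : ℕ) : ℤ) + ((σ⁻¹ i : Fin n) : ℕ)) ^ 2]
    simp
  have h2 : ∑ i, a i * ((i : ℕ) : ℤ) ≤ ∑ i, a i * (((σ⁻¹ i : Fin n) : ℕ) : ℤ) := by
    refine Antivary.sum_mul_le_sum_mul_comp_perm (f := a) (g := fun i : Fin n => ((i : ℕ) : ℤ)) ?_
    intro i j hij
    exact ha (by simpa using hij.le)
  obtain ⟨i₀, hi₀⟩ : ∃ i, σ⁻¹ i ≠ i := by
    by_contra hc
    push Not at hc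
    exact hσ (inv_eq_one.1 (Equiv.ext hc))
  have h3 : 0 < ∑ i : Fin n, ((((σ⁻¹ i : Fin n) : ℕ) : ℤ) - ((i : ℕ) : ℤ)) ^ 2 := by
    refine sum_pos' (fun i _ => sq_nonneg _) ⟨i₀, mem_univ _, ?_⟩
    refine sq_pos_of_ne_zero (sub_ne_zero.2 fun hc => hi₀ (Fin.ext ?_))
    exact_mod_cast hc
  rw [h1]
  have h4 : ∑ i, (a i - ((i : ℕ) : ℤ) + ((σ⁻¹ i : Fin n) : ℕ)) ^ 2 = ∑ i, a i ^ 2 +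
      2 * (∑ i, a i * (((σ⁻¹ i : Fin n) : ℕ) : ℤ) - ∑ i, a i * ((i : ℕ) : ℤ)) +
      ∑ i : Fin n, ((((σ⁻¹ i : Fin n) : ℕ) : ℤ) - ((i : ℕ) : ℤ)) ^ 2 := by
    rw [← sum_sub_distrib, mul_sum, ← sum_add_distrib, ← sum_add_distrib]
    exact sum_congr rfl fun i _ => by ring
  rw [h4]
  linarith

/-- For sorted $a$, the identity permutation contributes $\prod p_{a_i}$ to the Jacobi-Trudi
determinant of the diagram with rows $a_i$. Every other term is zero or a product with the same sum
of indices but a larger sum of squares. As $\sum b_i^2\le(\sum b_i)^2$, the quantity $(\sum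
a_i)^2-\sum a_i^2$ decreases and the induction ends. -/
theorem prod_pPoly_mem_span_schur {n : ℕ} (a : Fin n → ℕ) :
    ∏ i, pPoly k (a i) ∈ Submodule.span k (Set.range (schur k)) := by
  induction hN : (∑ i, a i) ^ 2 - ∑ i, a i ^ 2 using Nat.strong_induction_on generalizing a with
  | _ N ih =>
    have hsort : ∀ a : Fin n → ℕ, Antitone a → (∑ i, a i) ^ 2 - ∑ i, a i ^ 2 = N →
        ∏ i, pPoly k (a i) ∈ Submodule.span k (Set.range (schur k)) := by
      intro a ha hN
      let f : ℕ → ℕ := fun i => if h : i < n then a ⟨i, h⟩ else 0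
      have hf : Antitone f := by
        intro i j hij
        simp only [f]
        split_ifs with h1 h2
        · exact ha hij
        · omega
        · exact Nat.zero_le _
        · exact le_rfl
      obtain ⟨μ, hμ, hμn⟩ := exists_youngDiagram_rowLen hf (n := n)
        fun i hi => dif_neg (not_lt.2 hi)
      have hrow : ∀ i : Fin n, μ.rowLen i = a i := fun i => by simp [hμ, f, i.2]
      have hs := aeval_schur (k := k) (MvPolynomial.X : ℕ+ → MvPolynomial ℕ+ k) μ hμn
      rw [MvPolynomial.aeval_X_left_apply, Matrix.det_apply,
        ← add_sum_erase univ _ (mem_univ (1 : Equiv.Perm (Fin n)))] at hs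
      simp only [jacobiTrudi, Matrix.of_apply, pVal_X, hrow, Equiv.Perm.sign_one, one_smul,
        Equiv.Perm.one_apply, sub_add_cancel, pPolyInt_natCast] at hs
      rw [← sub_eq_iff_eq_add] at hs
      rw [← hs]
      refine Submodule.sub_mem _ (Submodule.subset_span ⟨μ, rfl⟩)
        (Submodule.sum_mem _ fun σ hσ => ?_)
      have hσ1 := ne_of_mem_erase hσ
      rw [Units.smul_def]
      refine zsmul_mem ?_ _
      by_cases hneg : ∃ i, ((a (σ i) : ℕ) : ℤ) - ((σ i : ℕ) : ℤ) + ((i : ℕ) : ℤ) < 0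
      · obtain ⟨i, hi⟩ := hneg
        rw [prod_eq_zero (mem_univ i) (pPolyInt_of_neg hi)]
        exact Submodule.zero_mem _
      · push Not at hneg
        choose b hb using fun i => Int.eq_ofNat_of_zero_le (hneg i)
        simp only [hb, pPolyInt_natCast]
        have hlt := sq_sum_lt_of_perm_ne_one (a := fun i => (a i : ℤ))
          (fun i j hij => Int.ofNat_le.2 (ha hij)) hσ1
        simp only [hb] at hlt
        have hlt' : ∑ i, a i ^ 2 < ∑ i, b i ^ 2 := by exact_mod_cast hlt
        have hsum : ∑ i, b i = ∑ i, a i := by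
          have h1 : ∑ i, (b i : ℤ) = ∑ i, (a i : ℤ) := by
            rw [← sum_congr rfl fun i _ => hb i, sum_add_distrib, sum_sub_distrib,
              Equiv.sum_comp σ fun i => (a i : ℤ), Equiv.sum_comp σ fun i => ((i : ℕ) : ℤ)]
            ring
          exact_mod_cast h1
        have hle : ∑ i, b i ^ 2 ≤ (∑ i, b i) ^ 2 :=
          sum_sq_le_sq_sum_of_nonneg fun i _ => Nat.zero_le _
        exact ih _ (by rw [hsum] at hle ⊢; omega) b rfl
    let σ := Tuple.sort (fun i => OrderDual.toDual (a i))
    have hσ : Antitone (a ∘ σ) := fun i j hij =>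
      Tuple.monotone_sort (fun i => OrderDual.toDual (a i)) hij
    have := hsort (a ∘ σ) hσ (by
      simp only [Function.comp_apply]
      rw [Equiv.sum_comp σ a, Equiv.sum_comp σ fun i => a i ^ 2, hN])
    simp only [Function.comp_apply] at this
    rwa [Equiv.prod_comp σ fun i => pPoly k (a i)] at this

/-- In the recursion for $(n+1)p_{n+1}$ the term with $p_0=1$ is $(n+1)x_{n+1}$ and the others
involve only earlier $x_i$, so the $x_i$ are successively polynomials in the $p_j$. -/
theorem adjoin_pPoly : Algebra.adjoin k (Set.range (pPoly k)) = ⊤ := by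
  have hp : ∀ n, pPoly k n ∈ Algebra.adjoin k (Set.range (pPoly k)) :=
    fun n => Algebra.subset_adjoin ⟨n, rfl⟩
  have hX : ∀ n : ℕ, (MvPolynomial.X n.succPNat : MvPolynomial ℕ+ k) ∈
      Algebra.adjoin k (Set.range (pPoly k)) := by
    intro n
    induction n using Nat.strong_induction_on with
    | _ n ih =>
      have h := pPoly_succ_mul k n
      have hmem : (0, n) ∈ antidiagonal n := by simp
      rw [← add_sum_erase _ _ hmem, pPoly_zero, one_mul] at h
      have hne : (n : k) + 1 ≠ 0 := by exact_mod_cast n.succ_ne_zero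
      have hc : (n : MvPolynomial ℕ+ k) + 1 = algebraMap k _ ((n : k) + 1) := by simp
      have hnat : ∀ m : ℕ, (m : MvPolynomial ℕ+ k) + 1 ∈
          Algebra.adjoin k (Set.range (pPoly k)) := fun m =>
        add_mem (natCast_mem _ m) (one_mem _)
      have h2 : ((n : MvPolynomial ℕ+ k) + 1) * MvPolynomial.X n.succPNat ∈
          Algebra.adjoin k (Set.range (pPoly k)) := by
        rw [← sub_eq_of_eq_add h]
        refine sub_mem (mul_mem (hp _) (hnat n)) (sum_mem fun x hx => ?_)
        rw [mem_erase, HasAntidiagonal.mem_antidiagonal] at hx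
        refine mul_mem (hp _) (mul_mem (hnat _) (ih _ ?_))
        by_contra hcon
        exact hx.1 (Prod.ext (by simp; omega) (by simp; omega))
      rw [hc, ← Algebra.smul_def] at h2
      have h3 := Subalgebra.smul_mem _ h2 ((n : k) + 1)⁻¹
      rwa [smul_smul, inv_mul_cancel₀ hne, one_smul] at h3
  rw [eq_top_iff, ← MvPolynomial.adjoin_range_X, Algebra.adjoin_le_iff]
  rintro _ ⟨i, rfl⟩
  have := hX (i.natPred)
  rwa [PNat.succPNat_natPred] at this

theorem span_schur : Submodule.span k (Set.range (schur k)) = ⊤ := by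
  rw [eq_top_iff, ← Algebra.top_toSubmodule, ← adjoin_pPoly (k := k), Algebra.adjoin_eq_span,
    Submodule.span_le]
  intro Q hQ
  obtain ⟨l, hl, rfl⟩ := Submonoid.exists_list_of_mem_closure hQ
  choose! a ha using hl
  have : l.prod = ∏ i : Fin l.length, pPoly k (a (l.get i)) := by
    rw [← List.prod_ofFn]
    congr 1
    refine List.ext_getElem (by simp) fun n h1 h2 => ?_
    simp [ha _ (List.getElem_mem h1)]
  rw [this]
  exact prod_pPoly_mem_span_schur _

theorem span_negX_schur : Submodule.span k (Set.range fun μ => negX (schur k μ)) = ⊤ := by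
  have h := congrArg (Submodule.map (negXHom k).toLinearMap) (span_schur (k := k))
  rw [Submodule.map_span, Submodule.map_top, ← Set.range_comp] at h
  refine h.trans (LinearMap.range_eq_top.2 fun Q => ⟨negX Q, negX_negX Q⟩)

end Span

/-! ### The pairing of polynomials and formal series -/

section Pairing

variable {k σ R : Type*} [Field k] [CommRing R] [Algebra k R]

/-- The number `∏ eₛ! cₛ ^ eₛ`. -/
def pairWeight (c : σ → k) (e : σ →₀ ℕ) : k :=
  e.prod fun s n => (n.factorial : k) * c s ^ n

/-- The value at `0` of `Q(c ∂) F`, as a linear form in `Q`. -/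
def pair (c : σ → k) (F : MvPowerSeries σ R) : MvPolynomial σ R →ₗ[R] R :=
  (MvPolynomial.basisMonomials σ R).constr R fun e =>
    algebraMap k R (pairWeight c e) * MvPowerSeries.coeff e F

variable (c : σ → k)

theorem pairWeight_zero : pairWeight c 0 = 1 := by
  simp [pairWeight]

theorem pairWeight_add_single (e : σ →₀ ℕ) (s : σ) :
    pairWeight c (e + Finsupp.single s 1) = pairWeight c e * ((e s + 1) * c s) := by
  rw [pairWeight, prod_add_single _ (by simp) e s (((e s : k) + 1) * c s), pairWeight]
  rw [Nat.factorial_succ, pow_succ]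
  push_cast
  ring

theorem pairWeight_ne_zero [CharZero k] (hc : ∀ s, c s ≠ 0) (e : σ →₀ ℕ) :
    pairWeight c e ≠ 0 := by
  refine prod_ne_zero_iff.2 fun s _ => mul_ne_zero ?_ (pow_ne_zero _ (hc s))
  exact_mod_cast Nat.factorial_ne_zero _

theorem pair_monomial (F : MvPowerSeries σ R) (e : σ →₀ ℕ) (a : R) :
    pair c F (MvPolynomial.monomial e a) =
      a * (algebraMap k R (pairWeight c e) * MvPowerSeries.coeff e F) := by
  have h1 : MvPolynomial.monomial e a = a • MvPolynomial.basisMonomials σ R e := by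
    rw [MvPolynomial.coe_basisMonomials, MvPolynomial.smul_monomial, smul_eq_mul, mul_one]
  rw [h1, map_smul, pair, Module.Basis.constr_basis, smul_eq_mul]

theorem pair_ext {f g : MvPolynomial σ R →ₗ[R] R}
    (h : ∀ e, f (MvPolynomial.monomial e 1) = g (MvPolynomial.monomial e 1)) : f = g :=
  (MvPolynomial.basisMonomials σ R).ext fun e => by
    rw [MvPolynomial.coe_basisMonomials]
    exact h e

theorem pair_C (F : MvPowerSeries σ R) (a : R) :
    pair c F (MvPolynomial.C a) = a * MvPowerSeries.constantCoeff F := by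
  have := pair_monomial c F 0 a
  rw [pairWeight_zero, map_one, one_mul, MvPowerSeries.coeff_zero_eq_constantCoeff_apply] at this
  exact this

theorem pair_add (F G : MvPowerSeries σ R) : pair c (F + G) = pair c F + pair c G :=
  pair_ext fun e => by
    rw [LinearMap.add_apply, pair_monomial, pair_monomial, pair_monomial, map_add]
    ring

theorem pair_C_mul (r : R) (F : MvPowerSeries σ R) :
    pair c (MvPowerSeries.C r * F) = r • pair c F :=
  pair_ext fun e => by
    rw [LinearMap.smul_apply, pair_monomial, pair_monomial, MvPowerSeries.coeff_C_mul, smul_eq_mul]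
    ring

theorem pair_one (Q : MvPolynomial σ R) :
    pair c (1 : MvPowerSeries σ R) Q = MvPolynomial.constantCoeff Q := by
  classical
  have : pair c (1 : MvPowerSeries σ R) = MvPolynomial.lcoeff R 0 :=
    pair_ext fun e => by
      rw [pair_monomial, MvPowerSeries.coeff_one, MvPolynomial.lcoeff_apply,
        MvPolynomial.coeff_monomial]
      split_ifs with h
      · rw [h, pairWeight_zero]; simp
      · simp
  rw [this]
  rfl

/-- Multiplication by $x_s$ on polynomials is adjoint to $c_s\partial_s$ on series. Symmetrically,
in `pair_X_mul_right`, multiplication by $t_s$ is adjoint to $c_s\partial/\partial x_s$. Together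
these two rules stand in for the calculus of differential operators. -/
theorem pair_mul_X (F : MvPowerSeries σ R) (Q : MvPolynomial σ R) (s : σ) :
    pair c F (Q * MvPolynomial.X s) =
      pair c (MvPowerSeries.C (algebraMap k R (c s)) * MvPowerSeries.pderiv R s F) Q := by
  have : pair c F ∘ₗ LinearMap.mulRight R (MvPolynomial.X s) =
      pair c (MvPowerSeries.C (algebraMap k R (c s)) * MvPowerSeries.pderiv R s F) :=
    pair_ext fun e => by
      rw [LinearMap.comp_apply, LinearMap.mulRight_apply, MvPolynomial.X,
        MvPolynomial.monomial_mul, mul_one, pair_monomial, pair_monomial, pairWeight_add_single,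
        MvPowerSeries.coeff_C_mul, MvPowerSeries.coeff_pderiv]
      simp only [map_mul, map_add, map_natCast, map_one]
      ring
  exact LinearMap.congr_fun this Q

theorem pair_X_mul_right (F : MvPowerSeries σ R) (Q : MvPolynomial σ R) (s : σ) :
    pair c (MvPowerSeries.X s * F) Q =
      algebraMap k R (c s) * pair c F (MvPolynomial.pderiv s Q) := by
  have : pair c (MvPowerSeries.X s * F) =
      algebraMap k R (c s) • (pair c F ∘ₗ (MvPolynomial.pderiv s).toLinearMap) :=
    pair_ext fun e => by
      classical
      change _ = algebraMap k R (c s) *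
        pair c F (MvPolynomial.pderiv s (MvPolynomial.monomial e 1))
      rw [MvPolynomial.pderiv_monomial, pair_monomial, pair_monomial, MvPowerSeries.X,
        MvPowerSeries.coeff_monomial_mul]
      split_ifs with h
      · obtain ⟨e', rfl⟩ := exists_add_of_le h
        rw [add_comm, add_tsub_cancel_right, pairWeight_add_single]
        simp only [map_mul, map_add, map_natCast, map_one, Finsupp.add_apply,
          Finsupp.single_eq_same]
        push_cast
        ring
      · have : e s = 0 := by
          by_contra hc
          exact h (Finsupp.single_le_iff.2 (Nat.one_le_iff_ne_zero.2 hc))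
        simp [this]
  exact LinearMap.congr_fun this Q

theorem pair_eq_zero_of_support (Q : MvPolynomial σ R)
    (F : MvPowerSeries σ R) (h : ∀ e ∈ Q.support, MvPowerSeries.coeff e F = 0) :
    pair c F Q = 0 := by
  rw [MvPolynomial.as_sum Q, map_sum]
  refine sum_eq_zero fun e he => ?_
  rw [pair_monomial, h e he, mul_zero, mul_zero]

end Pairing

/-! ### Differential operators -/

section DiffOp

variable {k : Type*} [Field k]

theorem coeff_dTilde (s : Fin 3 × ℕ+) (F : MvPowerSeries (Fin 3 × ℕ+) k)
    (d : Fin 3 × ℕ+ →₀ ℕ) : MvPowerSeries.coeff d (dTilde k s F) =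
      ((s.2 : ℕ) : k)⁻¹ * (MvPowerSeries.coeff (d + Finsupp.single s 1) F * (d s + 1)) := by
  rw [dTilde, LinearMap.smul_apply, MvPowerSeries.coeff_smul]
  exact congrArg _ (MvPowerSeries.coeff_pderiv F d)

theorem coeff_dTilde_pow (s : Fin 3 × ℕ+) (n : ℕ) (F : MvPowerSeries (Fin 3 × ℕ+) k)
    (d : Fin 3 × ℕ+ →₀ ℕ) :
    MvPowerSeries.coeff d ((dTilde k s ^ n) F) * ((d s).factorial : k) =
      (((s.2 : ℕ) : k)⁻¹ ^ n * ((d s + n).factorial : k)) *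
        MvPowerSeries.coeff (d + Finsupp.single s n) F := by
  induction n generalizing F with
  | zero => simp [mul_comm]
  | succ n ih =>
    rw [pow_succ, Module.End.mul_apply, ih, coeff_dTilde, add_assoc, ← Finsupp.single_add,
      ← add_assoc (d s), Nat.factorial_succ]
    simp only [Finsupp.add_apply, Finsupp.single_eq_same]
    push_cast
    ring

/-- Since `d` vanishes on `S`, each derivative of order $e_s$ produces the full factorial $e_s!$.
This generality is what the induction over `S` needs; only `d = 0` is used afterwards. -/
theorem coeff_noncommProd_dTilde (e : Fin 3 × ℕ+ →₀ ℕ) (S : Finset (Fin 3 × ℕ+))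
    (hS : (S : Set (Fin 3 × ℕ+)).Pairwise (Function.onFun Commute fun s => dTilde k s ^ e s))
    (F : MvPowerSeries (Fin 3 × ℕ+) k) (d : Fin 3 × ℕ+ →₀ ℕ) (hd : ∀ s ∈ S, d s = 0) :
    MvPowerSeries.coeff d (S.noncommProd (fun s => dTilde k s ^ e s) hS F) =
    (∏ s ∈ S, ((e s).factorial : k) * ((s.2 : ℕ) : k)⁻¹ ^ e s) *
      MvPowerSeries.coeff (d + ∑ s ∈ S, Finsupp.single s (e s)) F := by
  classical
  induction S using Finset.induction_on generalizing d with
  | empty => simp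
  | insert a S ha ih =>
    rw [noncommProd_insert_of_notMem _ _ _ _ ha, Module.End.mul_apply, prod_insert ha,
      sum_insert ha]
    have h0 := hd a (mem_insert_self a S)
    have h1 := coeff_dTilde_pow a (e a) (S.noncommProd (fun s => dTilde k s ^ e s)
      (hS.mono fun _ => mem_insert_of_mem) F) d
    rw [h0, Nat.factorial_zero, Nat.cast_one, mul_one, zero_add] at h1
    rw [h1, ih, add_assoc]
    · ring
    · intro s hs
      have : a ≠ s := fun h => ha (h ▸ hs)
      simp [hd s (mem_insert_of_mem hs), Ne.symm this]

/-- The bridge from the operators of the statement to the linear form `pair`, on which the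
computations are done. -/
theorem constantCoeff_diffOp (Q : MvPolynomial (Fin 3 × ℕ+) k)
    (F : MvPowerSeries (Fin 3 × ℕ+) k) :
    MvPowerSeries.constantCoeff (diffOp Q F) =
      pair (fun s : Fin 3 × ℕ+ => ((s.2 : ℕ) : k)⁻¹) F Q := by
  conv_rhs => rw [MvPolynomial.as_sum Q, map_sum]
  rw [diffOp, LinearMap.sum_apply, map_sum]
  refine sum_congr rfl fun e _ => ?_
  rw [LinearMap.smul_apply, ← MvPowerSeries.coeff_zero_eq_constantCoeff_apply,
    MvPowerSeries.coeff_smul, pair_monomial]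
  refine congrArg (Q.coeff e * ·)
    ((coeff_noncommProd_dTilde e e.support _ F 0 fun _ _ => rfl).trans ?_)
  rw [zero_add, show ∑ s ∈ e.support, Finsupp.single s (e s) = e from Finsupp.sum_single e]
  rfl

end DiffOp

/-! ### Products in separate sets of variables -/

/-- The scaling factors `1 / i` of the operators `∂̃`. -/
def timeScale (k : Type*) [Field k] (i : ℕ+) : k := ((i : ℕ) : k)⁻¹

section Separate

variable {τ R : Type*} [CommRing R]

/-- The series `F` involves only the variables in `p`. -/
def InVariables (p : Set τ) (F : MvPowerSeries τ R) : Prop :=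
  ∀ u : τ →₀ ℕ, MvPowerSeries.coeff u F ≠ 0 → ∀ i, u i ≠ 0 → i ∈ p

theorem InVariables.mono {p q : Set τ} (h : p ⊆ q) {F : MvPowerSeries τ R}
    (hF : InVariables p F) : InVariables q F :=
  fun u hu i hi => h (hF u hu i hi)

theorem InVariables.mul {p : Set τ} {F G : MvPowerSeries τ R} (hF : InVariables p F)
    (hG : InVariables p G) : InVariables p (F * G) := by
  classical
  intro u hu i hi
  rw [MvPowerSeries.coeff_mul] at hu
  obtain ⟨x, hx, hne⟩ := exists_ne_zero_of_sum_ne_zero hu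
  rw [HasAntidiagonal.mem_antidiagonal] at hx
  rw [← hx, Finsupp.add_apply] at hi
  by_cases h : x.1 i = 0
  · exact hG x.2 (right_ne_zero_of_mul hne) i (by omega)
  · exact hF x.1 (left_ne_zero_of_mul hne) i h

/-- The exponent $a+b$ splits in only one way into a part supported in `p` and a part supported off
`p`, so the convolution has a single term. Applied twice, it separates the variables $t,t',t''$. -/
theorem coeff_mul_of_inVariables {p : Set τ} {F G : MvPowerSeries τ R} (hF : InVariables p F)
    (hG : InVariables pᶜ G) {a b : τ →₀ ℕ} (ha : ∀ i, a i ≠ 0 → i ∈ p)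
    (hb : ∀ i, b i ≠ 0 → i ∈ pᶜ) :
    MvPowerSeries.coeff (a + b) (F * G) =
      MvPowerSeries.coeff a F * MvPowerSeries.coeff b G := by
  classical
  rw [MvPowerSeries.coeff_mul, sum_eq_single (a, b)]
  · rintro ⟨u, v⟩ hx hne
    by_contra hcon
    have hu := hF u (left_ne_zero_of_mul hcon)
    have hv := hG v (right_ne_zero_of_mul hcon)
    rw [HasAntidiagonal.mem_antidiagonal] at hx
    have key : u = a := by
      ext i
      have h1 := DFunLike.congr_fun hx i
      simp only [Finsupp.add_apply] at h1
      by_cases hi : i ∈ p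
      · have h2 : v i = 0 := by by_contra hc; exact hv i hc hi
        have h3 : b i = 0 := by by_contra hc; exact hb i hc hi
        omega
      · have h2 : u i = 0 := by by_contra hc; exact hi (hu i hc)
        have h3 : a i = 0 := by by_contra hc; exact hi (ha i hc)
        omega
    subst key
    exact hne (Prod.ext rfl (add_left_cancel hx))
  · intro h
    simp at h

/-- The exponent `e` in the `a`-th set of variables. -/
def inExp (a : Fin 3) (e : ℕ+ →₀ ℕ) : Fin 3 × ℕ+ →₀ ℕ :=
  e.embDomain (Function.Embedding.sectR a ℕ+)

theorem inExp_apply (a b : Fin 3) (e : ℕ+ →₀ ℕ) (i : ℕ+) :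
    inExp a e (b, i) = if b = a then e i else 0 := by
  rw [inExp]
  split_ifs with h
  · subst h
    exact Finsupp.embDomain_apply_self (Function.Embedding.sectR b ℕ+) e i
  · refine Finsupp.embDomain_of_notMem_range _ _ _ ?_
    rintro ⟨j, hj⟩
    exact h (congrArg Prod.fst hj).symm

theorem mem_of_inExp_ne_zero {a : Fin 3} {e : ℕ+ →₀ ℕ} (s : Fin 3 × ℕ+)
    (h : inExp a e s ≠ 0) : s ∈ {s : Fin 3 × ℕ+ | s.1 = a} := by
  obtain ⟨b, i⟩ := s
  rw [inExp_apply] at h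
  by_contra hc
  exact h (if_neg hc)

theorem coeff_inExp_inVars (a : Fin 3) (F : MvPowerSeries ℕ+ R) (e : ℕ+ →₀ ℕ) :
    MvPowerSeries.coeff (inExp a e) (inVars a F) = MvPowerSeries.coeff e F :=
  MvPowerSeries.coeff_embDomain_rename _ F e

theorem inVariables_inVars (a : Fin 3) (F : MvPowerSeries ℕ+ R) :
    InVariables {s : Fin 3 × ℕ+ | s.1 = a} (inVars a F) := by
  intro u hu s hs
  by_contra hc
  refine hu (MvPowerSeries.coeff_rename_eq_zero _ F ?_)
  rintro ⟨e, he⟩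
  refine hc ?_
  have h1 : s ∈ u.support := Finsupp.mem_support_iff.2 hs
  rw [← he] at h1
  classical
  obtain ⟨i, -, hi⟩ := mem_image.1 (Finsupp.mapDomain_support h1)
  rw [← hi]
  rfl

theorem coeff_inVars_mul (F : Fin 3 → MvPowerSeries ℕ+ R) (e : Fin 3 → ℕ+ →₀ ℕ) :
    MvPowerSeries.coeff (inExp 0 (e 0) + inExp 1 (e 1) + inExp 2 (e 2))
        (inVars 0 (F 0) * inVars 1 (F 1) * inVars 2 (F 2)) =
      MvPowerSeries.coeff (e 0) (F 0) * MvPowerSeries.coeff (e 1) (F 1) *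
        MvPowerSeries.coeff (e 2) (F 2) := by
  have h01 : ∀ a : Fin 3, a ≠ 2 →
      {s : Fin 3 × ℕ+ | s.1 = a} ⊆ {s : Fin 3 × ℕ+ | s.1 ≠ 2} := by
    rintro a ha s rfl
    exact ha
  have h2 : {s : Fin 3 × ℕ+ | s.1 = 2} ⊆ {s : Fin 3 × ℕ+ | s.1 ≠ 2}ᶜ := fun s hs hc => hc hs
  have h1 : {s : Fin 3 × ℕ+ | s.1 = 1} ⊆ {s : Fin 3 × ℕ+ | s.1 = 0}ᶜ := by
    rintro s hs hc
    exact absurd (hs.symm.trans hc) (by decide)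
  rw [coeff_mul_of_inVariables (p := {s : Fin 3 × ℕ+ | s.1 ≠ 2}),
    coeff_mul_of_inVariables (p := {s : Fin 3 × ℕ+ | s.1 = 0}),
    coeff_inExp_inVars, coeff_inExp_inVars, coeff_inExp_inVars]
  · exact inVariables_inVars 0 _
  · exact (inVariables_inVars 1 _).mono h1
  · exact mem_of_inExp_ne_zero
  · exact fun s hs => h1 (mem_of_inExp_ne_zero s hs)
  · exact ((inVariables_inVars 0 _).mono (h01 0 (by decide))).mul
      ((inVariables_inVars 1 _).mono (h01 1 (by decide)))
  · exact (inVariables_inVars 2 _).mono h2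
  · intro s hs
    rw [Finsupp.add_apply] at hs
    by_cases h : inExp 0 (e 0) s = 0
    · exact h01 1 (by decide) (mem_of_inExp_ne_zero s (by omega : inExp 1 (e 1) s ≠ 0))
    · exact h01 0 (by decide) (mem_of_inExp_ne_zero s h)
  · exact fun s hs => h2 (mem_of_inExp_ne_zero s hs)

theorem exists_eq_inExp_add (u : Fin 3 × ℕ+ →₀ ℕ) :
    ∃ e : Fin 3 → ℕ+ →₀ ℕ, u = inExp 0 (e 0) + inExp 1 (e 1) + inExp 2 (e 2) := by
  refine ⟨fun a => u.comapDomain (Prod.mk a) (Prod.mk_right_injective a).injOn, ?_⟩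
  ext ⟨b, i⟩
  simp only [Finsupp.add_apply, inExp_apply, Finsupp.comapDomain_apply]
  fin_cases b <;> simp

variable {k : Type*} [Field k]

theorem pairWeight_inExp (e : Fin 3 → ℕ+ →₀ ℕ) :
    pairWeight (fun s : Fin 3 × ℕ+ => ((s.2 : ℕ) : k)⁻¹)
        (inExp 0 (e 0) + inExp 1 (e 1) + inExp 2 (e 2)) =
      pairWeight (timeScale k) (e 0) *
        pairWeight (timeScale k) (e 1) *
        pairWeight (timeScale k) (e 2) := by
  have hdisj : ∀ (a b : Fin 3) (d d' : ℕ+ →₀ ℕ), a ≠ b →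
      Disjoint (inExp a d).support (inExp b d').support := by
    intro a b d d' hab
    rw [Finset.disjoint_left]
    intro s hs hs'
    have h1 := mem_of_inExp_ne_zero s (Finsupp.mem_support_iff.1 hs)
    have h2 := mem_of_inExp_ne_zero s (Finsupp.mem_support_iff.1 hs')
    exact hab (h1.symm.trans h2)
  have hemb : ∀ (a : Fin 3) (d : ℕ+ →₀ ℕ),
      pairWeight (fun s : Fin 3 × ℕ+ => ((s.2 : ℕ) : k)⁻¹) (inExp a d) =
        pairWeight (timeScale k) d := by
    intro a d
    rw [pairWeight, inExp, Finsupp.prod_embDomain]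
    rfl
  classical
  rw [← hemb 0, ← hemb 1, ← hemb 2, pairWeight, Finsupp.prod_add_index_of_disjoint,
    Finsupp.prod_add_index_of_disjoint (hdisj 0 1 _ _ (by decide))]
  · rfl
  · refine Finset.disjoint_of_subset_left Finsupp.support_add ?_
    rw [disjoint_union_left]
    exact ⟨hdisj 0 2 _ _ (by decide), hdisj 1 2 _ _ (by decide)⟩

theorem inX_monomial (a : Fin 3) (e : ℕ+ →₀ ℕ) (c : k) :
    inX a (MvPolynomial.monomial e c) = MvPolynomial.monomial (inExp a e) c := by
  rw [inX, MvPolynomial.rename_monomial, inExp, Finsupp.embDomain_eq_mapDomain]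
  rfl

theorem pair_inX_mul (F : Fin 3 → MvPowerSeries ℕ+ k) (Q : Fin 3 → MvPolynomial ℕ+ k) :
    pair (fun s : Fin 3 × ℕ+ => ((s.2 : ℕ) : k)⁻¹)
        (inVars 0 (F 0) * inVars 1 (F 1) * inVars 2 (F 2))
        (inX 0 (Q 0) * inX 1 (Q 1) * inX 2 (Q 2)) =
      pair (timeScale k) (F 0) (Q 0) *
        pair (timeScale k) (F 1) (Q 1) *
        pair (timeScale k) (F 2) (Q 2) := by
  have hexp : ∀ a : Fin 3, inX a (Q a) =
      ∑ e ∈ (Q a).support, MvPolynomial.monomial (inExp a e) ((Q a).coeff e) := by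
    intro a
    conv_lhs => rw [MvPolynomial.as_sum (Q a)]
    rw [inX, map_sum]
    exact sum_congr rfl fun e _ => inX_monomial a e _
  have hpair : ∀ a : Fin 3, pair (timeScale k) (F a) (Q a) =
      ∑ e ∈ (Q a).support, (Q a).coeff e *
        (pairWeight (timeScale k) e * MvPowerSeries.coeff e (F a)) := by
    intro a
    conv_lhs => rw [MvPolynomial.as_sum (Q a)]
    rw [map_sum]
    exact sum_congr rfl fun e _ => pair_monomial _ _ _ _
  rw [hexp 0, hexp 1, hexp 2, hpair 0, hpair 1, hpair 2]
  simp only [sum_mul, mul_sum, map_sum, MvPolynomial.monomial_mul]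
  refine sum_congr rfl fun e2 _ => sum_congr rfl fun e1 _ => sum_congr rfl fun e0 _ => ?_
  rw [pair_monomial]
  have h1 := coeff_inVars_mul F ![e0, e1, e2]
  have h2 := pairWeight_inExp (k := k) ![e0, e1, e2]
  simp only [Matrix.cons_val_zero, Matrix.cons_val_one, Matrix.cons_val] at h1 h2
  rw [h1, h2, Algebra.algebraMap_self_apply]
  ring

end Separate

/-! ### The shift `t ↦ t + [z]` -/

section Shift

variable {k : Type*} [Field k]

/-- A series in `t` and `z` as a series in `t` with coefficients in `k((z))`. -/
def splitTime (S : MvPowerSeries (ℕ+ ⊕ Unit) k) : MvPowerSeries ℕ+ (LaurentSeries k) :=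
  fun d => HahnSeries.ofPowerSeries ℤ k (PowerSeries.mk fun n =>
    MvPowerSeries.coeff (d.sumElim (Finsupp.single () n)) S)

theorem tauShift_eq (τ : MvPowerSeries ℕ+ k) :
    tauShift τ = splitTime (MvPowerSeries.subst (shiftVars k) τ) := rfl

theorem coeff_splitTime (S : MvPowerSeries (ℕ+ ⊕ Unit) k) (d : ℕ+ →₀ ℕ) :
    MvPowerSeries.coeff d (splitTime S) = HahnSeries.ofPowerSeries ℤ k (PowerSeries.mk fun n =>
      MvPowerSeries.coeff (d.sumElim (Finsupp.single () n)) S) := rfl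

theorem splitTime_add (S T : MvPowerSeries (ℕ+ ⊕ Unit) k) :
    splitTime (S + T) = splitTime S + splitTime T := by
  ext1 d
  rw [map_add, coeff_splitTime, coeff_splitTime, coeff_splitTime, ← map_add]
  congr 1

theorem splitTime_C_mul (r : k) (S : MvPowerSeries (ℕ+ ⊕ Unit) k) :
    splitTime (MvPowerSeries.C r * S) = MvPowerSeries.C (HahnSeries.C r) * splitTime S := by
  ext1 d
  rw [MvPowerSeries.coeff_C_mul, coeff_splitTime, coeff_splitTime, ← HahnSeries.ofPowerSeries_C,
    ← map_mul]
  congr 1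
  ext1 n
  rw [PowerSeries.coeff_C_mul, PowerSeries.coeff_mk, PowerSeries.coeff_mk,
    MvPowerSeries.coeff_C_mul]

theorem splitTime_X_inr_pow_mul (i : ℕ) (S : MvPowerSeries (ℕ+ ⊕ Unit) k) :
    splitTime (MvPowerSeries.X (Sum.inr ()) ^ i * S) =
      MvPowerSeries.C (zpow k i) * splitTime S := by
  classical
  ext1 d
  rw [MvPowerSeries.coeff_C_mul, coeff_splitTime, coeff_splitTime, zpow,
    ← HahnSeries.ofPowerSeries_X_pow, ← map_mul]
  congr 1
  ext1 n
  rw [PowerSeries.coeff_mk, PowerSeries.coeff_X_pow_mul', MvPowerSeries.X_pow_eq,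
    MvPowerSeries.coeff_monomial_mul, one_mul, PowerSeries.coeff_mk]
  have hiff : Finsupp.single (Sum.inr ()) i ≤ d.sumElim (Finsupp.single () n) ↔ i ≤ n := by
    rw [Finsupp.single_le_iff]
    simp
  rw [if_congr hiff rfl rfl]
  split_ifs with h
  · congr 2
    ext s
    rcases s with j | u <;> simp
  · rfl

theorem splitTime_X_inl_mul (i : ℕ+) (S : MvPowerSeries (ℕ+ ⊕ Unit) k) :
    splitTime (MvPowerSeries.X (Sum.inl i) * S) = MvPowerSeries.X i * splitTime S := by
  classical
  ext1 d
  rw [MvPowerSeries.X, MvPowerSeries.X, MvPowerSeries.coeff_monomial_mul, coeff_splitTime,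
    coeff_splitTime]
  simp only [MvPowerSeries.coeff_monomial_mul, one_mul]
  have hiff : ∀ n, Finsupp.single (Sum.inl i) 1 ≤ d.sumElim (Finsupp.single () n) ↔
      Finsupp.single i 1 ≤ d := by
    intro n
    rw [Finsupp.single_le_iff, Finsupp.single_le_iff]
    simp
  simp only [hiff]
  split_ifs with h
  · congr 1
    ext1 n
    rw [PowerSeries.coeff_mk, PowerSeries.coeff_mk]
    congr 2
    ext s
    rcases s with j | u
    · by_cases hj : i = j
      · subst hj; simp
      · have : Sum.inl i ≠ (Sum.inl j : ℕ+ ⊕ Unit) := fun hc => hj (Sum.inl_injective hc)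
        simp [hj, this]
    · simp
  · have : (PowerSeries.mk fun _ : ℕ => (0 : k)) = 0 := by ext; simp
    rw [this, map_zero]

theorem tauShift_add (F G : MvPowerSeries ℕ+ k) : tauShift (F + G) = tauShift F + tauShift G := by
  rw [tauShift_eq, tauShift_eq, tauShift_eq, MvPowerSeries.subst_add (hasSubst_shiftVars k),
    splitTime_add]

theorem tauShift_C_mul (r : k) (F : MvPowerSeries ℕ+ k) :
    tauShift (MvPowerSeries.C r * F) = MvPowerSeries.C (HahnSeries.C r) * tauShift F := by
  rw [tauShift_eq, tauShift_eq, ← MvPowerSeries.smul_eq_C_mul,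
    MvPowerSeries.subst_smul (hasSubst_shiftVars k), MvPowerSeries.smul_eq_C_mul, splitTime_C_mul]

theorem tauShift_X_mul (i : ℕ+) (F : MvPowerSeries ℕ+ k) :
    tauShift (MvPowerSeries.X i * F) = MvPowerSeries.X i * tauShift F +
      MvPowerSeries.C (HahnSeries.C (timeScale k i) * zpow k (i : ℕ)) * tauShift F := by
  rw [tauShift_eq, tauShift_eq, MvPowerSeries.subst_mul (hasSubst_shiftVars k),
    MvPowerSeries.subst_X (hasSubst_shiftVars k), shiftVars, add_mul, splitTime_add,
    splitTime_X_inl_mul, mul_assoc, splitTime_C_mul, splitTime_X_inr_pow_mul, map_mul, mul_assoc]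
  rfl

theorem tauShift_one : tauShift (1 : MvPowerSeries ℕ+ k) = 1 := by
  classical
  rw [tauShift_eq]
  have h1 : MvPowerSeries.subst (shiftVars k) (1 : MvPowerSeries ℕ+ k) = 1 := by
    rw [← MvPowerSeries.coe_substAlgHom (hasSubst_shiftVars k), map_one]
  rw [h1]
  ext1 d
  rw [coeff_splitTime, MvPowerSeries.coeff_one]
  split_ifs with h
  · subst h
    rw [← map_one (HahnSeries.ofPowerSeries ℤ k)]
    congr 1
    ext1 n
    rw [PowerSeries.coeff_mk, MvPowerSeries.coeff_one, PowerSeries.coeff_one]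
    refine if_congr ⟨fun hc => ?_, fun hc => ?_⟩ rfl rfl
    · have := DFunLike.congr_fun hc (Sum.inr ())
      simpa using this
    · subst hc
      ext s
      rcases s with j | u <;> simp
  · rw [← map_zero (HahnSeries.ofPowerSeries ℤ k)]
    congr 1
    ext1 n
    rw [PowerSeries.coeff_mk, MvPowerSeries.coeff_one, if_neg, map_zero]
    intro hc
    refine h (Finsupp.ext fun i => ?_)
    have := DFunLike.congr_fun hc (Sum.inl i)
    simpa using this

theorem coeff_tauShift_of_neg (F : MvPowerSeries ℕ+ k) (d : ℕ+ →₀ ℕ) {n : ℤ} (hn : n < 0) :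
    (MvPowerSeries.coeff d (tauShift F)).coeff n = 0 := by
  rw [tauShift_eq, coeff_splitTime, PowerSeries.coeff_coe, if_pos hn]

/-- Each coefficient of `τ(t + [z])` depends on finitely many coefficients of `τ`. -/
theorem exists_finset_coeff_tauShift (d : ℕ+ →₀ ℕ) (n : ℤ) :
    ∃ s : Finset (ℕ+ →₀ ℕ), ∀ F : MvPowerSeries ℕ+ k,
      (∀ e ∈ s, MvPowerSeries.coeff e F = 0) →
        (MvPowerSeries.coeff d (tauShift F)).coeff n = 0 := by
  rcases lt_or_ge n 0 with hn | hn
  · exact ⟨∅, fun F _ => coeff_tauShift_of_neg F d hn⟩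
  lift n to ℕ using hn
  have hfin := MvPowerSeries.coeff_subst_finite (hasSubst_shiftVars k)
    (fun _ => 1 : MvPowerSeries ℕ+ k) (d.sumElim (Finsupp.single () n))
  refine ⟨hfin.toFinset, fun F hF => ?_⟩
  rw [tauShift_eq, coeff_splitTime, HahnSeries.ofPowerSeries_apply_coeff, PowerSeries.coeff_mk,
    MvPowerSeries.coeff_subst (hasSubst_shiftVars k)]
  refine finsum_eq_zero_of_forall_eq_zero fun e => ?_
  by_cases he : e ∈ hfin.toFinset
  · rw [hF e he, zero_smul]
  · replace he := mt (Set.Finite.mem_toFinset hfin).2 he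
    rw [Function.mem_support, not_not] at he
    have h1 : MvPowerSeries.coeff e (fun _ => 1 : MvPowerSeries ℕ+ k) = 1 := rfl
    rw [h1, one_smul] at he
    rw [he, smul_zero]

/-! ### Taylor's formula for the shift -/

variable [CharZero k]

theorem pderiv_pPolyInt (m : ℕ+) (n : ℤ) :
    MvPolynomial.pderiv m (pPolyInt k n) = pPolyInt k (n - (m : ℕ)) := by
  have hm := m.pos
  rcases lt_or_ge n 0 with hn | hn
  · rw [pPolyInt_of_neg hn, pPolyInt_of_neg (by omega), map_zero]
  lift n to ℕ using hn
  rw [pPolyInt_natCast, pderiv_pPoly]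
  split_ifs with h
  · rw [← pPolyInt_natCast]
    congr 1
    omega
  · rw [pPolyInt_of_neg (by omega)]

theorem constantCoeff_pPolyInt (n : ℤ) :
    MvPolynomial.constantCoeff (pPolyInt k n) = if n = 0 then 1 else 0 := by
  rcases lt_trichotomy n 0 with h | h | h
  · rw [pPolyInt_of_neg h, if_neg h.ne, map_zero]
  · rw [h, pPolyInt_zero, if_pos rfl, map_one]
  · obtain ⟨m, rfl⟩ : ∃ m : ℕ, n = ((m + 1 : ℕ) : ℤ) := ⟨(n - 1).toNat, by omega⟩
    rw [if_neg h.ne', pPolyInt_natCast]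
    have h1 := congrArg MvPolynomial.constantCoeff (pPoly_succ_mul k m)
    rw [map_mul, map_sum, sum_eq_zero (fun x _ => by simp)] at h1
    have hne : (m : k) + 1 ≠ 0 := by exact_mod_cast m.succ_ne_zero
    simpa [hne] using h1

/-- Taylor's formula on polynomials: the identity of `pair_tauShift` holds for `F`. -/
def TaylorHolds (F : MvPowerSeries ℕ+ k) : Prop :=
  ∀ (Q : MvPolynomial ℕ+ k) (n : ℤ),
    (pair (timeScale k) (tauShift F) (Q.map (algebraMap k (LaurentSeries k)))).coeff n =
      pair (timeScale k) F (pPolyInt k n * Q)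

theorem taylorHolds_one : TaylorHolds (1 : MvPowerSeries ℕ+ k) := by
  classical
  intro Q n
  rw [tauShift_one, pair_one, pair_one, map_mul, constantCoeff_pPolyInt,
    MvPolynomial.constantCoeff_map, algebraMap_laurent, HahnSeries.C_apply,
    HahnSeries.coeff_single, ite_mul, one_mul, zero_mul]
  congr

theorem TaylorHolds.add {F G : MvPowerSeries ℕ+ k} (hF : TaylorHolds F) (hG : TaylorHolds G) :
    TaylorHolds (F + G) := by
  intro Q n
  rw [tauShift_add, pair_add, pair_add, LinearMap.add_apply, LinearMap.add_apply,
    HahnSeries.coeff_add, hF Q n, hG Q n]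

theorem TaylorHolds.C_mul {F : MvPowerSeries ℕ+ k} (hF : TaylorHolds F) (r : k) :
    TaylorHolds (MvPowerSeries.C r * F) := by
  intro Q n
  rw [tauShift_C_mul, pair_C_mul, pair_C_mul, LinearMap.smul_apply, LinearMap.smul_apply,
    smul_eq_mul, smul_eq_mul, coeff_C_mul, hF Q n]

/-- The shift sends $t_i$ to $t_i+z^i/i$. Under the pairing the first summand differentiates $Q$ and
the second lowers $n$ by $i$; together they are the Leibniz rule for $\partial_{x_i}(p_nQ)$, because
$\partial_{x_i}p_n=p_{n-i}$. -/
theorem TaylorHolds.X_mul {F : MvPowerSeries ℕ+ k} (hF : TaylorHolds F) (i : ℕ+) :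
    TaylorHolds (MvPowerSeries.X i * F) := by
  intro Q n
  rw [tauShift_X_mul, pair_add, LinearMap.add_apply, HahnSeries.coeff_add, pair_X_mul_right,
    pair_C_mul, LinearMap.smul_apply, smul_eq_mul, MvPolynomial.pderiv_map, algebraMap_laurent,
    coeff_C_mul, ← algebraMap_laurent, hF, mul_assoc, algebraMap_laurent, coeff_C_mul,
    coeff_zpow_mul, hF, pair_X_mul_right, Derivation.leibniz,
    pderiv_pPolyInt, smul_eq_mul, smul_eq_mul, map_add, mul_add, Algebra.algebraMap_self_apply,
    mul_comm Q]

theorem taylorHolds_monomial (e : ℕ+ →₀ ℕ) (r : k) :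
    TaylorHolds (MvPowerSeries.monomial e r) := by
  have h1 : MvPowerSeries.monomial e r = MvPowerSeries.C r * MvPowerSeries.monomial e (1 : k) := by
    rw [← MvPowerSeries.monomial_zero_eq_C_apply, MvPowerSeries.monomial_mul_monomial, zero_add,
      mul_one]
  rw [h1]
  refine TaylorHolds.C_mul ?_ r
  clear h1
  induction e using finsupp_induction_add_single with
  | h0 => exact taylorHolds_one
  | h e i ih =>
    have h2 : MvPowerSeries.monomial (e + Finsupp.single i 1) (1 : k) =
        MvPowerSeries.X i * MvPowerSeries.monomial e 1 := by
      rw [MvPowerSeries.X, MvPowerSeries.monomial_mul_monomial, add_comm, mul_one]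
    rw [h2]
    exact ih.X_mul i

theorem taylorHolds_sum {ι : Type*} (s : Finset ι) (F : ι → MvPowerSeries ℕ+ k)
    (h : ∀ i ∈ s, TaylorHolds (F i)) : TaylorHolds (∑ i ∈ s, F i) := by
  classical
  induction s using Finset.induction_on with
  | empty =>
    have := (taylorHolds_one (k := k)).C_mul 0
    rwa [map_zero, zero_mul] at this
  | insert i s hi ih =>
    rw [sum_insert hi]
    exact (h i (mem_insert_self i s)).add (ih fun j hj => h j (mem_insert_of_mem hj))

/-- Taylor's formula `τ(t + [z]) = ∑ z^n p_n(∂̃) τ(t)`. -/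
theorem pair_tauShift (F : MvPowerSeries ℕ+ k) (Q : MvPolynomial ℕ+ k) (n : ℤ) :
    (pair (timeScale k) (tauShift F) (Q.map (algebraMap k (LaurentSeries k)))).coeff n =
      pair (timeScale k) F (pPolyInt k n * Q) := by
  classical
  induction Q using MvPolynomial.induction_on' with
  | add P Q hP hQ => rw [map_add, map_add, HahnSeries.coeff_add, hP, hQ, mul_add, map_add]
  | monomial d a =>
    obtain ⟨s, hs⟩ := exists_finset_coeff_tauShift (k := k) d n
    let P := pPolyInt k n * MvPolynomial.monomial d a
    -- For fixed $Q$ and $n$ both sides see only finitely many coefficients of `F`. A polynomial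
    -- truncation carries them all, and the remainder contributes $0$ to each side.
    let F₀ : MvPowerSeries ℕ+ k := ∑ e ∈ s ∪ P.support,
      MvPowerSeries.monomial e (MvPowerSeries.coeff e F)
    obtain ⟨F₁, hF₁⟩ : ∃ F₁, F = F₀ + F₁ := ⟨F - F₀, by ring⟩
    have hvan : ∀ e ∈ s ∪ P.support, MvPowerSeries.coeff e F₁ = 0 := by
      intro e he
      have h1 : F₁ = F - F₀ := by rw [hF₁]; ring
      rw [h1, map_sub, map_sum, sum_eq_single e]
      · rw [MvPowerSeries.coeff_monomial_same, sub_self]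
      · intro e' _ hne
        exact MvPowerSeries.coeff_monomial_ne hne.symm _
      · exact fun h => absurd he h
    have h0 := taylorHolds_sum (s ∪ P.support) _
      (fun e _ => taylorHolds_monomial e (MvPowerSeries.coeff e F)) (MvPolynomial.monomial d a) n
    rw [hF₁, tauShift_add, pair_add, pair_add, LinearMap.add_apply, LinearMap.add_apply,
      HahnSeries.coeff_add, h0,
      pair_eq_zero_of_support _ P F₁ fun e he => hvan e (mem_union_right _ he),
      MvPolynomial.map_monomial, pair_monomial, algebraMap_laurent, algebraMap_laurent,
      coeff_C_mul, coeff_C_mul, hs F₁ fun e he => hvan e (mem_union_left _ he), mul_zero, mul_zero]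

theorem pair_tauShift_eq (F : MvPowerSeries ℕ+ k) (Q : MvPolynomial ℕ+ k) :
    pair (timeScale k) (tauShift F) (Q.map (algebraMap k (LaurentSeries k))) =
      HahnSeries.ofPowerSeries ℤ k
        (PowerSeries.mk fun n => pair (timeScale k) F (pPoly k n * Q)) := by
  ext n
  rw [pair_tauShift, PowerSeries.coeff_coe]
  split_ifs with h
  · rw [pPolyInt_of_neg h, zero_mul, map_zero]
  · lift n to ℕ using not_lt.1 h
    rw [pPolyInt_natCast, PowerSeries.coeff_mk, Int.natAbs_natCast]

end Shift

/-! ### The Baker-Akhiezer function against Schur polynomials -/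

section BakerPairing

variable {k : Type*} [Field k] [CharZero k]

/-- The substitution `x ↦ x - [z⁻¹]`. -/
def lowerVars (k : Type*) [Field k] :
    MvPolynomial ℕ+ (LaurentSeries k) →ₐ[LaurentSeries k] MvPolynomial ℕ+ (LaurentSeries k) :=
  MvPolynomial.aeval fun i => MvPolynomial.X i -
    MvPolynomial.C (HahnSeries.C (timeScale k i) * zpow k (-(i : ℤ)))

/-- Since $v^{-1}$ is an exponential,
$\tilde\partial_i(v^{-1}G)=v^{-1}(\tilde\partial_i-z^{-i}/i)G$, and $v^{-1}=1$ at $t=0$. -/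
theorem pair_vInv_mul (Q : MvPolynomial ℕ+ (LaurentSeries k))
    (G : MvPowerSeries ℕ+ (LaurentSeries k)) :
    pair (timeScale k) (vInv k * G) Q = pair (timeScale k) G (lowerVars k Q) := by
  induction Q using MvPolynomial.induction_on generalizing G with
  | C a =>
    rw [pair_C, lowerVars, MvPolynomial.aeval_C, MvPolynomial.algebraMap_eq, pair_C, map_mul,
      constantCoeff_vInv, one_mul]
  | add P Q hP hQ => rw [map_add, hP, hQ, map_add, map_add]
  | mul_X Q i ih =>
    have h1 : MvPowerSeries.C (algebraMap k (LaurentSeries k) (timeScale k i)) *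
        MvPowerSeries.pderiv (LaurentSeries k) i (vInv k * G) =
        vInv k * (MvPowerSeries.C (algebraMap k (LaurentSeries k) (timeScale k i)) *
          MvPowerSeries.pderiv (LaurentSeries k) i G +
          MvPowerSeries.C (-(HahnSeries.C (timeScale k i) * zpow k (-(i : ℤ)))) * G) := by
      rw [Derivation.leibniz, pderiv_vInv, smul_eq_mul, smul_eq_mul, algebraMap_laurent, map_neg,
        map_neg, map_mul]
      ring
    have h2 : lowerVars k (Q * MvPolynomial.X i) = lowerVars k Q * MvPolynomial.X i +
        (-(HahnSeries.C (timeScale k i) * zpow k (-(i : ℤ)))) • lowerVars k Q := by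
      rw [map_mul, MvPolynomial.smul_eq_C_mul, map_neg]
      conv_lhs => rw [lowerVars, MvPolynomial.aeval_X]
      rw [← lowerVars]
      ring
    rw [pair_mul_X, h1, ih, h2, map_add, pair_mul_X, pair_add, LinearMap.add_apply, pair_C_mul,
      pair_C_mul, map_smul]
    rfl

/-- The sign in $\chi_\nu(-x)$ turns $x-[z^{-1}]$ into $-x+[z^{-1}]$, so the branching rule applies
with the new variable $y=z^{-1}$. -/
theorem lowerVars_negX_schur (ν : YoungDiagram) :
    lowerVars k ((negX (schur k ν)).map (algebraMap k (LaurentSeries k))) =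
      ∑ α ∈ range (ν.card + 1), zpow k (-(α : ℤ)) •
        (negX (stripSum k ν α)).map (algebraMap k (LaurentSeries k)) := by
  have hneg : ∀ Q : MvPolynomial ℕ+ k,
      (negX Q).map (algebraMap k (LaurentSeries k)) =
        MvPolynomial.aeval (fun i : ℕ+ => -(MvPolynomial.X i :
          MvPolynomial ℕ+ (LaurentSeries k))) Q := by
    intro Q
    have : ((MvPolynomial.map (algebraMap k (LaurentSeries k))).comp (negXHom k).toRingHom) =
        (MvPolynomial.aeval (R := k) (fun i : ℕ+ => -(MvPolynomial.X i :
          MvPolynomial ℕ+ (LaurentSeries k)))).toRingHom := by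
      refine MvPolynomial.ringHom_ext (fun r => ?_) fun i => ?_
      · simp [negXHom, MvPolynomial.algebraMap_apply]
      · simp [negXHom]
    exact RingHom.congr_fun this Q
  have hlow : ∀ Q : MvPolynomial ℕ+ k,
      lowerVars k ((negX Q).map (algebraMap k (LaurentSeries k))) =
        MvPolynomial.aeval (fun i : ℕ+ => -(MvPolynomial.X i : MvPolynomial ℕ+ (LaurentSeries k)) +
          algebraMap k (MvPolynomial ℕ+ (LaurentSeries k)) ((i : ℕ) : k)⁻¹ *
            MvPolynomial.C (zpow k (-1)) ^ (i : ℕ)) Q := by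
    intro Q
    have : ((lowerVars k).toRingHom.comp
        ((MvPolynomial.map (algebraMap k (LaurentSeries k))).comp (negXHom k).toRingHom)) =
        (MvPolynomial.aeval (R := k) (fun i : ℕ+ =>
          -(MvPolynomial.X i : MvPolynomial ℕ+ (LaurentSeries k)) +
          algebraMap k (MvPolynomial ℕ+ (LaurentSeries k)) ((i : ℕ) : k)⁻¹ *
            MvPolynomial.C (zpow k (-1)) ^ (i : ℕ))).toRingHom := by
      refine MvPolynomial.ringHom_ext (fun r => ?_) fun i => ?_
      · simp [negXHom, lowerVars, MvPolynomial.algebraMap_apply]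
      · have h1 : zpow k (-1) ^ (i : ℕ) = zpow k (-(i : ℤ)) := by
          rw [zpow_pow]; congr 1; ring
        have h2 : algebraMap k (MvPolynomial ℕ+ (LaurentSeries k)) ((i : ℕ) : k)⁻¹ =
            MvPolynomial.C (HahnSeries.C ((i : ℕ) : k)⁻¹) := by
          rw [MvPolynomial.algebraMap_apply, algebraMap_laurent]
        simp only [AlgHom.toRingHom_eq_coe, RingHom.comp_apply, RingHom.coe_coe, negXHom,
          MvPolynomial.aeval_X, map_neg, MvPolynomial.map_X, lowerVars]
        rw [h2, ← map_pow, h1, ← map_mul, timeScale]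
        ring
    exact RingHom.congr_fun this Q
  rw [hlow, aeval_schur_add_variable]
  refine sum_congr rfl fun α _ => ?_
  rw [← hneg, MvPolynomial.smul_eq_C_mul, ← map_pow, zpow_pow]
  congr 3
  ring

/-- The Baker-Akhiezer numerator against the Schur polynomial `χ_ν(-x)`. -/
theorem pair_bakerNum_negX_schur (F : MvPowerSeries ℕ+ k) (ν : YoungDiagram) :
    pair (timeScale k) (bakerNum F)
        ((negX (schur k ν)).map (algebraMap k (LaurentSeries k))) =
      ∑ α ∈ range (ν.card + 1), zpow k (-(α : ℤ)) * HahnSeries.ofPowerSeries ℤ k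
        (PowerSeries.mk fun n =>
          pair (timeScale k) F (pPoly k n * negX (stripSum k ν α))) := by
  rw [bakerNum, pair_vInv_mul, lowerVars_negX_schur, map_sum]
  refine sum_congr rfl fun α _ => ?_
  rw [map_smul, pair_tauShift_eq, smul_eq_mul]

end BakerPairing

/-! ### The residue pairing -/

section Residue

variable {k : Type*} [Field k]

/-- The residue pairing `(f, h) ↦ Res_{z=0} f h dz`. -/
def resForm (k : Type*) [Field k] : LaurentSeries k →ₗ[k] LaurentSeries k →ₗ[k] k :=
  LinearMap.mk₂ k (fun f h => (f * h).coeff (-1)) (fun f f' h => by rw [add_mul]; rfl)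
    (fun c f h => by
      rw [← HahnSeries.C_mul_eq_smul, mul_assoc, coeff_C_mul, smul_eq_mul])
    (fun f h h' => by rw [mul_add]; rfl)
    (fun c f h => by
      rw [← HahnSeries.C_mul_eq_smul, mul_left_comm, coeff_C_mul, smul_eq_mul])

theorem resForm_apply (f h : LaurentSeries k) : resForm k f h = (f * h).coeff (-1) := rfl

theorem resForm_comm (f h : LaurentSeries k) : resForm k f h = resForm k h f := by
  rw [resForm_apply, resForm_apply, mul_comm]

theorem mem_orth {U : Submodule k (LaurentSeries k)} {f : LaurentSeries k} :
    f ∈ orth U ↔ ∀ u ∈ U, resForm k f u = 0 := Iff.rfl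

theorem resForm_zpow (f : LaurentSeries k) (n : ℤ) :
    resForm k f (zpow k n) = f.coeff (-1 - n) := by
  rw [resForm_comm, resForm_apply, coeff_zpow_mul]

theorem resForm_eq_zero_of_mem_zPlus {m n : ℤ} (h : 0 ≤ m + n) {f h' : LaurentSeries k}
    (hf : f ∈ zPlus k m) (hh : h' ∈ zPlus k n) : resForm k f h' = 0 := by
  rw [resForm_apply, coeff_mul_eq_sum_Ico hf hh, Ico_eq_empty (by omega), sum_empty]

theorem resForm_injective : Function.Injective (resForm k) := by
  rw [injective_iff_map_eq_zero]
  intro f hf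
  ext n
  have := resForm_zpow f (-1 - n)
  rw [hf] at this
  simpa using this.symm

theorem sub_coeff_smul_zpow_mem {m : ℤ} {f : LaurentSeries k} (hf : f ∈ zPlus k m) :
    f - f.coeff m • zpow k m ∈ zPlus k (m + 1) := by
  intro j hj
  rw [HahnSeries.coeff_sub, HahnSeries.coeff_smul, coeff_zpow, smul_eq_mul]
  split_ifs with h
  · rw [h]; simp
  · rw [hf j (by omega)]; simp

theorem eq_zero_of_eq_zero_on_zpow {φ : Module.Dual k (LaurentSeries k)}
    (h0 : ∀ f ∈ VPlus k, φ f = 0) (h1 : ∀ n : ℕ, φ (zpow k (-1 - n)) = 0) : φ = 0 := by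
  have key : ∀ n : ℕ, ∀ f ∈ zPlus k (-(n : ℤ)), φ f = 0 := by
    intro n
    induction n with
    | zero => simpa using h0
    | succ n ih =>
      intro f hf
      have h2 := sub_coeff_smul_zpow_mem hf
      have h3 := ih _ (by convert h2 using 2; push_cast; ring)
      have h4 : (-((n + 1 : ℕ) : ℤ)) = -1 - n := by push_cast; ring
      rw [map_sub, map_smul, h4, h1, smul_zero, sub_zero] at h3
      exact h3
  refine LinearMap.ext fun f => ?_
  obtain ⟨n, hn⟩ := exists_mem_zPlus_neg f
  exact key n f hn

/-- $V_+$ is the full dual of $V/V_+$: the functional is determined by its arbitrary values on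
$z^{-1},z^{-2},\dots$, and these are the coefficients of a power series. -/
theorem exists_resForm_eq {φ : Module.Dual k (LaurentSeries k)} (h0 : ∀ f ∈ VPlus k, φ f = 0) :
    ∃ y ∈ VPlus k, resForm k y = φ := by
  let y : LaurentSeries k :=
    HahnSeries.ofPowerSeries ℤ k (PowerSeries.mk fun n => φ (zpow k (-1 - n)))
  have hy : y ∈ VPlus k := fun j hj => by rw [PowerSeries.coeff_coe, if_pos hj]
  refine ⟨y, hy, sub_eq_zero.1 (eq_zero_of_eq_zero_on_zpow (fun f hf => ?_) fun n => ?_)⟩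
  · rw [LinearMap.sub_apply, h0 f hf, resForm_eq_zero_of_mem_zPlus (by simp) hy hf, sub_zero]
  · rw [LinearMap.sub_apply, resForm_zpow, show (-1 - (-1 - n : ℤ)) = n by ring,
      HahnSeries.ofPowerSeries_apply_coeff, PowerSeries.coeff_mk, sub_self]

theorem resForm_mem_dualAnnihilator {U : Submodule k (LaurentSeries k)} {f : LaurentSeries k} :
    resForm k f ∈ U.dualAnnihilator ↔ f ∈ orth U := by
  rw [Submodule.mem_dualAnnihilator, mem_orth]

theorem map_resForm_orth_inf (U : Submodule k (LaurentSeries k)) :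
    (orth U ⊓ VPlus k).map (resForm k) = (U ⊔ VPlus k).dualAnnihilator := by
  ext φ
  rw [Submodule.mem_map, Submodule.dualAnnihilator_sup_eq, Submodule.mem_inf]
  constructor
  · rintro ⟨f, ⟨hf, hf'⟩, rfl⟩
    refine ⟨resForm_mem_dualAnnihilator.2 hf, ?_⟩
    rw [Submodule.mem_dualAnnihilator]
    exact fun w hw => resForm_eq_zero_of_mem_zPlus (by simp) hf' hw
  · rintro ⟨h1, h2⟩
    obtain ⟨y, hy, rfl⟩ := exists_resForm_eq ((Submodule.mem_dualAnnihilator _).1 h2)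
    exact ⟨y, ⟨resForm_mem_dualAnnihilator.1 h1, hy⟩, rfl⟩

/-- The residue pairing identifies $U^\perp\cap V_+$ with the dual of $V/(U+V_+)$. In infinite
dimension both ranks are $0$ by convention, so no finiteness is required. -/
theorem finrank_orth_inf (U : Submodule k (LaurentSeries k)) :
    Module.finrank k ↥(orth U ⊓ VPlus k) =
      Module.finrank k (LaurentSeries k ⧸ (U ⊔ VPlus k)) := by
  rw [← Subspace.dual_finrank_eq (V := LaurentSeries k ⧸ (U ⊔ VPlus k)),
    ((U ⊔ VPlus k).dualQuotEquivDualAnnihilator).finrank_eq, ← map_resForm_orth_inf]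
  exact (Submodule.equivMapOfInjective _ resForm_injective _).finrank_eq

/-- The pairing induces a map $V\to(U\cap V_+)^*$. It is onto because the pairing is nondegenerate
and $U\cap V_+$ is finite-dimensional; its kernel is $U^\perp+V_+$. -/
theorem finrank_quot_orth_sup (U : Submodule k (LaurentSeries k))
    [FiniteDimensional k ↥(U ⊓ VPlus k)] :
    Module.finrank k (LaurentSeries k ⧸ (orth U ⊔ VPlus k)) =
      Module.finrank k ↥(U ⊓ VPlus k) := by
  let X := U ⊓ VPlus k
  let ρ : LaurentSeries k →ₗ[k] Module.Dual k X := X.subtype.dualMap ∘ₗ resForm k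
  have hρ : ∀ f (x : X), ρ f x = resForm k f x := fun _ _ => rfl
  have hsurj : Function.Surjective ρ := by
    have hinj : Function.Injective ρ.flip := by
      rw [injective_iff_map_eq_zero]
      intro x hx
      have h1 : resForm k (x : LaurentSeries k) = 0 := LinearMap.ext fun f => by
        rw [resForm_comm, ← hρ]
        exact LinearMap.congr_fun hx f
      exact Subtype.ext (resForm_injective (h1.trans (map_zero _).symm))
    have := LinearMap.flip_injective_iff₂ (B := ρ)
    exact this.1 hinj
  have hker : LinearMap.ker ρ = orth U ⊔ VPlus k := by
    refine le_antisymm (fun f hf => ?_) (sup_le (fun f hf => ?_) fun f hf => ?_)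
    · have h1 : resForm k f ∈ X.dualAnnihilator := by
        rw [Submodule.mem_dualAnnihilator]
        intro x hx
        exact LinearMap.congr_fun (LinearMap.mem_ker.1 hf) (⟨x, hx⟩ : X)
      -- A functional killing $U\cap V_+$ is a sum of one killing $U$ and one killing $V_+$. The
      -- latter is the residue against some $y\in V_+$, so $f-y\in U^\perp$.
      rw [Subspace.dualAnnihilator_inf_eq, Submodule.mem_sup] at h1
      obtain ⟨a, ha, b, hb, hab⟩ := h1
      obtain ⟨y, hy, rfl⟩ := exists_resForm_eq ((Submodule.mem_dualAnnihilator _).1 hb)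
      refine Submodule.mem_sup.2 ⟨f - y, ?_, y, hy, sub_add_cancel f y⟩
      rw [← resForm_mem_dualAnnihilator, map_sub, ← hab, add_sub_cancel_right]
      exact ha
    · exact LinearMap.mem_ker.2 (LinearMap.ext fun x => mem_orth.1 hf x x.2.1)
    · exact LinearMap.mem_ker.2 (LinearMap.ext fun x =>
        resForm_eq_zero_of_mem_zPlus (by simp) hf x.2.2)
  rw [← hker, (ρ.quotKerEquivOfSurjective hsurj).finrank_eq, Subspace.dual_finrank_eq]

/-- Hence the normalisations of the two $\tau$-functions use the opposite powers $z^{-n}$ and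
$z^{n}$, which cancel in the pairing, and $z^{-n}U\perp z^nU^\perp$. -/
theorem index_orth (U : Submodule k (LaurentSeries k)) [FiniteDimensional k ↥(U ⊓ VPlus k)] :
    index (orth U) = -index U := by
  rw [index, index, finrank_orth_inf, finrank_quot_orth_sup, neg_sub]

theorem mem_homothety {n : ℤ} {U : Submodule k (LaurentSeries k)} {f : LaurentSeries k} :
    f ∈ homothety n U ↔ ∃ u ∈ U, zpow k n * u = f := Iff.rfl

theorem resForm_homothety_orth {n : ℤ} {U : Submodule k (LaurentSeries k)}
    {f h : LaurentSeries k} (hf : f ∈ homothety n U) (hh : h ∈ homothety (-n) (orth U)) :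
    resForm k f h = 0 := by
  obtain ⟨u, hu, rfl⟩ := mem_homothety.1 hf
  obtain ⟨u', hu', rfl⟩ := mem_homothety.1 hh
  have := hu' u hu
  rw [resForm_apply, mul_mul_mul_comm, zpow_mul_zpow, add_neg_cancel, zpow_zero, one_mul,
    mul_comm, this]

end Residue

/-! ### Admissible bases -/

section Admissible

variable {k : Type*} [Field k]

theorem IsAdmissibleBasis.mem {W : Submodule k (LaurentSeries k)} {w : ℕ → LaurentSeries k}
    (h : IsAdmissibleBasis W w) (i : ℕ) : w i ∈ W := by
  rw [← h.span_eq]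
  exact Submodule.subset_span ⟨i, rfl⟩

/-- The bound must exceed the pole orders of the finitely many exceptional $w_i$ as well as $N_0$.
Beyond $N_0$ the element $w_n$ has leading term $z^{-(n+1)}$, so the poles of $f$ can be removed one
at a time down to order $M$. -/
theorem IsAdmissibleBasis.exists_bound {W : Submodule k (LaurentSeries k)}
    {w : ℕ → LaurentSeries k} (h : IsAdmissibleBasis W w) :
    ∃ N : ℕ, ∀ M ≥ N, (∀ i < M, w i ∈ zPlus k (-(M : ℤ))) ∧
      ∀ f, ∃ u ∈ W, f - u ∈ zPlus k (-(M : ℤ)) := by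
  obtain ⟨N₀, hN₀⟩ := h.eventually_eq
  choose b hb using fun i => exists_mem_zPlus_neg (w i)
  refine ⟨N₀ + ∑ i ∈ range N₀, b i, fun M hM => ⟨fun i hi => ?_, fun f => ?_⟩⟩
  · by_cases hiN : i < N₀
    · have h1 : b i ≤ ∑ i ∈ range N₀, b i :=
        single_le_sum (f := b) (fun _ _ => Nat.zero_le _) (mem_range.2 hiN)
      exact zPlus_mono (by omega) (hb i)
    · have h1 := zPlus_mono (show -(M : ℤ) ≤ -(N₀ : ℤ) by omega) (hN₀ i (not_lt.1 hiN))
      have h2 : zpow k (-(i + 1 : ℤ)) ∈ zPlus k (-(M : ℤ)) := zpow_mem_zPlus (by omega)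
      have := add_mem h1 h2
      rwa [sub_add_cancel] at this
  · have key : ∀ n : ℕ, ∀ f ∈ zPlus k (-(n : ℤ)), ∃ u ∈ W, f - u ∈ zPlus k (-(M : ℤ)) := by
      intro n
      induction n with
      | zero =>
        exact fun f hf => ⟨0, zero_mem _, by rw [sub_zero]; exact zPlus_mono (by simp) hf⟩
      | succ n ih =>
        intro f hf
        by_cases hn : n + 1 ≤ M
        · exact ⟨0, zero_mem _, by rw [sub_zero]; exact zPlus_mono (by omega) hf⟩
        · have h1 := sub_coeff_smul_zpow_mem hf
          have h2 := zPlus_mono (show -(n : ℤ) ≤ -(N₀ : ℤ) by omega) (hN₀ n (by omega))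
          have e1 : -((n + 1 : ℕ) : ℤ) + 1 = -(n : ℤ) := by push_cast; ring
          have e2 : -((n + 1 : ℕ) : ℤ) = -((n : ℤ) + 1) := by push_cast; ring
          rw [e1, e2] at h1
          set c := f.coeff (-((n : ℤ) + 1))
          obtain ⟨u, hu, hfu⟩ := ih (f - c • w n) (by
            have := sub_mem h1 (Submodule.smul_mem _ c h2)
            convert this using 1
            rw [smul_sub]
            abel)
          refine ⟨u + c • w n, add_mem hu (Submodule.smul_mem _ _ (h.mem n)), ?_⟩
          rwa [add_comm, ← sub_sub]
    obtain ⟨n, hn⟩ := exists_mem_zPlus_neg f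
    exact key n f hn

/-- If `W ⟂ W'` and `W' + z^{-M} V_+ = V`, then `W ∩ z^M V_+ = 0`. -/
theorem eq_zero_of_mem_zPlus {W W' : Submodule k (LaurentSeries k)}
    (horth : ∀ f ∈ W, ∀ h ∈ W', resForm k f h = 0) {M : ℤ}
    (hW' : ∀ f, ∃ u ∈ W', f - u ∈ zPlus k (-M)) {x : LaurentSeries k} (hx : x ∈ W)
    (hxM : x ∈ zPlus k M) : x = 0 := by
  refine resForm_injective ((LinearMap.ext fun f => ?_).trans (map_zero _).symm)
  obtain ⟨u, hu, hfu⟩ := hW' f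
  have h1 := horth x hx u hu
  have h2 := resForm_eq_zero_of_mem_zPlus (by omega) hxM hfu
  rw [map_sub, h1, sub_zero] at h2
  exact h2

end Admissible

/-! ### Matrices on a window of exponents -/

section Window

variable {k : Type*} [Field k]

/-- The exponents `-1, ..., -M` and `0, ..., M - 1`. -/
def winExp {M : ℕ} : Fin M ⊕ Fin M → ℤ :=
  Sum.elim (fun l => -((l : ℕ) + 1 : ℤ)) fun l => (l : ℕ)

theorem winExp_mem {M : ℕ} (q : Fin M ⊕ Fin M) : winExp q ∈ Ico (-(M : ℤ)) M := by
  rcases q with l | l <;> have := l.2 <;>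
    simp only [winExp, Sum.elim_inl, Sum.elim_inr, mem_Ico] <;> omega

theorem winExp_injective {M : ℕ} : Function.Injective (winExp (M := M)) := by
  rintro (l | l) (l' | l') h <;> simp only [winExp, Sum.elim_inl, Sum.elim_inr] at h
  · exact congrArg Sum.inl (Fin.ext (by omega))
  · omega
  · omega
  · exact congrArg Sum.inr (Fin.ext (by omega))

/-- Exponents $a$ and $-1-a$ are dual under the residue, so the two halves of the window are
exchanged by the pairing. -/
theorem winExp_swap {M : ℕ} (q : Fin M ⊕ Fin M) : winExp q.swap = -1 - winExp q := by
  rcases q with l | l <;>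
    simp only [winExp, Sum.swap_inl, Sum.swap_inr, Sum.elim_inl, Sum.elim_inr] <;>
    ring

theorem sum_winExp {A : Type*} [AddCommMonoid A] {M : ℕ} (f : ℤ → A) :
    ∑ q : Fin M ⊕ Fin M, f (winExp q) = ∑ a ∈ Ico (-(M : ℤ)) M, f a := by
  refine sum_bij (fun q _ => winExp q) (fun q _ => winExp_mem q)
    (fun q _ q' _ h => winExp_injective h) (fun a ha => ?_) fun _ _ => rfl
  rw [mem_Ico] at ha
  rcases lt_or_ge a 0 with h | h
  · exact ⟨Sum.inl ⟨(-a - 1).toNat, by omega⟩, mem_univ _, by simp [winExp]; omega⟩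
  · exact ⟨Sum.inr ⟨a.toNat, by omega⟩, mem_univ _, by simp [winExp]; omega⟩

/-- The coefficients of `w 0, ..., w (M - 1)` in the window. -/
def winMatrix (w : ℕ → LaurentSeries k) (M : ℕ) : Matrix (Fin M ⊕ Fin M) (Fin M) k :=
  Matrix.of fun q i => (w i).coeff (winExp q)

/-- The matrix `winMatrix`, with constant series as entries. -/
def winSeries (w : ℕ → LaurentSeries k) (M : ℕ) :
    Matrix (Fin M ⊕ Fin M) (Fin M) (MvPowerSeries ℕ+ k) :=
  (winMatrix w M).map MvPowerSeries.C

/-- The transpose of `winMatrix`, with the window reversed by the residue pairing. -/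
def winDual (w : ℕ → LaurentSeries k) (M : ℕ) : Matrix (Fin M) (Fin M ⊕ Fin M) k :=
  Matrix.of fun i q => (w i).coeff (winExp q.swap)

/-- For two elements of $z^{-M}V_+$ the residue of the product involves only exponents of the
window, so orthogonality survives the truncation. -/
theorem winDual_mul_winMatrix {w w' : ℕ → LaurentSeries k} {M : ℕ}
    (hw : ∀ i < M, w i ∈ zPlus k (-(M : ℤ))) (hw' : ∀ i < M, w' i ∈ zPlus k (-(M : ℤ)))
    (h : ∀ i j, resForm k (w i) (w' j) = 0) : winDual w' M * winMatrix w M = 0 := by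
  ext j i
  have h1 := h i j
  rw [resForm_apply, coeff_mul_eq_sum_Ico (hw i i.2) (hw' j j.2),
    show (-1 - -(M : ℤ) + 1) = M by ring, ← sum_winExp] at h1
  rw [Matrix.mul_apply, Matrix.zero_apply, ← h1]
  refine sum_congr rfl fun q _ => ?_
  rw [winDual, winMatrix, Matrix.of_apply, Matrix.of_apply, winExp_swap, mul_comm]

theorem exists_left_inverse_of_mulVec {m n : Type*} [Fintype m] [Fintype n] [DecidableEq n]
    [DecidableEq m] (A : Matrix m n k) (h : ∀ c, A.mulVec c = 0 → c = 0) :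
    ∃ L : Matrix n m k, L * A = 1 := by
  obtain ⟨g, hg⟩ := LinearMap.exists_leftInverse_of_injective (Matrix.toLin' A)
    (LinearMap.ker_eq_bot'.2 fun c hc => h c (by rwa [Matrix.toLin'_apply] at hc))
  refine ⟨LinearMap.toMatrix' g, ?_⟩
  have := congrArg LinearMap.toMatrix' hg
  rwa [LinearMap.toMatrix'_comp, LinearMap.toMatrix'_toLin', LinearMap.toMatrix'_id] at this

/-- A combination of $w_0,\dots,w_{M-1}$ with zero coefficients in the window lies in $z^MV_+$,
hence is $0$; the columns are therefore independent. -/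
theorem exists_left_inverse_winMatrix {w : ℕ → LaurentSeries k} (hli : LinearIndependent k w)
    {M : ℕ} (hw : ∀ i < M, w i ∈ zPlus k (-(M : ℤ)))
    (h0 : ∀ x ∈ Submodule.span k (Set.range w), x ∈ zPlus k M → x = 0) :
    ∃ L : Matrix (Fin M) (Fin M ⊕ Fin M) k, L * winMatrix w M = 1 := by
  refine exists_left_inverse_of_mulVec _ fun c hc => ?_
  have hli' : LinearIndependent k fun i : Fin M => w i := hli.comp _ Fin.val_injective
  have hx : ∑ i : Fin M, c i • w i = 0 := by
    refine h0 _ (Submodule.sum_mem _ fun i _ => Submodule.smul_mem _ _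
      (Submodule.subset_span ⟨i, rfl⟩)) fun j hj => ?_
    rw [HahnSeries.coeff_sum]
    simp only [HahnSeries.coeff_smul, smul_eq_mul]
    by_cases hjM : j < -(M : ℤ)
    · exact sum_eq_zero fun i _ => by rw [hw i i.2 j hjM, mul_zero]
    · have hmem : j ∈ Ico (-(M : ℤ)) M := mem_Ico.2 ⟨not_lt.1 hjM, hj⟩
      obtain ⟨q, hq⟩ : ∃ q : Fin M ⊕ Fin M, winExp q = j := by
        by_contra hcon
        push Not at hcon
        have h1 := sum_winExp (M := M) fun a => if a = j then (1 : ℕ) else 0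
        rw [sum_ite_eq' (Ico (-(M : ℤ)) M) j, if_pos hmem,
          sum_eq_zero fun q _ => if_neg (hcon q)] at h1
        omega
      have := congrFun hc q
      rw [Matrix.mulVec, dotProduct, Pi.zero_apply] at this
      rw [← this]
      refine sum_congr rfl fun i _ => ?_
      rw [winMatrix, Matrix.of_apply, hq, mul_comm]
  funext i
  exact Fintype.linearIndependent_iff.1 hli' c hx i

theorem exists_right_inverse_winDual {w : ℕ → LaurentSeries k} (hli : LinearIndependent k w)
    {M : ℕ} (hw : ∀ i < M, w i ∈ zPlus k (-(M : ℤ)))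
    (h0 : ∀ x ∈ Submodule.span k (Set.range w), x ∈ zPlus k M → x = 0) :
    ∃ K : Matrix (Fin M ⊕ Fin M) (Fin M) k, winDual w M * K = 1 := by
  obtain ⟨L, hL⟩ := exists_left_inverse_winMatrix hli hw h0
  refine ⟨L.transpose.submatrix Sum.swap id, ?_⟩
  have h1 := congrArg Matrix.transpose hL
  rw [Matrix.transpose_mul, Matrix.transpose_one] at h1
  rw [← h1]
  ext i j
  rw [Matrix.mul_apply, Matrix.mul_apply]
  exact Equiv.sum_comp (Equiv.sumComm (Fin M) (Fin M))
    fun q => (winMatrix w M).transpose i q * L.transpose q j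

/-! ### Toeplitz matrices -/

/-- The matrix of multiplication by `F` on the window. -/
def toeplitz (F : MvPowerSeries ℕ+ (LaurentSeries k)) (M : ℕ) :
    Matrix (Fin M ⊕ Fin M) (Fin M ⊕ Fin M) (MvPowerSeries ℕ+ k) :=
  Matrix.of fun p q => zCoeff (winExp p - winExp q) F

/-- `F` has the form `∑ c_d t^d z^{-|d|}`. -/
def IsIsobaric (F : MvPowerSeries ℕ+ (LaurentSeries k)) (c : (ℕ+ →₀ ℕ) → k) : Prop :=
  ∀ d, MvPowerSeries.coeff d F = HahnSeries.C (c d) * zpow k (-(timeWeight d : ℤ))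

theorem coeff_zCoeff (n : ℤ) (F : MvPowerSeries ℕ+ (LaurentSeries k)) (d : ℕ+ →₀ ℕ) :
    MvPowerSeries.coeff d (zCoeff n F) = (MvPowerSeries.coeff d F).coeff n := rfl

theorem IsIsobaric.coeff_zCoeff {F : MvPowerSeries ℕ+ (LaurentSeries k)} {c : (ℕ+ →₀ ℕ) → k}
    (hF : IsIsobaric F c) (n : ℤ) (d : ℕ+ →₀ ℕ) :
    MvPowerSeries.coeff d (zCoeff n F) = if n = -(timeWeight d : ℤ) then c d else 0 := by
  rw [SatoGr.coeff_zCoeff, hF, coeff_C_mul, coeff_zpow, mul_ite, mul_one, mul_zero]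

theorem timeWeight_eq_zero {d : ℕ+ →₀ ℕ} (h : timeWeight d = 0) : d = 0 := by
  induction d using finsupp_induction_add_single with
  | h0 => rfl
  | h d i ih =>
    rw [map_add, timeWeight_single] at h
    have := i.pos
    omega

theorem IsIsobaric.zCoeff_of_pos {F : MvPowerSeries ℕ+ (LaurentSeries k)} {c : (ℕ+ →₀ ℕ) → k}
    (hF : IsIsobaric F c) {n : ℤ} (hn : 0 < n) : zCoeff n F = 0 := by
  ext d
  rw [hF.coeff_zCoeff, if_neg (by omega), map_zero]

theorem IsIsobaric.zCoeff_zero {F : MvPowerSeries ℕ+ (LaurentSeries k)} {c : (ℕ+ →₀ ℕ) → k}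
    (hF : IsIsobaric F c) (hc : c 0 = 1) : zCoeff 0 F = 1 := by
  classical
  ext d
  rw [hF.coeff_zCoeff, MvPowerSeries.coeff_one]
  by_cases hd : d = 0
  · subst hd; simp [hc]
  · rw [if_neg hd, if_neg]
    intro h
    exact hd (timeWeight_eq_zero (by omega))

/-- Truncation is multiplicative here because isobaric series contain no positive powers of $z$. A
nonzero term forces the intermediate exponent to lie between those of `p` and `r`, hence in the
window. -/
theorem toeplitz_mul {F G : MvPowerSeries ℕ+ (LaurentSeries k)} {a b : (ℕ+ →₀ ℕ) → k}
    (hF : IsIsobaric F a) (hG : IsIsobaric G b) (M : ℕ) :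
    toeplitz F M * toeplitz G M = toeplitz (F * G) M := by
  classical
  ext p r d
  rw [Matrix.mul_apply]
  simp only [toeplitz, Matrix.of_apply]
  rw [sum_winExp fun q => zCoeff (winExp p - q) F * zCoeff (q - winExp r) G, map_sum]
  simp only [MvPowerSeries.coeff_mul, SatoGr.coeff_zCoeff, HahnSeries.coeff_sum]
  rw [sum_comm]
  refine sum_congr rfl fun x _ => ?_
  have hp := mem_Ico.1 (winExp_mem p)
  have hr := mem_Ico.1 (winExp_mem r)
  rw [hF, hG]
  have h1 : ∀ q : ℤ, (HahnSeries.C (a x.1) * zpow k (-(timeWeight x.1 : ℤ))).coeff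
      (winExp p - q) * (HahnSeries.C (b x.2) * zpow k (-(timeWeight x.2 : ℤ))).coeff
      (q - winExp r) = if q = winExp p + timeWeight x.1 then
        (if winExp p - winExp r = -(timeWeight x.1 : ℤ) - timeWeight x.2
          then a x.1 * b x.2 else 0) else 0 := by
    intro q
    simp only [coeff_C_mul, coeff_zpow, mul_ite, mul_one, mul_zero]
    split_ifs <;> first | rfl | omega | simp
  rw [sum_congr rfl fun q _ => h1 q, sum_ite_eq']
  have h2 : HahnSeries.C (a x.1) * zpow k (-(timeWeight x.1 : ℤ)) *
      (HahnSeries.C (b x.2) * zpow k (-(timeWeight x.2 : ℤ))) =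
      HahnSeries.C (a x.1 * b x.2) * zpow k (-(timeWeight x.1 : ℤ) - timeWeight x.2) := by
    rw [mul_mul_mul_comm, zpow_mul_zpow, map_mul, sub_eq_add_neg]
  rw [h2, coeff_C_mul, coeff_zpow, mul_ite, mul_one, mul_zero]
  simp only [mem_Ico]
  split_ifs <;> first | rfl | omega

theorem toeplitz_one (M : ℕ) :
    toeplitz (1 : MvPowerSeries ℕ+ (LaurentSeries k)) M = 1 := by
  classical
  ext p q d
  rw [toeplitz, Matrix.of_apply, SatoGr.coeff_zCoeff, MvPowerSeries.coeff_one, Matrix.one_apply]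
  by_cases hpq : p = q
  · subst hpq
    rw [if_pos rfl, MvPowerSeries.coeff_one, sub_self]
    split_ifs
    · exact HahnSeries.coeff_one.trans (if_pos rfl)
    · rfl
  · have h1 : winExp p - winExp q ≠ 0 := sub_ne_zero.2 fun h => hpq (winExp_injective h)
    rw [if_neg hpq, map_zero]
    split_ifs
    · exact HahnSeries.coeff_one.trans (if_neg h1)
    · rfl

theorem det_toeplitz {F : MvPowerSeries ℕ+ (LaurentSeries k)} {c : (ℕ+ →₀ ℕ) → k}
    (hF : IsIsobaric F c) (hc : c 0 = 1) (M : ℕ) : (toeplitz F M).det = 1 := by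
  have htri : Matrix.BlockTriangular (toeplitz F M) winExp := by
    intro p q hpq
    rw [toeplitz, Matrix.of_apply]
    exact hF.zCoeff_of_pos (by omega)
  rw [htri.det]
  refine prod_eq_one fun a _ => ?_
  have : (toeplitz F M).toSquareBlock winExp a = 1 := by
    ext1 p q
    have hpq : p = q := Subtype.ext (winExp_injective (p.2.trans q.2.symm))
    rw [hpq, Matrix.one_apply_eq, Matrix.toSquareBlock_def, Matrix.of_apply, toeplitz,
      Matrix.of_apply, sub_self, hF.zCoeff_zero hc]
  rw [this, Matrix.det_one]

/-! ### Corners of the windowed matrices, up to high weight -/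

/-- The rows of negative exponents of a matrix on the window. -/
def upperRows {R : Type*} {M : ℕ} (A : Matrix (Fin M ⊕ Fin M) (Fin M) R) :
    Matrix (Fin M) (Fin M) R :=
  A.submatrix Sum.inl id

/-- The series without terms of weight at most `M`. -/
def weightIdeal (k : Type*) [Field k] (M : ℕ) : Ideal (MvPowerSeries ℕ+ k) where
  carrier := {F | ∀ d, timeWeight d ≤ M → MvPowerSeries.coeff d F = 0}
  add_mem' hF hG d hd := by rw [map_add, hF d hd, hG d hd, add_zero]
  zero_mem' d _ := map_zero _
  smul_mem' G F hF d hd := by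
    classical
    rw [smul_eq_mul, MvPowerSeries.coeff_mul]
    refine sum_eq_zero fun x hx => ?_
    have := congrArg timeWeight (HasAntidiagonal.mem_antidiagonal.1 hx)
    rw [map_add] at this
    rw [hF x.2 (by omega), mul_zero]

/-- Agreement of the coefficients of weight at most $M$ is congruence modulo an ideal, and
determinants respect congruences. -/
theorem coeff_det_eq_of_coeff_eq {M n : ℕ} {A B : Matrix (Fin n) (Fin n) (MvPowerSeries ℕ+ k)}
    (h : ∀ i j d, timeWeight d ≤ M →
      MvPowerSeries.coeff d (A i j) = MvPowerSeries.coeff d (B i j))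
    {d : ℕ+ →₀ ℕ} (hd : timeWeight d ≤ M) :
    MvPowerSeries.coeff d A.det = MvPowerSeries.coeff d B.det := by
  have h1 : A.det - B.det ∈ weightIdeal k M := by
    rw [← Ideal.Quotient.eq, RingHom.map_det, RingHom.map_det]
    congr 1
    ext i j
    refine Ideal.Quotient.eq.2 fun d hd => ?_
    rw [map_sub, h i j d hd, sub_self]
  have h2 := h1 d hd
  rwa [map_sub, sub_eq_zero] at h2

/-- Up to high weight, the upper rows of the Toeplitz matrix applied to `w` are the matrix of
`w_i ↦ F w_i` modulo `V_+`. -/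
theorem coeff_upperRows_toeplitz_mul {F : MvPowerSeries ℕ+ (LaurentSeries k)}
    {c : (ℕ+ →₀ ℕ) → k} (hF : IsIsobaric F c) (w : ℕ → LaurentSeries k) {M : ℕ}
    (l i : Fin M) {d : ℕ+ →₀ ℕ} (hd : timeWeight d ≤ M) :
    MvPowerSeries.coeff d
        (upperRows (toeplitz F M * winSeries w M) l i) =
      MvPowerSeries.coeff d (zCoeff (-((l : ℕ) + 1 : ℤ)) (F * MvPowerSeries.C (w i))) := by
  have hl := l.2
  rw [upperRows, Matrix.submatrix_apply, id, Matrix.mul_apply, SatoGr.coeff_zCoeff,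
    MvPowerSeries.coeff_mul_C, hF, mul_assoc, coeff_C_mul, coeff_zpow_mul, map_sum]
  simp only [winSeries, Matrix.map_apply, MvPowerSeries.coeff_mul_C, toeplitz, Matrix.of_apply,
    hF.coeff_zCoeff, winMatrix]
  -- Only the exponent $|d|-(l+1)$ contributes, and $|d|\le M$ keeps it below $M$.
  rw [sum_winExp fun q => (if winExp (Sum.inl l : Fin M ⊕ Fin M) - q = -(timeWeight d : ℤ)
    then c d else 0) * (w i).coeff q, sum_eq_single (-((l : ℕ) + 1 : ℤ) - -(timeWeight d : ℤ))]
  · rw [if_pos]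
    simp only [winExp, Sum.elim_inl]
    ring
  · intro q _ hq
    rw [if_neg, zero_mul]
    simp only [winExp, Sum.elim_inl]
    omega
  · intro hn
    exact absurd (mem_Ico.2 ⟨by omega, by omega⟩) hn

end Window

/-! ### Duality of `τ`-functions -/

section Duality

variable {k : Type*} [Field k]

/-- Complementary minors: if the windows of `w` and `w'` are orthogonal, the minors of negative
exponents of `F w` and `F⁻¹ w'` are proportional. -/
theorem exists_ne_zero_det_upperRows {F G : MvPowerSeries ℕ+ (LaurentSeries k)}
    {a b : (ℕ+ →₀ ℕ) → k} (hF : IsIsobaric F a) (hG : IsIsobaric G b) (hb : b 0 = 1)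
    (hGF : G * F = 1) {w w' : ℕ → LaurentSeries k} {M : ℕ}
    {L : Matrix (Fin M) (Fin M ⊕ Fin M) k} (hL : L * winMatrix w M = 1)
    {K : Matrix (Fin M ⊕ Fin M) (Fin M) k} (hK : winDual w' M * K = 1)
    (h0 : winDual w' M * winMatrix w M = 0) :
    ∃ y : k, y ≠ 0 ∧
      MvPowerSeries.C y *
        (upperRows (toeplitz F M * winSeries w M)).det =
      (upperRows (toeplitz G M * winSeries w' M)).det := by
  let ι : k →+* MvPowerSeries ℕ+ k := MvPowerSeries.C
  -- A change of basis of the window taking the columns of $w$ to the first $M$ unit vectors. It is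
  -- invertible because its product with $(w\mid K)$ is block unipotent; its determinant is the
  -- constant sought.
  let Y : Matrix (Fin M ⊕ Fin M) (Fin M ⊕ Fin M) k := Matrix.fromRows L (winDual w' M)
  have hY : Y.det ≠ 0 := by
    have h1 : Y * Matrix.fromCols (winMatrix w M) K = Matrix.fromBlocks 1 (L * K) 0 1 := by
      rw [Matrix.fromRows_mul_fromCols, hL, hK, h0]
    have h2 := congrArg Matrix.det h1
    rw [Matrix.det_mul, Matrix.det_fromBlocks_zero₂₁, Matrix.det_one, mul_one] at h2
    exact left_ne_zero_of_mul_eq_one h2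
  refine ⟨Y.det, hY, ?_⟩
  set A := toeplitz F M * winSeries w M with hA
  set Z := (Y.map ι) * toeplitz G M with hZ
  have hZA : Z * A = Matrix.fromRows 1 0 := by
    rw [hZ, hA, Matrix.mul_assoc, ← Matrix.mul_assoc (toeplitz G M), toeplitz_mul hG hF, hGF,
      toeplitz_one, Matrix.one_mul, show winSeries w M = (winMatrix w M).map ι from rfl,
      ← Matrix.map_mul, Matrix.fromRows_mul, hL, h0]
    ext (i | i) j
    · simp [Matrix.one_apply, ι, apply_ite (MvPowerSeries.C (σ := ℕ+) (R := k))]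
    · simp [ι]
  -- Toeplitz entries depend only on differences of exponents, so the reflection $a\mapsto-1-a$
  -- transposes them.
  have hcol : Z.submatrix Sum.inr Sum.inr =
      (upperRows (toeplitz G M * winSeries w' M)).transpose := by
    ext1 j l
    rw [Matrix.submatrix_apply, Matrix.transpose_apply, upperRows, Matrix.submatrix_apply, hZ,
      Matrix.mul_apply, Matrix.mul_apply,
      ← Equiv.sum_comp (Equiv.sumComm (Fin M) (Fin M))]
    refine sum_congr rfl fun q _ => ?_
    rw [mul_comm]
    simp only [toeplitz, Matrix.of_apply, Equiv.sumComm_apply, id]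
    congr 1
    · congr 1
      rw [winExp_swap]
      simp only [winExp, Sum.elim_inl, Sum.elim_inr]
      ring_nf
    · simp [Y, winDual, winMatrix, winSeries, ι]
  -- Jacobi's argument for complementary minors: completing $A$ by unit vectors makes both sides
  -- block triangular, so $\det Z\cdot\det(\text{upper block of }A)=\det Z_{22}$. As $\det T(G)=1$,
  -- $\det Z=\det Y$.
  have hmul : Z * Matrix.fromBlocks (upperRows A) 0 (A.submatrix Sum.inr id) 1 =
      Matrix.fromBlocks 1 (Z.submatrix Sum.inl Sum.inr) 0 (Z.submatrix Sum.inr Sum.inr) := by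
    ext1 p q
    rcases q with q | q
    · have h1 := congrFun (congrFun hZA p) q
      rw [Matrix.mul_apply] at h1 ⊢
      have h2 : ∀ r, Matrix.fromBlocks (upperRows A) 0 (A.submatrix Sum.inr id)
          (1 : Matrix (Fin M) (Fin M) (MvPowerSeries ℕ+ k)) r (Sum.inl q) =
          A r q := by rintro (r | r) <;> rfl
      simp only [h2]
      rw [h1]
      rcases p with p | p <;> rfl
    · rw [Matrix.mul_apply, sum_eq_single (Sum.inr q)]
      · rw [Matrix.fromBlocks_apply₂₂, Matrix.one_apply_eq, mul_one]
        rcases p with p | p <;> rfl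
      · rintro (r | r) _ hr
        · rw [Matrix.fromBlocks_apply₁₂, Matrix.zero_apply, mul_zero]
        · rw [Matrix.fromBlocks_apply₂₂, Matrix.one_apply_ne (fun h => hr (congrArg Sum.inr h)),
            mul_zero]
      · simp
  have hdet := congrArg Matrix.det hmul
  rw [Matrix.det_mul, Matrix.det_fromBlocks_zero₁₂, Matrix.det_fromBlocks_zero₂₁, Matrix.det_one,
    mul_one, one_mul, hcol, Matrix.det_transpose, hZ, Matrix.det_mul,
    det_toeplitz hG hb, mul_one] at hdet
  rw [← hdet]
  congr 1
  exact RingHom.map_det ι Y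

variable [CharZero k]

theorem isIsobaric_vSeries : IsIsobaric (vSeries k) (expCoeff k) := coeff_vSeries k

theorem isIsobaric_vInv :
    IsIsobaric (vInv k) fun d => (-1) ^ d.degree * expCoeff k d := by
  intro d
  rw [vInv_eq_negTime, coeff_negTime, coeff_vSeries, ← mul_assoc, map_mul,
    map_pow, map_neg, map_one]

theorem negTime_zCoeff_vSeries_mul (n : ℤ) (f : LaurentSeries k) :
    negTime (zCoeff n (vSeries k * MvPowerSeries.C f)) =
      zCoeff n (vInv k * MvPowerSeries.C f) := by
  ext d
  rw [coeff_negTime, coeff_zCoeff, coeff_zCoeff, MvPowerSeries.coeff_mul_C,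
    MvPowerSeries.coeff_mul_C, isIsobaric_vSeries, isIsobaric_vInv, mul_assoc, mul_assoc,
    coeff_C_mul, coeff_C_mul, mul_assoc]

theorem negTime_det_tauMatrix (w : ℕ → LaurentSeries k) (M : ℕ) :
    negTime (tauMatrix w M).det = (Matrix.of fun l i : Fin M =>
      zCoeff (-((l : ℕ) + 1 : ℤ)) (vInv k * MvPowerSeries.C (w i))).det := by
  refine (RingHom.map_det (MvPowerSeries.rescale fun _ => (-1 : k)) _).trans ?_
  congr 1
  ext1 l i
  exact negTime_zCoeff_vSeries_mul _ _

/-- The complementary minor identity gives a factor $y_M$ for each large $M$. If $\tau\ne0$, a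
nonzero coefficient of $\tau$ determines $y_M$ once its corner determinants have stabilised, so all
later $y_M$ coincide. If $\tau=0$, the limit gives $\tau'(-t)=0$ and any constant serves. -/
theorem exists_negTime_eq {W W' : Submodule k (LaurentSeries k)}
    (horth : ∀ f ∈ W, ∀ h ∈ W', resForm k f h = 0)
    {w w' : ℕ → LaurentSeries k} (hw : IsAdmissibleBasis W w) (hw' : IsAdmissibleBasis W' w')
    {τ τ' : MvPowerSeries ℕ+ k}
    (hτ : ∀ d : ℕ+ →₀ ℕ, ∀ᶠ m in Filter.atTop,
      MvPowerSeries.coeff d (tauMatrix w m).det = MvPowerSeries.coeff d τ)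
    (hτ' : ∀ d : ℕ+ →₀ ℕ, ∀ᶠ m in Filter.atTop,
      MvPowerSeries.coeff d (tauMatrix w' m).det = MvPowerSeries.coeff d τ') :
    ∃ c : k, c ≠ 0 ∧ negTime τ' = MvPowerSeries.C c * τ := by
  obtain ⟨N, hN⟩ := hw.exists_bound
  obtain ⟨N', hN'⟩ := hw'.exists_bound
  have horth' : ∀ f ∈ W', ∀ h ∈ W, resForm k f h = 0 := fun f hf h hh => by
    rw [resForm_comm]; exact horth h hh f hf
  have hfin : ∀ M ≥ N + N', ∃ y : k, y ≠ 0 ∧ ∀ d, timeWeight d ≤ M →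
      y * MvPowerSeries.coeff d (tauMatrix w M).det =
        MvPowerSeries.coeff d (negTime (tauMatrix w' M).det) := by
    intro M hM
    obtain ⟨h1, h2⟩ := hN M (by omega)
    obtain ⟨h1', h2'⟩ := hN' M (by omega)
    obtain ⟨L, hL⟩ := exists_left_inverse_winMatrix hw.linearIndependent h1 (by
      rw [hw.span_eq]
      exact fun x hx hxM => eq_zero_of_mem_zPlus horth h2' hx hxM)
    obtain ⟨K, hK⟩ := exists_right_inverse_winDual hw'.linearIndependent h1' (by
      rw [hw'.span_eq]
      exact fun x hx hxM => eq_zero_of_mem_zPlus horth' h2 hx hxM)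
    obtain ⟨y, hy, hdet⟩ := exists_ne_zero_det_upperRows isIsobaric_vSeries isIsobaric_vInv
      (by simp [expCoeff_zero]) (by rw [mul_comm, vSeries_mul_vInv]) hL hK
      (winDual_mul_winMatrix h1 h1' fun i j => horth _ (hw.mem i) _ (hw'.mem j))
    refine ⟨y, hy, fun d hd => ?_⟩
    have e1 := coeff_det_eq_of_coeff_eq (B := tauMatrix w M)
      (fun l i d hd => coeff_upperRows_toeplitz_mul isIsobaric_vSeries w l i hd) hd
    have e2 := coeff_det_eq_of_coeff_eq (B := Matrix.of fun l i : Fin M =>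
      zCoeff (-((l : ℕ) + 1 : ℤ)) (vInv k * MvPowerSeries.C (w' i)))
      (fun l i d hd => coeff_upperRows_toeplitz_mul isIsobaric_vInv w' l i hd) hd
    rw [negTime_det_tauMatrix, ← e2, ← hdet, MvPowerSeries.coeff_C_mul, e1]
  have hlim : ∀ d, ∀ᶠ M in Filter.atTop, M ≥ N + N' ∧ timeWeight d ≤ M ∧
      MvPowerSeries.coeff d (tauMatrix w M).det = MvPowerSeries.coeff d τ ∧
      MvPowerSeries.coeff d (negTime (tauMatrix w' M).det) =
        MvPowerSeries.coeff d (negTime τ') := by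
    intro d
    filter_upwards [Filter.eventually_ge_atTop (N + N'),
      Filter.eventually_ge_atTop (timeWeight d), hτ d, hτ' d] with M a1 a2 a3 a4
    exact ⟨a1, a2, a3, by rw [coeff_negTime, coeff_negTime, a4]⟩
  by_cases h0 : τ = 0
  · refine ⟨1, one_ne_zero, ?_⟩
    ext d
    obtain ⟨M, hM, hd, a3, a4⟩ := (hlim d).exists
    obtain ⟨y, -, hy⟩ := hfin M hM
    rw [← a4, ← hy d hd, a3, h0]
    simp
  · obtain ⟨d₀, hd₀⟩ : ∃ d, MvPowerSeries.coeff d τ ≠ 0 := by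
      by_contra hcon
      push Not at hcon
      exact h0 (MvPowerSeries.ext fun d => by rw [hcon d, map_zero])
    have hc : ∀ d, ∃ y : k, y ≠ 0 ∧
        y * MvPowerSeries.coeff d₀ τ = MvPowerSeries.coeff d₀ (negTime τ') ∧
        y * MvPowerSeries.coeff d τ = MvPowerSeries.coeff d (negTime τ') := by
      intro d
      obtain ⟨M, ⟨hM, hd, a3, a4⟩, -, hd', a3', a4'⟩ := ((hlim d).and (hlim d₀)).exists
      obtain ⟨y, hy0, hy⟩ := hfin M hM
      exact ⟨y, hy0, by rw [← a3', ← a4', hy d₀ hd'], by rw [← a3, ← a4, hy d hd]⟩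
    obtain ⟨c, hc0, hc1, -⟩ := hc d₀
    refine ⟨c, hc0, ?_⟩
    ext d
    obtain ⟨y, -, hy1, hy2⟩ := hc d
    rw [MvPowerSeries.coeff_C_mul, ← hy2, mul_right_cancel₀ hd₀ (hy1.trans hc1.symm)]

/-- The `τ`-function of `U^⊥` is `τ_U(-t)`, up to a nonzero constant. -/
theorem exists_negTime_tau_orth_eq {U : Submodule k (LaurentSeries k)}
    [FiniteDimensional k ↥(U ⊓ VPlus k)] {τ τ' : MvPowerSeries ℕ+ k} (hτ : IsTauFunction U τ)
    (hτ' : IsTauFunction (orth U) τ') :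
    ∃ c : k, c ≠ 0 ∧ negTime τ' = MvPowerSeries.C c * τ := by
  obtain ⟨w, hw, hlim⟩ := hτ
  obtain ⟨w', hw', hlim'⟩ := hτ'
  rw [index_orth] at hw'
  exact exists_negTime_eq (fun f hf h hh => resForm_homothety_orth hf hh) hw hw' hlim hlim'

end Duality

/-! ### The residue condition in terms of coefficients -/

section Residue

variable {k : Type*} [Field k]

theorem inVars_injective {R : Type*} [CommRing R] (a : Fin 3) :
    Function.Injective (inVars (R := R) a) :=
  MvPowerSeries.rename_injective _

theorem inVars_ne_zero {R : Type*} [CommRing R] (a : Fin 3) {F : MvPowerSeries ℕ+ R}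
    (hF : F ≠ 0) : inVars a F ≠ 0 := fun h =>
  hF (inVars_injective a (h.trans (map_zero (MvPowerSeries.rename _)).symm))

theorem residue_tmul (c : TimeField k) (F : MvPowerSeries (Fin 3 × ℕ+) (LaurentSeries k)) :
    residue k (c ⊗ₜ F) = zCoeff (-1) F • c := by
  rw [residue, LinearMap.comp_apply, LinearMap.lTensor_tmul]
  exact TensorProduct.rid_tmul _ _

theorem residue_tmul_eq_zero_iff {c : TimeField k} (hc : c ≠ 0)
    (F : MvPowerSeries (Fin 3 × ℕ+) (LaurentSeries k)) :
    residue k (c ⊗ₜ F) = 0 ↔ zCoeff (-1) F = 0 := by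
  rw [residue_tmul, Algebra.smul_def, mul_eq_zero, or_iff_left hc,
    map_eq_zero_iff _ (IsFractionRing.injective _ _)]

variable [CharZero k]

theorem bakerProduct_eq (τ τ' : MvPowerSeries ℕ+ k) (n : ℤ) :
    baker 0 τ * baker 1 τ * bakerAdj 2 τ' * zpowBaker k n =
      ((algebraMap (MvPowerSeries (Fin 3 × ℕ+) k) (TimeField k) (inVars 0 τ))⁻¹ *
        (algebraMap (MvPowerSeries (Fin 3 × ℕ+) k) (TimeField k) (inVars 1 τ))⁻¹ *
        (algebraMap (MvPowerSeries (Fin 3 × ℕ+) k) (TimeField k)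
          (inVars 2 (negTime τ')))⁻¹) ⊗ₜ
      (inVars 0 (bakerNum τ) * inVars 1 (bakerNum τ) * inVars 2 (negTime (bakerNum τ')) *
        MvPowerSeries.C (zpow k n)) := by
  rw [baker, baker, bakerAdj, zpowBaker, frac, frac, frac,
    Algebra.TensorProduct.tmul_mul_tmul, Algebra.TensorProduct.tmul_mul_tmul,
    Algebra.TensorProduct.tmul_mul_tmul, mul_one]

/-- Nonvanishing of the $\tau$-functions makes the inverted denominators a nonzero scalar, which can
be cancelled since $k\{\{t,t',t''\}\}$ embeds in its fraction field. -/
theorem residue_bakerProduct_eq_zero_iff {τ τ' : MvPowerSeries ℕ+ k} (hτ : τ ≠ 0)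
    (hτ' : negTime τ' ≠ 0) (n : ℤ) :
    residue k (baker 0 τ * baker 1 τ * bakerAdj 2 τ' * zpowBaker k n) = 0 ↔
      ∀ e : Fin 3 → ℕ+ →₀ ℕ,
        (MvPowerSeries.coeff (e 0) (bakerNum τ) * MvPowerSeries.coeff (e 1) (bakerNum τ) *
          MvPowerSeries.coeff (e 2) (negTime (bakerNum τ'))).coeff (-1 - n) = 0 := by
  have h : ∀ (a : Fin 3) {F : MvPowerSeries ℕ+ k}, F ≠ 0 →
      (algebraMap (MvPowerSeries (Fin 3 × ℕ+) k) (TimeField k) (inVars a F))⁻¹ ≠ 0 :=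
    fun a F hF => inv_ne_zero ((map_ne_zero_iff _ (IsFractionRing.injective _ _)).2
      (inVars_ne_zero a hF))
  have hcoeff : ∀ u, MvPowerSeries.coeff u (zCoeff (-1) (inVars 0 (bakerNum τ) *
      inVars 1 (bakerNum τ) * inVars 2 (negTime (bakerNum τ')) * MvPowerSeries.C (zpow k n))) =
      (MvPowerSeries.coeff u (inVars 0 (bakerNum τ) * inVars 1 (bakerNum τ) *
        inVars 2 (negTime (bakerNum τ')))).coeff (-1 - n) := fun u => by
    rw [← coeff_zpow_mul, mul_comm (zpow k n), ← MvPowerSeries.coeff_mul_C]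
    rfl
  have htriple := coeff_inVars_mul
    (fun a : Fin 3 => if a = 2 then negTime (bakerNum τ') else bakerNum τ)
  simp only [show (0 : Fin 3) ≠ 2 by decide, show (1 : Fin 3) ≠ 2 by decide, if_true,
    if_false] at htriple
  rw [bakerProduct_eq, residue_tmul_eq_zero_iff (mul_ne_zero (mul_ne_zero (h 0 hτ) (h 1 hτ))
    (h 2 hτ'))]
  constructor
  · intro h0 e
    rw [← htriple, ← hcoeff, h0, map_zero]
  · intro h0
    ext u
    obtain ⟨e, rfl⟩ := exists_eq_inExp_add u
    rw [hcoeff, htriple, h0, map_zero]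

end Residue

/-! ### Passage to Schur polynomials -/

section Trilinear

variable {k : Type*} [Field k]

/-- One slot is freed at a time: a linear functional vanishing on a spanning family is zero. Used
for monomials and again for Schur polynomials, it makes the two tests equivalent. -/
theorem forall_trilinear_eq_zero_iff {V A : Type*} [AddCommGroup V] [Module k V] [CommRing A]
    (φ : A → k) (L : Fin 3 → V → A) (hL : ∀ a f, ∃ T : V →ₗ[k] k, ∀ x, T x = φ (f * L a x))
    {ι : Type*} {v : Fin 3 → ι → V} (hv : ∀ a, Submodule.span k (Set.range (v a)) = ⊤) :
    (∀ i : Fin 3 → ι, φ (L 0 (v 0 (i 0)) * L 1 (v 1 (i 1)) * L 2 (v 2 (i 2))) = 0) ↔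
      ∀ x : Fin 3 → V, φ (L 0 (x 0) * L 1 (x 1) * L 2 (x 2)) = 0 := by
  refine ⟨fun h x => ?_, fun h i => h fun a => v a (i a)⟩
  have key : ∀ (a : Fin 3) (f : A), (∀ i, φ (f * L a (v a i)) = 0) → ∀ x, φ (f * L a x) = 0 := by
    intro a f hf x
    obtain ⟨T, hT⟩ := hL a f
    have h0 : T = 0 :=
      LinearMap.ext_on_range (hv a) fun i => by rw [hT, hf, LinearMap.zero_apply]
    rw [← hT, h0, LinearMap.zero_apply]
  have h2 : ∀ i j z, φ (L 0 (v 0 i) * L 1 (v 1 j) * L 2 z) = 0 := fun i j =>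
    key 2 _ fun l => h ![i, j, l]
  have h1 : ∀ i y z, φ (L 0 (v 0 i) * L 2 z * L 1 y) = 0 := fun i y z =>
    key 1 _ (fun j => by rw [mul_right_comm]; exact h2 i j z) y
  have h0 : φ (L 1 (x 1) * L 2 (x 2) * L 0 (x 0)) = 0 :=
    key 0 _ (fun i => by rw [mul_comm, ← mul_assoc, mul_right_comm]; exact h1 i _ _) _
  rwa [mul_assoc, mul_comm]

/-- The value `Q(∂̃) F` at `t = 0`, for polynomials `Q` with coefficients in `k`. -/
def laurentPair (F : MvPowerSeries ℕ+ (LaurentSeries k)) (Q : MvPolynomial ℕ+ k) :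
    LaurentSeries k :=
  pair (timeScale k) F (Q.map (algebraMap k (LaurentSeries k)))

theorem laurentPair_add (F : MvPowerSeries ℕ+ (LaurentSeries k)) (P Q : MvPolynomial ℕ+ k) :
    laurentPair F (P + Q) = laurentPair F P + laurentPair F Q := by
  rw [laurentPair, map_add, map_add]
  rfl

theorem laurentPair_C_mul (F : MvPowerSeries ℕ+ (LaurentSeries k)) (c : k)
    (Q : MvPolynomial ℕ+ k) :
    laurentPair F (MvPolynomial.C c * Q) = HahnSeries.C c * laurentPair F Q := by
  rw [laurentPair, map_mul, MvPolynomial.map_C, MvPolynomial.C_mul', map_smul, smul_eq_mul,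
    algebraMap_laurent]
  rfl

theorem laurentPair_monomial (F : MvPowerSeries ℕ+ (LaurentSeries k)) (e : ℕ+ →₀ ℕ) (a : k) :
    laurentPair F (MvPolynomial.monomial e a) =
      HahnSeries.C (a * pairWeight (timeScale k) e) * MvPowerSeries.coeff e F := by
  rw [laurentPair, MvPolynomial.map_monomial, pair_monomial, algebraMap_laurent,
    algebraMap_laurent, map_mul, mul_assoc]

/-- The coefficients of `f * Q(∂̃) F` at `t = 0` are linear in `Q`. -/
theorem exists_linearMap_coeff_mul_laurentPair (F : MvPowerSeries ℕ+ (LaurentSeries k)) (n : ℤ)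
    (f : LaurentSeries k) :
    ∃ T : MvPolynomial ℕ+ k →ₗ[k] k, ∀ Q, T Q = (f * laurentPair F Q).coeff n :=
  ⟨{toFun := fun Q => (f * laurentPair F Q).coeff n
    map_add' := fun P Q => by rw [laurentPair_add, mul_add, HahnSeries.coeff_add]
    map_smul' := fun c Q => by
      rw [MvPolynomial.smul_eq_C_mul, laurentPair_C_mul, mul_left_comm, coeff_C_mul]
      rfl}, fun _ => rfl⟩

theorem negX_monomial (e : ℕ+ →₀ ℕ) (a : k) :
    negX (MvPolynomial.monomial e a) = MvPolynomial.monomial e ((-1) ^ e.degree * a) := by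
  have h : (e.prod fun i n => (-MvPolynomial.X i : MvPolynomial ℕ+ k) ^ n) =
      MvPolynomial.monomial e ((-1) ^ e.degree) := by
    rw [MvPolynomial.monomial_eq, Finsupp.degree_apply, ← prod_pow_eq_pow_sum, map_prod,
      Finsupp.prod, Finsupp.prod, ← prod_mul_distrib]
    refine prod_congr rfl fun i _ => ?_
    rw [map_pow, map_neg, map_one, ← mul_pow, neg_one_mul]
  rw [negX, MvPolynomial.aeval_monomial, h, MvPolynomial.algebraMap_eq,
    MvPolynomial.C_mul_monomial, mul_comm]

theorem laurentPair_negTime (F : MvPowerSeries ℕ+ (LaurentSeries k)) (Q : MvPolynomial ℕ+ k) :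
    laurentPair (negTime F) Q = laurentPair F (negX Q) := by
  refine MvPolynomial.induction_on' Q (fun e a => ?_) fun P Q hP hQ => ?_
  · rw [negX_monomial, laurentPair_monomial, laurentPair_monomial, coeff_negTime, map_mul, map_mul,
      map_mul, map_pow, map_neg, map_one]
    ring
  · rw [laurentPair_add, hP, hQ, ← laurentPair_add]
    exact congrArg _ (map_add (negXHom k) P Q).symm

theorem pair_negX (F : MvPowerSeries ℕ+ k) (Q : MvPolynomial ℕ+ k) :
    pair (timeScale k) F (negX Q) = pair (timeScale k) (negTime F) Q := by
  refine LinearMap.congr_fun (f := pair (timeScale k) F ∘ₗ (negXHom k).toLinearMap)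
    (g := pair (timeScale k) (negTime F)) (pair_ext fun e => ?_) Q
  rw [LinearMap.comp_apply, AlgHom.toLinearMap_apply, negXHom_apply, negX_monomial,
    pair_monomial, pair_monomial, coeff_negTime, mul_one, one_mul]
  exact mul_left_comm _ _ _

theorem span_monomial_range :
    Submodule.span k (Set.range fun e : ℕ+ →₀ ℕ => MvPolynomial.monomial e (1 : k)) = ⊤ := by
  rw [← MvPolynomial.coe_basisMonomials]
  exact Module.Basis.span_eq _

variable [CharZero k]

theorem timeScale_ne_zero (i : ℕ+) : timeScale k i ≠ 0 :=
  inv_ne_zero (Nat.cast_ne_zero.2 i.ne_zero)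

/-- The vanishing of the products of coefficients of three series may be tested with the
operators given by Schur polynomials. -/
theorem forall_coeff_mul_eq_zero_iff (A B : MvPowerSeries ℕ+ (LaurentSeries k)) (n : ℤ) :
    (∀ e : Fin 3 → ℕ+ →₀ ℕ, (MvPowerSeries.coeff (e 0) A * MvPowerSeries.coeff (e 1) A *
      MvPowerSeries.coeff (e 2) B).coeff n = 0) ↔
    ∀ l : Fin 3 → YoungDiagram, (laurentPair A (negX (schur k (l 0))) *
      laurentPair A (negX (schur k (l 1))) * laurentPair B (schur k (l 2))).coeff n = 0 := by
  let φ : LaurentSeries k → k := fun f => f.coeff n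
  let T : Fin 3 → MvPolynomial ℕ+ k → LaurentSeries k :=
    ![laurentPair A, laurentPair A, laurentPair B]
  have hT : ∀ a f, ∃ S : MvPolynomial ℕ+ k →ₗ[k] k, ∀ Q, S Q = φ (f * T a Q) := by
    intro a f
    fin_cases a <;> exact exists_linearMap_coeff_mul_laurentPair _ n f
  have h1 := forall_trilinear_eq_zero_iff φ T hT
    (v := fun _ (e : ℕ+ →₀ ℕ) => MvPolynomial.monomial e (1 : k)) fun _ => span_monomial_range
  have h2 := forall_trilinear_eq_zero_iff φ T hT
    (v := ![fun μ => negX (schur k μ), fun μ => negX (schur k μ), schur k])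
    (by
      intro a
      fin_cases a
      · exact span_negX_schur
      · exact span_negX_schur
      · exact span_schur)
  refine Iff.trans ?_ (h1.trans h2.symm)
  refine forall_congr' fun e => ?_
  have h3 : laurentPair A (MvPolynomial.monomial (e 0) 1) *
      laurentPair A (MvPolynomial.monomial (e 1) 1) *
      laurentPair B (MvPolynomial.monomial (e 2) 1) =
      HahnSeries.C (pairWeight (timeScale k) (e 0) * pairWeight (timeScale k) (e 1) *
        pairWeight (timeScale k) (e 2)) * (MvPowerSeries.coeff (e 0) A *
          MvPowerSeries.coeff (e 1) A * MvPowerSeries.coeff (e 2) B) := by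
    simp only [laurentPair_monomial, map_mul, map_one]
    ring
  change _ ↔ HahnSeries.coeff (laurentPair A _ * laurentPair A _ * laurentPair B _) n = 0
  rw [h3, coeff_C_mul, mul_eq_zero, or_iff_right]
  exact mul_ne_zero (mul_ne_zero (pairWeight_ne_zero _ timeScale_ne_zero _)
    (pairWeight_ne_zero _ timeScale_ne_zero _)) (pairWeight_ne_zero _ timeScale_ne_zero _)

end Trilinear

/-! ### The coefficients of the triple products -/

section Product

variable {k : Type*} [Field k]

theorem prod_zpow {ι : Type*} (s : Finset ι) (α : ι → ℤ) :
    ∏ i ∈ s, zpow k (α i) = zpow k (∑ i ∈ s, α i) := by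
  classical
  induction s using Finset.induction_on with
  | empty => rfl
  | insert i s hi ih => rw [prod_insert hi, sum_insert hi, ih, zpow_mul_zpow]

theorem coeff_prod_mk {ι : Type*} [Fintype ι] [DecidableEq ι] (u : ι → ℕ → k) (n : ℕ) :
    PowerSeries.coeff n (∏ a, PowerSeries.mk (u a)) =
      ∑ β ∈ piAntidiag (univ : Finset ι) n, ∏ a, u a (β a) := by
  rw [PowerSeries.coeff_prod]
  refine sum_bij (fun l _ => (l : ι → ℕ)) (fun l hl => ?_) (fun l _ l' _ h => ?_)
    (fun β hβ => ?_) fun l _ => ?_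
  · rw [mem_finsuppAntidiag] at hl
    exact mem_piAntidiag.2 ⟨hl.1, fun i _ => mem_univ i⟩
  · exact DFunLike.coe_injective h
  · refine ⟨Finsupp.equivFunOnFinite.symm β, ?_, rfl⟩
    exact mem_finsuppAntidiag.2 ⟨(mem_piAntidiag.1 hβ).1, subset_univ _⟩
  · exact prod_congr rfl fun a _ => PowerSeries.coeff_mk _ _

/-- Choosing a term $z^{-\alpha_a}$ in each factor leaves the exponent $n+\sum\alpha_a$ to be
distributed over the power series. This is the index set of `symbolP`. -/
theorem coeff_prod_sum_zpow_mul {ι : Type*} [Fintype ι] [DecidableEq ι] (m : ι → ℕ)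
    (u : ι → ℕ → ℕ → k) (n : ℕ) :
    (∏ a, ∑ α ∈ range (m a + 1), zpow k (-(α : ℤ)) *
      HahnSeries.ofPowerSeries ℤ k (PowerSeries.mk (u a α))).coeff (n : ℤ) =
      ∑ α ∈ Fintype.piFinset fun a => range (m a + 1),
        ∑ β ∈ piAntidiag (univ : Finset ι) (n + ∑ a, α a), ∏ a, u a (α a) (β a) := by
  rw [prod_univ_sum, HahnSeries.coeff_sum]
  refine sum_congr rfl fun α _ => ?_
  rw [prod_mul_distrib, prod_zpow, coeff_zpow_mul, ← map_prod, ← coeff_prod_mk,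
    ← HahnSeries.ofPowerSeries_apply_coeff (Γ := ℤ)]
  congr 1
  rw [sum_neg_distrib, sub_neg_eq_add]
  push_cast
  rfl

variable [CharZero k]

/-- The substitution $t\mapsto-t$ is adjoint to $x\mapsto-x$. It is moved first to the Schur
polynomial and then back to $\tau$, which reverses the signs in the third factor of $P$. -/
theorem laurentPair_negTime_bakerNum_schur (F : MvPowerSeries ℕ+ k) (ν : YoungDiagram) :
    laurentPair (negTime (bakerNum F)) (schur k ν) =
      ∑ α ∈ range (ν.card + 1), zpow k (-(α : ℤ)) * HahnSeries.ofPowerSeries ℤ k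
        (PowerSeries.mk fun n =>
          pair (timeScale k) (negTime F) (negX (pPoly k n) * stripSum k ν α)) := by
  rw [laurentPair_negTime, laurentPair, pair_bakerNum_negX_schur]
  refine sum_congr rfl fun α _ => ?_
  congr 3
  funext n
  have h : negX (negX (pPoly k n) * stripSum k ν α) = pPoly k n * negX (stripSum k ν α) := by
    rw [← negXHom_apply (_ * _), map_mul, negXHom_apply, negXHom_apply, negX_negX]
  rw [← pair_negX, h]

theorem constantCoeff_diffOp_symbolP (g : ℕ) (l : Fin 3 → YoungDiagram)
    (F : Fin 3 → MvPowerSeries ℕ+ k) :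
    MvPowerSeries.constantCoeff
        (diffOp (symbolP k g l) (inVars 0 (F 0) * inVars 1 (F 1) * inVars 2 (F 2))) =
      ∑ α ∈ Fintype.piFinset fun a => range ((l a).card + 1),
        ∑ β ∈ piAntidiag (univ : Finset (Fin 3)) (1 + g + ∑ a, α a),
          pair (timeScale k) (F 0) (pPoly k (β 0) * negX (stripSum k (l 0) (α 0))) *
          pair (timeScale k) (F 1) (pPoly k (β 1) * negX (stripSum k (l 1) (α 1))) *
          pair (timeScale k) (F 2) (negX (pPoly k (β 2)) * stripSum k (l 2) (α 2)) := by
  rw [constantCoeff_diffOp, symbolP, map_sum]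
  refine sum_congr rfl fun α _ => ?_
  rw [map_sum]
  refine sum_congr rfl fun β _ => ?_
  have hmul : ∀ (a : Fin 3) (P Q : MvPolynomial ℕ+ k), inX a P * inX a Q = inX a (P * Q) :=
    fun a P Q => (map_mul (MvPolynomial.rename (Prod.mk a)) P Q).symm
  rw [hmul, hmul, hmul]
  exact pair_inX_mul F ![_, _, _]

/-- The coefficient of `z ^ (1 + g)` of the triple product of Baker-Akhiezer numerators, tested
with Schur polynomials. -/
theorem coeff_laurentPair_schur_mul {τ τ' : MvPowerSeries ℕ+ k} {c : k}
    (hc : negTime τ' = MvPowerSeries.C c * τ) (g : ℕ) (l : Fin 3 → YoungDiagram) :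
    (laurentPair (bakerNum τ) (negX (schur k (l 0))) *
      laurentPair (bakerNum τ) (negX (schur k (l 1))) *
      laurentPair (negTime (bakerNum τ')) (schur k (l 2))).coeff ((1 + g : ℕ) : ℤ) =
    c * MvPowerSeries.constantCoeff
      (diffOp (symbolP k g l) (inVars 0 τ * inVars 1 τ * inVars 2 τ)) := by
  have h := coeff_prod_sum_zpow_mul (fun a => (l a).card)
    ![fun α n => pair (timeScale k) τ (pPoly k n * negX (stripSum k (l 0) α)),
      fun α n => pair (timeScale k) τ (pPoly k n * negX (stripSum k (l 1) α)),
      fun α n => pair (timeScale k) (negTime τ') (negX (pPoly k n) * stripSum k (l 2) α)]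
    (1 + g)
  simp only [Fin.prod_univ_three] at h
  rw [laurentPair, laurentPair, pair_bakerNum_negX_schur, pair_bakerNum_negX_schur,
    laurentPair_negTime_bakerNum_schur]
  refine h.trans ?_
  rw [constantCoeff_diffOp_symbolP g l fun _ => τ, mul_sum]
  refine sum_congr rfl fun α _ => ?_
  rw [mul_sum]
  refine sum_congr rfl fun β _ => ?_
  change pair (timeScale k) τ _ * pair (timeScale k) τ _ * pair (timeScale k) (negTime τ') _ = _
  rw [hc, pair_C_mul, LinearMap.smul_apply, smul_eq_mul, mul_left_comm]

end Product

/-! ### The degenerate case $\tau=0$ -/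

theorem bakerNum_zero {k : Type*} [Field k] [CharZero k] :
    bakerNum (0 : MvPowerSeries ℕ+ k) = 0 := by
  have h := tauShift_C_mul (0 : k) 0
  rw [mul_zero, map_zero, map_zero, zero_mul] at h
  rw [bakerNum, h, mul_zero]

theorem baker_zero {k : Type*} [Field k] [CharZero k] (a : Fin 3) :
    baker a (0 : MvPowerSeries ℕ+ k) = 0 := by
  rw [baker, frac, bakerNum_zero]
  exact (congrArg _ (map_zero (MvPowerSeries.rename _))).trans (TensorProduct.tmul_zero _ _)

end SatoGr

end

/-! ### The equivalence -/

theorem mainTheorem2 {k : Type*} [Field k] [CharZero k] (g : ℕ)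
    (U : Submodule k (LaurentSeries k)) (hU : IsRationalPoint (1 - (g : ℤ)) U)
    (τ : MvPowerSeries ℕ+ k) (hτ : IsTauFunction U τ)
    (τ' : MvPowerSeries ℕ+ k) (hτ' : IsTauFunction (orth U) τ') :
    residue k (baker 0 τ * baker 1 τ * bakerAdj 2 τ' * zpowBaker k (-(2 + (g : ℤ)))) = 0 ↔
      ∀ l : Fin 3 → YoungDiagram,
        MvPowerSeries.constantCoeff
          (diffOp (symbolP k g l) (inVars 0 τ * inVars 1 τ * inVars 2 τ)) = 0 := by
  have := hU.finite_inf
  obtain ⟨c, hc0, hc⟩ := exists_negTime_tau_orth_eq hτ hτ'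
  by_cases h0 : τ = 0
  -- Nonvanishing of $\tau_U$ is not needed: if $\tau=0$, the numerators and the triple product are
  -- zero and both conditions hold.
  · have h1 : inVars 0 (0 : MvPowerSeries ℕ+ k) = 0 := map_zero (MvPowerSeries.rename _)
    rw [h0, baker_zero, zero_mul, zero_mul, zero_mul, map_zero, h1, zero_mul, zero_mul]
    simp only [map_zero, implies_true]
  · have h1 : negTime τ' ≠ 0 := by
      rw [hc]
      exact mul_ne_zero (fun h => hc0 (MvPowerSeries.C_injective (h.trans (map_zero _).symm))) h0
    -- The residue takes the coefficient of $z^{-1}$, and the factor $z^{-(2+g)}$ moves it to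
    -- $z^{1+g}$ in the product of the numerators.
    rw [residue_bakerProduct_eq_zero_iff h0 h1, forall_coeff_mul_eq_zero_iff,
      show (-1 - -(2 + (g : ℤ))) = ((1 + g : ℕ) : ℤ) by push_cast; ring]
    refine forall_congr' fun l => ?_
    rw [coeff_laurentPair_schur_mul hc, mul_eq_zero, or_iff_right hc0]
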